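/- An instance of \textsc{Restricted Leafed Induced Subtree} consists of a finite simple graph $G$, a vertex $v_0\in V(G)$ and two nonnegative integers $a$ and $b$. The question is whether there is a set $S\subseteq V(G)$ with $|S|=a$ such that the induced subgraph $G[S]$ is a tree that has at least $b$ leaves (vertices of degree $1$ in $G[S]$) and contains $v_0$ as an internal vertex (a vertex of degree at least $2$ in $G[S]$). A graph is chordal if each of its cycles of length at least $4$ has a chord. **Theorem.** \textsc{Restricted Leafed Induced Subtree} on instances $(G,v_0,a,b)$ where $G$ is chordal can be solved in time $O(a^2\cdot n^4)$, where $n$ is the number of vertices of $G$. Precisely, there are a single program for a unit-cost random access machine (with addition, truncated subtraction, multiplication and comparisons of words) and constants $C$ and $k$ such that, for every $n$, every chordal graph $G$ with vertex set $\{0,\dots,n-1\}$, given by its adjacency matrix, every vertex $v_0$ and all integers $a,b\ge 0$, the program halts on input $(G,v_0,a,b)$ with the correct yes/no answer after at most $C\,(a^2n^4+1)$ steps, and all numbers that occur in the computation are at most $(n+a+b+1)^k$ (so words of $O(\log(n+a+b+1))$ bits suffice). The summand $1$ matters only for $a=0$. -/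

import Mathlib

namespace SimpleGraph

/-- A graph is chordal if every cycle of length at least four has a chord, that is, an edge of the
graph which joins two vertices of the cycle and is not an edge of the cycle. -/
def IsChordal {V : Type*} (G : SimpleGraph V) : Prop :=
  ∀ (v : V) (c : G.Walk v v), c.IsCycle → 4 ≤ c.length →
    ∃ x ∈ c.support, ∃ y ∈ c.support, G.Adj x y ∧ s(x, y) ∉ c.edges

/-- A leaf: a vertex of degree one. -/
def IsLeaf {V : Type*} (G : SimpleGraph V) (v : V) : Prop :=
  (G.neighborSet v).ncard = 1

/-- An internal vertex (of a tree): a vertex of degree at least two. -/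
def IsInternal {V : Type*} (G : SimpleGraph V) (v : V) : Prop :=
  2 ≤ (G.neighborSet v).ncard

/-- Restricted Leafed Induced Subtree: `G` has an induced subtree (given by its vertex set `S`) with
exactly `a` vertices and at least `b` leaves that contains `v₀` as an internal vertex. -/
def HasRestrictedLeafedInducedSubtree {V : Type*} (G : SimpleGraph V) (v₀ : V)
    (a b : ℕ) : Prop :=
  ∃ S : Finset V, (G.induce (S : Set V)).IsTree ∧ S.card = a ∧
    (∃ h : v₀ ∈ (S : Set V), (G.induce (S : Set V)).IsInternal ⟨v₀, h⟩) ∧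
    b ≤ {v : (S : Set V) | (G.induce (S : Set V)).IsLeaf v}.ncard

end SimpleGraph

/-! ### A unit-cost random access machine with bounded words

Programs are structured programs over registers and random access arrays, all holding
natural numbers. Register names and array names are fixed in the program text, so that a program
uses finitely many of each; array indices are computed at run time. Every operation (reading a
constant, a register or an array cell, an arithmetic operation, a comparison, a write, a test)
takes one unit of time. The semantics is relative to a bound `W` on the values that fit in a machine
word: an execution exists only if every value that is ever computed, array indices and intermediate
results included, is at most `W`. -/

namespace RAM

/-- The contents of the registers and of the arrays: `arr A i` is the cell `i` of the array `A`. -/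
structure State where
  reg : ℕ → ℕ
  arr : ℕ → ℕ → ℕ

/-- Write `v` to the register `x`. -/
def State.setReg (s : State) (x v : ℕ) : State :=
  { s with reg := Function.update s.reg x v }

/-- Write `v` to the cell `i` of the array `A`. -/
def State.setArr (s : State) (A i v : ℕ) : State :=
  { s with arr := Function.update s.arr A (Function.update (s.arr A) i v) }

/-- The binary word operations; subtraction is truncated at zero, comparisons return 0 or 1. -/
inductive Op where
  | add
  | sub
  | mul
  | lt
  | eq

def Op.eval : Op → ℕ → ℕ → ℕ
  | .add, x, y => x + y
  | .sub, x, y => x - y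
  | .mul, x, y => x * y
  | .lt, x, y => if x < y then 1 else 0
  | .eq, x, y => if x = y then 1 else 0

/-- Expressions: constants, registers, array cells (with a computed index), binary operations. -/
inductive Exp where
  | const (c : ℕ)
  | reg (x : ℕ)
  | arr (A : ℕ) (i : Exp)
  | bin (o : Op) (e f : Exp)

/-- The value of an expression. -/
def Exp.eval (s : State) : Exp → ℕ
  | .const c => c
  | .reg x => s.reg x
  | .arr A i => s.arr A (i.eval s)
  | .bin o e f => o.eval (e.eval s) (f.eval s)

/-- The time to evaluate an expression: the number of its nodes. -/
def Exp.cost : Exp → ℕ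
  | .const _ => 1
  | .reg _ => 1
  | .arr _ i => i.cost + 1
  | .bin _ e f => e.cost + f.cost + 1

/-- The values of the expression and of all its subexpressions fit in a word. -/
def Exp.Fits (W : ℕ) (s : State) : Exp → Prop
  | .const c => c ≤ W
  | .reg x => s.reg x ≤ W
  | .arr A i => i.Fits W s ∧ s.arr A (i.eval s) ≤ W
  | .bin o e f => e.Fits W s ∧ f.Fits W s ∧ o.eval (e.eval s) (f.eval s) ≤ W

/-- Programs. Tests regard nonzero values as true. -/
inductive Prog where
  | nop
  | assign (x : ℕ) (e : Exp)
  | store (A : ℕ) (i e : Exp)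
  | seq (p q : Prog)
  | branch (e : Exp) (p q : Prog)
  | loop (e : Exp) (p : Prog)

/-- `Exec W p s t s'`: with words bounded by `W`, the program `p` started in the state `s` halts
after exactly `t` steps in the state `s'`. -/
inductive Exec (W : ℕ) : Prog → State → ℕ → State → Prop where
  | nop (s : State) : Exec W .nop s 1 s
  | assign (s : State) (x : ℕ) (e : Exp) (he : e.Fits W s) :
      Exec W (.assign x e) s (e.cost + 1) (s.setReg x (e.eval s))
  | store (s : State) (A : ℕ) (i e : Exp) (hi : i.Fits W s) (he : e.Fits W s) :
      Exec W (.store A i e) s (i.cost + e.cost + 1) (s.setArr A (i.eval s) (e.eval s))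
  | seq {s s₁ s₂ : State} {p q : Prog} {t₁ t₂ : ℕ}
      (hp : Exec W p s t₁ s₁) (hq : Exec W q s₁ t₂ s₂) :
      Exec W (.seq p q) s (t₁ + t₂) s₂
  | branch_true {s s₁ : State} {e : Exp} {p q : Prog} {t : ℕ}
      (he : e.Fits W s) (h : e.eval s ≠ 0) (hp : Exec W p s t s₁) :
      Exec W (.branch e p q) s (e.cost + 1 + t) s₁
  | branch_false {s s₁ : State} {e : Exp} {p q : Prog} {t : ℕ}
      (he : e.Fits W s) (h : e.eval s = 0) (hq : Exec W q s t s₁) :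
      Exec W (.branch e p q) s (e.cost + 1 + t) s₁
  | loop_done {s : State} {e : Exp} {p : Prog}
      (he : e.Fits W s) (h : e.eval s = 0) :
      Exec W (.loop e p) s (e.cost + 1) s
  | loop_step {s s₁ s₂ : State} {e : Exp} {p : Prog} {t₁ t₂ : ℕ}
      (he : e.Fits W s) (h : e.eval s ≠ 0) (hp : Exec W p s t₁ s₁)
      (hl : Exec W (.loop e p) s₁ t₂ s₂) :
      Exec W (.loop e p) s (e.cost + 1 + t₁ + t₂) s₂

/-- Executions are deterministic: the final state and the number of steps are determined. -/
theorem Exec.unique {W : ℕ} {p : Prog} {s s₁ : State} {t₁ : ℕ} (h : Exec W p s t₁ s₁) :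
    ∀ {t₂ : ℕ} {s₂ : State}, Exec W p s t₂ s₂ → t₁ = t₂ ∧ s₁ = s₂ := by
  induction h with
  | nop | assign | store => intro t₂ s₂ h'; cases h'; exact ⟨rfl, rfl⟩
  | seq _ _ ih₁ ih₂ =>
    intro t₂ s₂ h'
    cases h' with
    | seq hp hq =>
      obtain ⟨rfl, rfl⟩ := ih₁ hp
      obtain ⟨rfl, rfl⟩ := ih₂ hq
      exact ⟨rfl, rfl⟩
  | branch_true _ h _ ih =>
    intro t₂ s₂ h'
    cases h' with
    | branch_true _ _ hp => obtain ⟨rfl, rfl⟩ := ih hp; exact ⟨rfl, rfl⟩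
    | branch_false _ h0 _ => exact absurd h0 h
  | branch_false _ h _ ih =>
    intro t₂ s₂ h'
    cases h' with
    | branch_true _ h0 _ => exact absurd h h0
    | branch_false _ _ hp => obtain ⟨rfl, rfl⟩ := ih hp; exact ⟨rfl, rfl⟩
  | loop_done _ h =>
    intro t₂ s₂ h'
    cases h' with
    | loop_done => exact ⟨rfl, rfl⟩
    | loop_step _ h0 => exact absurd h h0
  | loop_step _ h _ _ ih₁ ih₂ =>
    intro t₂ s₂ h'
    cases h' with
    | loop_done _ h0 => exact absurd h0 h
    | loop_step _ _ hp hl =>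
      obtain ⟨rfl, rfl⟩ := ih₁ hp
      obtain ⟨rfl, rfl⟩ := ih₂ hl
      exact ⟨rfl, rfl⟩

open Classical in
/-- With words bounded by `W`, the program `p` started in the state `s` halts after at most `T`
steps, and its answer, found in the register 0, is 1 if `Q` holds and 0 otherwise. -/
def Prog.DecidesWithin (p : Prog) (W T : ℕ) (s : State) (Q : Prop) : Prop :=
  ∃ (t : ℕ) (s' : State), Exec W p s t s' ∧ t ≤ T ∧ s'.reg 0 = if Q then 1 else 0

open Classical in
/-- The initial state for an instance `(G, v₀, a, b)` with vertices `0, …, n - 1`: the registers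
0, 1, 2, 3 hold `n`, `v₀`, `a`, `b`, the array 0 holds the adjacency matrix of `G` row by row, and
everything else is zero. -/
noncomputable def input {n : ℕ} (G : SimpleGraph (Fin n)) (v₀ : Fin n) (a b : ℕ) : State where
  reg x := if x = 0 then n else if x = 1 then v₀ else if x = 2 then a else if x = 3 then b else 0
  arr A i := if A = 0 ∧ ∃ u v : Fin n, i = u * n + v ∧ G.Adj u v then 1 else 0

end RAM

/-! The combinatorial core is a local-to-global principle for chordal graphs
(`IsChordal.isPath_of_isLocal`): a walk in which vertices at distance two are distinct and
nonadjacent is already an induced path, since a shortest counterexample would close up to a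
chordless cycle. Hence an induced tree can be recognised by local conditions: siblings are
nonadjacent and no vertex is adjacent to its grandparent. This is the content of `HasBranch`.
Cutting a tree at an edge `v₀ w` gives two branches, one on each side, and conversely any two
branches hung on the two ends of that edge form an induced tree
(`IsChordal.hasRestrictedLeafedInducedSubtree_iff`). The two branches need no consistency check.

The largest number of leaves of a branch with root `v` below `u` and given size depends on the best
independent set of children among the neighbours of `v` that are not adjacent to `u`, each child
carrying an optimal branch of its own. To optimise over independent sets, take a perfect elimination
order, which exists by Dirac's theorem, and its elimination tree, where the parent of `x` is the
first later neighbour of `x`. Adjacent vertices are comparable in this tree, so the subtrees of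
distinct siblings do not interact. If `x` is chosen, the descendants of `x` adjacent to it become
forbidden. A vertex `s` forbidden earlier, later than `x` and not adjacent to it, has no neighbours
among these descendants (`IsElimination.eq_or_adj_of_mem_descUpTo`). Thus a single forbidden vertex
is all that has to be remembered, and `IsElimination.choice_descSib` is a recurrence over earlier
siblings, `x` itself and the children of `x`.

The table therefore has the five parameters size, `u`, `v`, `x` and forbidden vertex `z`, so `O(a
n⁴)` entries. Each is a maximum over `O(a)` ways to split the size, whence `O(a² n⁴)`. The
elimination order is found by brute force in `O(n⁴)`. The rest is a verification of the program by
loop invariants that bound the running time and the word size together. -/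

namespace SimpleGraph

/-! ### Local walks in chordal graphs -/

variable {V : Type*} {G : SimpleGraph V}

/-- A walk is local if vertices at distance two along it are distinct and not adjacent. -/
def Walk.IsLocal {u v : V} (p : G.Walk u v) : Prop :=
  ∀ i, i + 2 ≤ p.length →
    p.getVert i ≠ p.getVert (i + 2) ∧ ¬ G.Adj (p.getVert i) (p.getVert (i + 2))

theorem Walk.isLocal_cons_iff {u v w : V} (h : G.Adj u v) (p : G.Walk v w) :
    (Walk.cons h p).IsLocal ↔
      p.IsLocal ∧ (1 ≤ p.length → u ≠ p.getVert 1 ∧ ¬ G.Adj u (p.getVert 1)) := by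
  constructor
  · intro hl
    refine ⟨fun i hi => ?_, fun h1 => ?_⟩
    · have := hl (i + 1) (by simp; omega)
      simpa [Walk.getVert_cons_succ, show i + 1 + 2 = (i + 2) + 1 by ring] using this
    · have := hl 0 (by simp; omega)
      simpa using this
  · rintro ⟨hp, h1⟩ i hi
    rcases i with _ | i
    · have := h1 (by simp at hi; omega)
      simpa using this
    · have := hp i (by simp at hi; omega)
      simpa [show i + 1 + 2 = (i + 2) + 1 by ring] using this

/-- In a chordal graph, local walks are induced paths. -/
theorem IsChordal.isPath_of_isLocal (hG : G.IsChordal) {u v : V} (p : G.Walk u v)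
    (hp : p.IsLocal) : p.IsPath ∧
      ∀ i j, i + 2 ≤ j → j ≤ p.length → ¬ G.Adj (p.getVert i) (p.getVert j) := by
  -- Removing the first or the last vertex leaves a shorter local walk, so the induction settles
  -- every pair of vertices except the two ends of the walk.
  induction hn : p.length using Nat.strong_induction_on generalizing u v with
  | _ n ih =>
  subst hn
  cases p with
  | nil => exact ⟨by simp, fun i j h1 h2 => by simp at h2; omega⟩
  | @cons u w v h q =>
    obtain ⟨hq, -⟩ := (Walk.isLocal_cons_iff h q).1 hp
    obtain ⟨qpath, qind⟩ := ih q.length (by simp) q hq rfl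
    set p := Walk.cons h q with hpdef
    have hlen : p.length = q.length + 1 := by simp [hpdef]
    have hsucc : ∀ i, p.getVert (i + 1) = q.getVert i := fun i => by
      simp [hpdef]
    have hd : (p.take q.length).length = q.length := by simp [Walk.take_length, hlen]
    have hdv : ∀ i ≤ q.length, (p.take q.length).getVert i = p.getVert i := fun i hi => by
      rw [Walk.take_getVert, min_eq_right hi]
    have hdl : (p.take q.length).IsLocal := by
      intro i hi
      rw [hd] at hi
      rw [hdv _ (by omega), hdv _ (by omega)]
      exact hp i (by omega)
    obtain ⟨dpath, dind⟩ := ih q.length (by omega) (p.take q.length) hdl hd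
    have hp0 : p.getVert 0 = u := by simp
    have hpl : p.getVert (q.length + 1) = v := by rw [← hlen]; simp
    have dind' : ∀ i j, i + 2 ≤ j → j ≤ q.length → ¬ G.Adj (p.getVert i) (p.getVert j) := by
      intro i j h1 h2
      have := dind i j h1 h2
      rwa [hdv _ (by omega), hdv _ (by omega)] at this
    -- If the ends coincided, the last edge would join the start to the last vertex but one, a chord
    -- of the initial part. The short walks are excluded by looplessness and by locality.
    have hne : u ≠ v := by
      intro huv
      rcases Nat.lt_or_ge q.length 2 with h2 | h2
      · interval_cases hq : q.length
        · have : w = v := Walk.eq_of_length_eq_zero hq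
          rw [this, huv] at h
          exact h.ne rfl
        · have := (hp 0 (by omega)).1
          rw [hp0] at this
          exact this (by rw [← hpl] at huv; exact huv)
      · apply dind' 0 q.length (by omega) le_rfl
        have := p.adj_getVert_succ (i := q.length) (by omega)
        rw [hpl] at this
        rw [hp0]
        have h3 : G.Adj v (p.getVert q.length) := this.symm
        exact Eq.subst (motive := fun z => G.Adj z (p.getVert q.length)) huv.symm h3
    have hpath : p.IsPath := by
      rw [hpdef, Walk.cons_isPath_iff]
      refine ⟨qpath, fun hu => ?_⟩
      obtain ⟨j, hj, hjl⟩ := Walk.mem_support_iff_exists_getVert.1 hu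
      rcases Nat.lt_or_ge j q.length with h1 | h1
      · have := dpath.getVert_injOn (show 0 ∈ {i | i ≤ (p.take q.length).length} by simp)
          (show j + 1 ∈ {i | i ≤ (p.take q.length).length} by
            rw [Set.mem_ofPred_eq, hd]; omega) (by
          rw [hdv _ (by omega), hdv _ (by omega), hsucc, hj, hp0])
        omega
      · have : j = q.length := by omega
        subst this
        simp at hj
        exact hne hj.symm
    refine ⟨hpath, fun i j hij hj => ?_⟩
    rcases Nat.eq_zero_or_pos i with rfl | hi
    · rcases Nat.lt_or_ge q.length j with h1 | h1
      · have hj : j = q.length + 1 := by omega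
        subst hj
        rw [hp0, hpl]
        intro huv
        rcases Nat.lt_or_ge q.length 2 with h2 | h2
        · have := (hp 0 (by omega)).2
          rw [hp0, show 0 + 2 = q.length + 1 by omega, hpl] at this
          exact this huv
        · have hns : s(v, u) ∉ p.edges := by
            intro he
            rw [hpdef, Walk.edges_cons, List.mem_cons] at he
            rcases he with he | he
            · have : v = w := by
                rcases Sym2.eq_iff.1 he with h3 | h3
                · exact absurd h3.1.symm hne
                · exact h3.1
              subst this
              have := Walk.length_eq_zero_iff.2 (Walk.isPath_iff_nil.1 qpath)
              omega
            · have := Walk.snd_mem_support_of_mem_edges q he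
              rw [hpdef, Walk.cons_isPath_iff] at hpath
              exact hpath.2 this
          obtain ⟨x, hx, y, hy, hxy, hc⟩ := hG v (Walk.cons huv.symm p)
            ((Walk.cons_isCycle_iff p huv.symm).2 ⟨hpath, hns⟩) (by simp; omega)
          have hsup : ∀ x ∈ (Walk.cons huv.symm p).support, ∃ i ≤ p.length, p.getVert i = x := by
            intro x hx
            rw [Walk.support_cons, List.mem_cons] at hx
            rcases hx with rfl | hx
            · exact ⟨p.length, le_rfl, by simp⟩
            · obtain ⟨j, hj, hjl⟩ := Walk.mem_support_iff_exists_getVert.1 hx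
              exact ⟨j, hjl, hj⟩
          -- If the ends were adjacent, the walk would close up to a cycle of length at least four.
          -- By the induction hypotheses every edge between its vertices is an edge of the cycle, so
          -- chordality is violated.
          have key : ∀ i j, i < j → j ≤ p.length → G.Adj (p.getVert i) (p.getVert j) →
              s(p.getVert i, p.getVert j) ∈ (Walk.cons huv.symm p).edges := by
            intro i j hij hj hadj
            rw [Walk.edges_cons, List.mem_cons]
            rcases Nat.lt_or_ge (i + 1) j with h3 | h3
            · rcases Nat.eq_zero_or_pos i with rfl | hi
              · rcases Nat.lt_or_ge q.length j with h4 | h4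
                · left
                  have : j = q.length + 1 := by omega
                  subst this
                  rw [hp0, hpl, Sym2.eq_swap]
                · exact absurd hadj (dind' 0 j (by omega) h4)
              · exfalso
                obtain ⟨i, rfl⟩ : ∃ i', i = i' + 1 := ⟨i - 1, by omega⟩
                obtain ⟨j, rfl⟩ : ∃ i', j = i' + 1 := ⟨j - 1, by omega⟩
                rw [hsucc, hsucc] at hadj
                exact qind i j (by omega) (by omega) hadj
            · right
              have : j = i + 1 := by omega
              subst this
              rw [Walk.edges_eq_zipWith_support]
              rw [List.mem_iff_getElem]
              refine ⟨i, ?_, ?_⟩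
              · simp; omega
              · simp [Walk.support_getElem_eq_getVert]
          obtain ⟨i, hi, rfl⟩ := hsup x hx
          obtain ⟨j, hj, rfl⟩ := hsup y hy
          rcases lt_trichotomy i j with h3 | h3 | h3
          · exact hc (key i j h3 hj hxy)
          · subst h3; exact hxy.ne rfl
          · rw [Sym2.eq_swap] at hc
            exact hc (key j i h3 hi hxy.symm)
      · exact dind' 0 j hij h1
    · obtain ⟨i, rfl⟩ : ∃ i', i = i' + 1 := ⟨i - 1, by omega⟩
      obtain ⟨j, rfl⟩ : ∃ i', j = i' + 1 := ⟨j - 1, by omega⟩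
      rw [hsucc, hsucc]
      exact qind i j (by omega) (by omega)

end SimpleGraph

/-! ### Reachability by local walks, and Dirac's theorem -/

namespace SimpleGraph

variable {V : Type*} {G : SimpleGraph V}

/-- `G.LocalReach S k u v y`: there is a local walk of length `k` with first edge `u v` and end `y`,
all of whose vertices but the first lie in `S`. -/
inductive LocalReach (G : SimpleGraph V) (S : Set V) : ℕ → V → V → V → Prop
  | edge {u v : V} (h : G.Adj u v) (hv : v ∈ S) : LocalReach G S 1 u v v
  | cons {k : ℕ} {u v w y : V} (h : G.Adj u v) (hv : v ∈ S) (hne : u ≠ w) (hna : ¬ G.Adj u w)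
      (hr : LocalReach G S k v w y) : LocalReach G S (k + 1) u v y

namespace LocalReach

variable {S T : Set V} {k l : ℕ} {u v w y y' : V}

theorem mono (hST : S ⊆ T) (h : G.LocalReach S k u v y) : G.LocalReach T k u v y := by
  induction h with
  | edge h hv => exact .edge h (hST hv)
  | cons h hv hne hna _ ih => exact .cons h (hST hv) hne hna ih

theorem adj (h : G.LocalReach S k u v y) : G.Adj u v := by
  cases h <;> assumption

theorem snd_mem (h : G.LocalReach S k u v y) : v ∈ S := by
  cases h <;> assumption

theorem mem (h : G.LocalReach S k u v y) : y ∈ S := by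
  induction h <;> assumption

theorem pos (h : G.LocalReach S k u v y) : 1 ≤ k := by
  cases h <;> omega

theorem exists_walk (h : G.LocalReach S k u v y) :
    ∃ p : G.Walk u y, p.length = k ∧ p.IsLocal ∧ p.getVert 1 = v := by
  induction h with
  | edge h hv =>
    exact ⟨.cons h .nil, by simp, fun i hi => by simp at hi, by simp⟩
  | cons h hv hne hna hr ih =>
    obtain ⟨p, hl, hp, h1⟩ := ih
    refine ⟨.cons h p, by simp [hl], ?_, by simp⟩
    rw [Walk.isLocal_cons_iff]
    exact ⟨hp, fun _ => by rw [h1]; exact ⟨hne, hna⟩⟩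

theorem ne (hG : G.IsChordal) (h : G.LocalReach S k u v y) : u ≠ y := by
  obtain ⟨p, hl, hp, -⟩ := h.exists_walk
  have := (hG.isPath_of_isLocal p hp).1
  rintro rfl
  have h0 := Walk.length_eq_zero_iff.2 (Walk.isPath_iff_nil.1 this)
  have := h.pos
  omega

theorem not_adj (hG : G.IsChordal) (h : G.LocalReach S k u v y) (hk : 2 ≤ k) : ¬ G.Adj u y := by
  obtain ⟨p, hl, hp, -⟩ := h.exists_walk
  have := (hG.isPath_of_isLocal p hp).2 0 k (by omega) (by omega)
  rw [← hl] at this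
  simpa using this

/-- The two walks traverse a common edge in opposite directions. Reversing the first and continuing
along the second is again local, because any three consecutive vertices lie on one of the two. The
common edge is counted once, hence `k + l - 1`. -/
theorem glue (h : G.LocalReach S k v w y) (h' : G.LocalReach S l w v y') :
    ∃ z, G.LocalReach S (k + l - 1) y z y' := by
  induction h generalizing l with
  | @edge v w _ _ => exact ⟨v, by rwa [Nat.add_sub_cancel_left]⟩
  | @cons k u v w y hh hv hne hna hr ih =>
    obtain ⟨z, hz⟩ := ih (.cons hr.adj.symm hv hne.symm (fun h => hna h.symm) h')
    exact ⟨z, by convert hz using 1; omega⟩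

/-- Walks that leave `v` towards distinct nonadjacent vertices join at `v` to a local walk of length
at least two, and chordality applies to its ends. This is what keeps the branches of different
children apart. -/
theorem glue_of_not_adj (hG : G.IsChordal) (h : G.LocalReach S k v w y)
    (h' : G.LocalReach T l v w' y') (hne : w ≠ w') (hna : ¬ G.Adj w w') :
    y ≠ y' ∧ ¬ G.Adj y y' := by
  obtain ⟨z, hz⟩ := (h.mono (Set.subset_univ _)).glue
    (.cons h.adj.symm (Set.mem_univ _) hne hna (h'.mono (Set.subset_univ _)))
  have := h.pos
  have := h'.pos
  exact ⟨hz.ne hG, hz.not_adj hG (by omega)⟩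

end LocalReach

/-- A repetition or an edge at distance two would give a shortcut, so shortest walks inside `T` are
local. -/
theorem Walk.localReach_of_minimal {T : Set V} {u y : V} (p : G.Walk u y)
    (hp : ∀ z ∈ p.support, z ∈ T) (huy : u ≠ y)
    (hmin : ∀ q : G.Walk u y, (∀ z ∈ q.support, z ∈ T) → p.length ≤ q.length) :
    G.LocalReach T p.length u (p.getVert 1) y := by
  induction p with
  | nil => exact absurd rfl huy
  | @cons u v y h q ih =>
    cases q with
    | nil => simpa using LocalReach.edge h (hp _ (by simp))
    | @cons _ w _ h' q' =>
      have hvy : v ≠ y := by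
        rintro rfl
        have := hmin (.cons h .nil) (fun z hz => hp z (by
          simp at hz; rcases hz with rfl | rfl <;> simp))
        simp at this
      have := ih (fun z hz => hp z (by rw [Walk.support_cons]; exact List.mem_cons_of_mem _ hz)) hvy
        (fun r hr => by
          have := hmin (.cons h r) (fun z hz => by
            rw [Walk.support_cons, List.mem_cons] at hz
            rcases hz with rfl | hz
            · exact hp _ (by simp)
            · exact hr z hz)
          simpa using this)
      simp only [Walk.getVert_cons_succ, Walk.getVert_zero] at this ⊢
      refine .cons h (hp _ (by simp)) ?_ ?_ this
      · rintro rfl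
        have := hmin q' (fun z hz => hp z (by simp [hz]))
        simp at this
      · intro huw
        have := hmin (.cons huw q') (fun z hz => hp z (by
          rw [Walk.support_cons, List.mem_cons] at hz
          rcases hz with rfl | hz
          · simp
          · simp [hz]))
        simp at this

theorem Walk.exists_localReach {T : Set V} {u y : V} (p : G.Walk u y)
    (hp : ∀ z ∈ p.support, z ∈ T) (huy : u ≠ y) : ∃ k v, G.LocalReach T k u v y := by
  classical
  have hex : ∃ k, ∃ q : G.Walk u y, (∀ z ∈ q.support, z ∈ T) ∧ q.length = k := ⟨_, p, hp, rfl⟩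
  obtain ⟨q, hq, hk⟩ := Nat.find_spec hex
  refine ⟨_, _, q.localReach_of_minimal hq huy fun r hr => ?_⟩
  rw [hk]
  exact Nat.find_min' hex ⟨r, hr, rfl⟩

/-- The vertex `v` of `R` is simplicial in the subgraph induced by `R`. -/
def IsSimplicialIn (G : SimpleGraph V) (R : Finset V) (v : V) : Prop :=
  v ∈ R ∧ ∀ x ∈ R, ∀ y ∈ R, G.Adj v x → G.Adj v y → x ≠ y → G.Adj x y

/-- The second conjunct, a simplicial vertex outside the closed neighbourhood of a prescribed `x`,
is the strengthening that makes the induction work. Let `C` be a component of the non-neighbours of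
`x` and `K` the set of neighbours of `x` that have a neighbour in `C`. Then `K` is a clique, the
neighbours of `C` lie in `C ∪ K`, and `C ∪ K` is smaller since it misses `x`. -/
theorem IsChordal.exists_isSimplicialIn_aux (hG : G.IsChordal) (R : Finset V) :
    (R.Nonempty → ∃ v, G.IsSimplicialIn R v) ∧
      ∀ x ∈ R, (∃ r ∈ R, r ≠ x ∧ ¬ G.Adj x r) →
        ∃ v, G.IsSimplicialIn R v ∧ v ≠ x ∧ ¬ G.Adj x v := by
  classical
  induction hn : R.card using Nat.strong_induction_on generalizing R with
  | _ n ih =>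
  subst hn
  have main : ∀ x ∈ R, (∃ r ∈ R, r ≠ x ∧ ¬ G.Adj x r) →
        ∃ v, G.IsSimplicialIn R v ∧ v ≠ x ∧ ¬ G.Adj x v := by
    rintro x hx ⟨c₀, hc₀, hc₀x, hxc₀⟩
    let U : Set V := {z | z ∈ R ∧ z ≠ x ∧ ¬ G.Adj x z}
    have hc₀U : c₀ ∈ U := ⟨hc₀, hc₀x, hxc₀⟩
    let C : Finset V := R.filter fun c => ∃ p : G.Walk c₀ c, ∀ z ∈ p.support, z ∈ U
    let K : Finset V := R.filter fun k => G.Adj x k ∧ ∃ c ∈ C, G.Adj k c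
    have hCU : ∀ c ∈ C, c ∈ U := fun c hc => by
      obtain ⟨-, p, hp⟩ := Finset.mem_filter.1 hc
      exact hp c (by simp)
    have hc₀C : c₀ ∈ C := Finset.mem_filter.2 ⟨hc₀, .nil, by simpa using hc₀U⟩
    have hnb : ∀ c ∈ C, ∀ r ∈ R, G.Adj c r → r ∈ C ∪ K := by
      intro c hc r hr hcr
      rw [Finset.mem_union]
      by_cases hxr : G.Adj x r
      · exact .inr (Finset.mem_filter.2 ⟨hr, hxr, c, hc, hcr.symm⟩)
      · left
        obtain ⟨-, p, hp⟩ := Finset.mem_filter.1 hc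
        refine Finset.mem_filter.2 ⟨hr, p.concat hcr, fun z hz => ?_⟩
        rw [Walk.support_concat, List.mem_append] at hz
        rcases hz with hz | hz
        · exact hp z hz
        · rw [List.mem_singleton] at hz
          subst hz
          refine ⟨hr, ?_, hxr⟩
          rintro rfl
          exact (hCU c hc).2.2 hcr.symm
    -- For nonadjacent `k` and `k'`, a shortest walk between them through the non-neighbours of `x`,
    -- preceded by `x`, is a local walk of length at least two whose end `k'` is adjacent to its
    -- start `x`.
    have hK : ∀ k ∈ K, ∀ k' ∈ K, k ≠ k' → G.Adj k k' := by
      intro k hk k' hk' hne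
      by_contra hna
      obtain ⟨hkR, hxk, c, hc, hkc⟩ := Finset.mem_filter.1 hk
      obtain ⟨hkR', hxk', c', hc', hkc'⟩ := Finset.mem_filter.1 hk'
      obtain ⟨-, p, hp⟩ := Finset.mem_filter.1 hc
      obtain ⟨-, p', hp'⟩ := Finset.mem_filter.1 hc'
      let T : Set V := {z | z = k ∨ z = k' ∨ z ∈ U}
      obtain ⟨m, v, hv⟩ := Walk.exists_localReach (T := T)
        (Walk.cons hkc ((p.reverse.append p').concat hkc'.symm)) (by
          intro z hz
          rw [Walk.support_cons, Walk.support_concat, List.mem_cons, List.mem_append,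
            Walk.mem_support_append_iff, Walk.support_reverse,
            List.mem_reverse, List.mem_singleton] at hz
          rcases hz with h | (h | h) | h
          · exact .inl h
          · exact .inr (.inr (hp z h))
          · exact .inr (.inr (hp' z h))
          · exact .inr (.inl h)) hne
      have hvU : v ∈ U := by
        rcases hv.snd_mem with rfl | rfl | h
        · exact absurd hv.adj (G.irrefl)
        · exact absurd hv.adj hna
        · exact h
      have h2 : G.LocalReach Set.univ (m + 1) x k k' :=
        .cons hxk (Set.mem_univ _) hvU.2.1.symm hvU.2.2 (hv.mono (Set.subset_univ _))
      exact h2.not_adj hG (by have := hv.pos; omega) hxk'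
    have hCR : C ⊆ R := Finset.filter_subset _ _
    have hKR : K ⊆ R := Finset.filter_subset _ _
    have hxC : x ∉ C := fun h => (hCU x h).2.1 rfl
    have hxK : x ∉ K := fun h => G.irrefl (Finset.mem_filter.1 h).2.1
    -- If some `k` in `K` misses a vertex of `C ∪ K`, induction for `k` gives a simplicial vertex
    -- outside its closed neighbourhood, which lies in `C` because `K` is a clique. Otherwise `K` is
    -- joined to everything in `C ∪ K`, and a simplicial vertex of `C` stays simplicial.
    by_cases hall : ∃ k ∈ K, ∃ r ∈ C ∪ K, r ≠ k ∧ ¬ G.Adj k r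
    · obtain ⟨k, hk, hr⟩ := hall
      have hlt : (C ∪ K).card < R.card := Finset.card_lt_card
        ⟨Finset.union_subset hCR hKR, fun h => by
          rcases Finset.mem_union.1 (h hx) with h | h
          exacts [hxC h, hxK h]⟩
      obtain ⟨v, ⟨hvm, hv⟩, hvk, hkv⟩ :=
        (ih _ hlt (C ∪ K) rfl).2 k (Finset.mem_union_right _ hk) hr
      have hvC : v ∈ C := by
        rcases Finset.mem_union.1 hvm with h | h
        · exact h
        · exact absurd (hK k hk v h hvk.symm) hkv
      exact ⟨v, ⟨hCR hvC, fun a ha b hb hva hvb hab =>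
        hv a (hnb v hvC a ha hva) b (hnb v hvC b hb hvb) hva hvb hab⟩, (hCU v hvC).2⟩
    · push Not at hall
      have hlt : C.card < R.card := Finset.card_lt_card ⟨hCR, fun h => hxC (h hx)⟩
      obtain ⟨v, hvC, hv⟩ := (ih _ hlt C rfl).1 ⟨c₀, hc₀C⟩
      refine ⟨v, ⟨hCR hvC, fun a ha b hb hva hvb hab => ?_⟩, (hCU v hvC).2⟩
      have haa := hnb v hvC a ha hva
      have hbb := hnb v hvC b hb hvb
      rcases Finset.mem_union.1 haa with ha' | ha'
      · rcases Finset.mem_union.1 hbb with hb' | hb'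
        · exact hv a ha' b hb' hva hvb hab
        · exact (hall b hb' a haa hab).symm
      · exact hall a ha' b hbb hab.symm
  refine ⟨fun ⟨v, hv⟩ => ?_, main⟩
  by_cases h : ∃ x ∈ R, ∃ r ∈ R, r ≠ x ∧ ¬ G.Adj x r
  · obtain ⟨x, hx, hr⟩ := h
    obtain ⟨w, hw, -⟩ := main x hx hr
    exact ⟨w, hw⟩
  · push Not at h
    exact ⟨v, hv, fun a ha b hb _ _ hab => h a ha b hb hab.symm⟩

/-- Dirac's theorem: every nonempty induced subgraph of a chordal graph has a simplicial vertex. -/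
theorem IsChordal.exists_isSimplicialIn (hG : G.IsChordal) {R : Finset V} (hR : R.Nonempty) :
    ∃ v, G.IsSimplicialIn R v :=
  (hG.exists_isSimplicialIn_aux R).1 hR

end SimpleGraph

/-! ### Branches and their vertex sets -/

namespace SimpleGraph

variable {V : Type*} {G : SimpleGraph V}

/-- `G.HasBranch u v i l`: one can hang below `u` a branch with root `v`, with `i` vertices and `l`
leaves, such that siblings are not adjacent and no vertex is adjacent to its grandparent. -/
inductive HasBranch (G : SimpleGraph V) : V → V → ℕ → ℕ → Prop
  | mk (u v : V) (I : Finset V) (sz lf : V → ℕ)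
      (hI : ∀ w ∈ I, G.Adj v w ∧ w ≠ u ∧ ¬ G.Adj u w)
      (hind : ∀ w ∈ I, ∀ w' ∈ I, ¬ G.Adj w w')
      (hb : ∀ w ∈ I, HasBranch G v w (sz w) (lf w)) :
      HasBranch G u v (1 + ∑ w ∈ I, sz w) (if I.Nonempty then ∑ w ∈ I, lf w else 1)

theorem HasBranch.pos {u v : V} {i l : ℕ} (h : G.HasBranch u v i l) : 1 ≤ i := by
  cases h; omega

theorem HasBranch.leaves_le {u v : V} {i l : ℕ} (h : G.HasBranch u v i l) : l ≤ i := by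
  induction h with
  | mk u v I sz lf hI hind hb ih =>
    split_ifs
    · have := Finset.sum_le_sum ih
      omega
    · omega

/-- No three vertices of `S` are pairwise adjacent. -/
def TriangleFreeOn (G : SimpleGraph V) (S : Finset V) : Prop :=
  ∀ x ∈ S, ∀ y ∈ S, ∀ z ∈ S, G.Adj x y → G.Adj y z → ¬ G.Adj x z

open Classical in
/-- The vertices of `S` that are adjacent to `y`. -/
noncomputable def nbrsIn (G : SimpleGraph V) (S : Finset V) (y : V) : Finset V :=
  S.filter fun z => G.Adj y z

open Classical in
/-- The vertices of `S` that have exactly one neighbour in `T`. -/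
noncomputable def leavesIn (G : SimpleGraph V) (T S : Finset V) : Finset V :=
  S.filter fun y => (G.nbrsIn T y).card = 1

theorem mem_nbrsIn {S : Finset V} {y z : V} : z ∈ G.nbrsIn S y ↔ z ∈ S ∧ G.Adj y z := by
  simp [nbrsIn]

theorem mem_leavesIn {T S : Finset V} {y : V} :
    y ∈ G.leavesIn T S ↔ y ∈ S ∧ (G.nbrsIn T y).card = 1 := by
  simp [leavesIn]

open Classical in
-- The parent `u` is always a neighbour of `v`, so `v` itself is a leaf exactly when it has no
-- children. This accounts for the case distinction in `HasBranch`.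
theorem card_leavesIn_insert_biUnion {T : Finset V} {v u : V} {I : Finset V} {S : V → Finset V}
    (hd : ∀ w ∈ I, ∀ w' ∈ I, w ≠ w' → Disjoint (S w) (S w'))
    (hv : ∀ w ∈ I, v ∉ S w) (hu : u ∉ I) (hN : G.nbrsIn T v = insert u I) :
    (G.leavesIn T (insert v (I.biUnion S))).card =
      if I.Nonempty then ∑ w ∈ I, (G.leavesIn T (S w)).card else 1 := by
  have hvv : v ∉ I.biUnion S := by
    simpa using hv
  have hcard : (G.nbrsIn T v).card = I.card + 1 := by
    rw [hN, Finset.card_insert_of_notMem hu]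
  have hsum : (G.leavesIn T (I.biUnion S)).card = ∑ w ∈ I, (G.leavesIn T (S w)).card := by
    rw [leavesIn, Finset.filter_biUnion, Finset.card_biUnion]
    · rfl
    · intro w hw w' hw' hne
      exact Finset.disjoint_filter_filter (hd w hw w' hw' hne)
  split_ifs with h
  · rw [← hsum, leavesIn, Finset.filter_insert, if_neg]
    · rfl
    · rw [hcard]
      have := h.card_pos
      omega
  · rw [Finset.not_nonempty_iff_eq_empty] at h
    subst h
    rw [leavesIn, Finset.filter_insert, if_pos (by rw [hcard]; rfl)]
    simp

open Classical in
theorem card_insert_biUnion' {v : V} {I : Finset V} {S : V → Finset V}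
    (hd : ∀ w ∈ I, ∀ w' ∈ I, w ≠ w' → Disjoint (S w) (S w'))
    (hv : ∀ w ∈ I, v ∉ S w) :
    (insert v (I.biUnion S)).card = 1 + ∑ w ∈ I, (S w).card := by
  rw [Finset.card_insert_of_notMem (by simpa using hv), Finset.card_biUnion, add_comm]
  exact hd

open Classical in
/-- The properties of the vertex set of a branch `v` below `u`. -/
structure IsBranchSet (G : SimpleGraph V) (u v : V) (S : Finset V) : Prop where
  reach : ∀ y ∈ S, ∃ k, G.LocalReach S k u v y
  root_mem : v ∈ S
  triangleFree : G.TriangleFreeOn (insert u S)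

theorem LocalReach.eq_snd (hG : G.IsChordal) {S : Set V} {k : ℕ} {u v y : V}
    (h : G.LocalReach S k u v y) (ha : G.Adj u y) : y = v := by
  cases h with
  | edge => rfl
  | cons h hv hne hna hr =>
    exact absurd ha (LocalReach.not_adj hG (.cons h hv hne hna hr) (by have := hr.pos; omega))

open Classical in
-- The sets of the children can be united freely. By `LocalReach.glue_of_not_adj` they are disjoint
-- with no edges between them, and `u` is joined to none of their vertices because the local walks
-- from `u` to them have length at least two. So a vertex below the child `w` has the same
-- neighbours as in the branch of `w`, and degrees and the absence of triangles carry over. Degrees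
-- are taken in `insert u S`, so that the edge from the root to its parent counts.
theorem HasBranch.exists_isBranchSet (hG : G.IsChordal) {u v : V} {i l : ℕ}
    (h : G.HasBranch u v i l) (huv : G.Adj u v) :
    ∃ S, G.IsBranchSet u v S ∧ S.card = i ∧ (G.leavesIn (insert u S) S).card = l := by
  induction h with
  | mk u v I sz lf hI hind hb ih =>
    have ih' : ∀ w, ∃ S : Finset V, w ∈ I → G.IsBranchSet v w S ∧ S.card = sz w ∧
        (G.leavesIn (insert v S) S).card = lf w := fun w => by
      by_cases hw : w ∈ I
      · obtain ⟨S, hS⟩ := ih w hw (hI w hw).1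
        exact ⟨S, fun _ => hS⟩
      · exact ⟨∅, fun h => absurd h hw⟩
    choose S hS using ih'
    set U := insert v (I.biUnion S) with hU
    have hSU : ∀ w ∈ I, S w ⊆ U := fun w hw y hy =>
      Finset.mem_insert_of_mem (Finset.mem_biUnion.2 ⟨w, hw, hy⟩)
    have hvU : v ∈ U := Finset.mem_insert_self _ _
    have hr : ∀ w ∈ I, ∀ y ∈ S w, ∃ k, G.LocalReach U k v w y := fun w hw y hy => by
      obtain ⟨k, hk⟩ := (hS w hw).1.reach y hy
      exact ⟨k, hk.mono (by exact_mod_cast hSU w hw)⟩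
    have hr' : ∀ w ∈ I, ∀ y ∈ S w, ∃ k, 2 ≤ k ∧ G.LocalReach U k u v y := fun w hw y hy => by
      obtain ⟨k, hk⟩ := hr w hw y hy
      exact ⟨k + 1, by have := hk.pos; omega,
        .cons huv hvU (hI w hw).2.1.symm (hI w hw).2.2 hk⟩
    have hcross : ∀ w ∈ I, ∀ y ∈ S w, ∀ w' ∈ I, ∀ y' ∈ S w', w ≠ w' → y ≠ y' ∧ ¬ G.Adj y y' := by
      intro w hw y hy w' hw' y' hy' hne
      obtain ⟨k, hk⟩ := hr w hw y hy
      obtain ⟨k', hk'⟩ := hr w' hw' y' hy'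
      exact hk.glue_of_not_adj hG hk' hne (hind w hw w' hw')
    have hd : ∀ w ∈ I, ∀ w' ∈ I, w ≠ w' → Disjoint (S w) (S w') := by
      intro w hw w' hw' hne
      rw [Finset.disjoint_left]
      intro y hy hy'
      exact (hcross w hw y hy w' hw' y hy' hne).1 rfl
    have hvS : ∀ w ∈ I, v ∉ S w := fun w hw hv => by
      obtain ⟨k, hk⟩ := hr w hw v hv
      exact hk.ne hG rfl
    have huS : ∀ w ∈ I, ∀ y ∈ S w, u ≠ y ∧ ¬ G.Adj u y := fun w hw y hy => by
      obtain ⟨k, hk2, hk⟩ := hr' w hw y hy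
      exact ⟨hk.ne hG, hk.not_adj hG hk2⟩
    have hnb : ∀ w ∈ I, ∀ y ∈ S w, ∀ z, z ∈ insert u U → G.Adj y z → z ∈ insert v (S w) := by
      intro w hw y hy z hz hyz
      rw [hU, Finset.mem_insert, Finset.mem_insert, Finset.mem_biUnion] at hz
      rcases hz with rfl | rfl | ⟨w', hw', hz⟩
      · exact absurd hyz.symm (huS w hw y hy).2
      · exact Finset.mem_insert_self _ _
      · by_cases hww : w = w'
        · subst hww; exact Finset.mem_insert_of_mem hz
        · exact absurd hyz (hcross w hw y hy w' hw' z hz hww).2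
    have hnbeq : ∀ w ∈ I, ∀ y ∈ S w, G.nbrsIn (insert u U) y = G.nbrsIn (insert v (S w)) y := by
      intro w hw y hy
      ext z
      rw [mem_nbrsIn, mem_nbrsIn]
      refine ⟨fun h => ⟨hnb w hw y hy z h.1 h.2, h.2⟩, fun h => ⟨?_, h.2⟩⟩
      rcases Finset.mem_insert.1 h.1 with rfl | hz
      · exact Finset.mem_insert_of_mem hvU
      · exact Finset.mem_insert_of_mem (hSU w hw hz)
    have hN : G.nbrsIn (insert u U) v = insert u I := by
      ext z
      rw [mem_nbrsIn, Finset.mem_insert (s := U), Finset.mem_insert (s := I)]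
      constructor
      · rintro ⟨hz | hz, hvz⟩
        · exact .inl hz
        · right
          rw [hU, Finset.mem_insert, Finset.mem_biUnion] at hz
          rcases hz with rfl | ⟨w, hw, hz⟩
          · exact absurd hvz G.irrefl
          · obtain ⟨k, hk⟩ := hr w hw z hz
            rwa [hk.eq_snd hG hvz]
      · rintro (rfl | hz)
        · exact ⟨.inl rfl, huv.symm⟩
        · exact ⟨.inr (hSU z hz (hS z hz).1.root_mem), (hI z hz).1⟩
    have huI : u ∉ I := fun h => (hI u h).2.1 rfl
    refine ⟨U, ⟨?_, hvU, ?_⟩, ?_, ?_⟩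
    · intro y hy
      rcases Finset.mem_insert.1 hy with rfl | hy
      · exact ⟨1, .edge huv hvU⟩
      · obtain ⟨w, hw, hy⟩ := Finset.mem_biUnion.1 hy
        obtain ⟨k, -, hk⟩ := hr' w hw y hy
        exact ⟨k, hk⟩
    -- A triangle with a vertex in `S w` has its other vertices in `insert v (S w)`, where the
    -- induction hypothesis forbids it. The remaining candidates use only `u` and `v`.
    · have key : ∀ w ∈ I, ∀ x ∈ S w, ∀ y ∈ insert u U, ∀ z ∈ insert u U,
          G.Adj x y → G.Adj y z → ¬ G.Adj x z := by
        intro w hw x hx y hy z hz hxy hyz hxz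
        exact (hS w hw).1.triangleFree x (Finset.mem_insert_of_mem hx) y (hnb w hw x hx y hy hxy)
          z (hnb w hw x hx z hz hxz) hxy hyz hxz
      have hcases : ∀ x ∈ insert u U, x = u ∨ x = v ∨ ∃ w ∈ I, x ∈ S w := by
        intro x hx
        rw [hU, Finset.mem_insert, Finset.mem_insert, Finset.mem_biUnion] at hx
        exact hx
      intro x hx y hy z hz hxy hyz hxz
      rcases hcases x hx with hx' | hx' | ⟨w, hw, hx'⟩
      rotate_left 2
      · exact key w hw x hx' y hy z hz hxy hyz hxz
      all_goals
        rcases hcases y hy with hy' | hy' | ⟨w, hw, hy'⟩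
        rotate_left 2
        · exact key w hw y hy' x hx z hz hxy.symm hxz hyz
        all_goals
          rcases hcases z hz with hz' | hz' | ⟨w, hw, hz'⟩
          rotate_left 2
          · exact key w hw z hz' x hx y hy hxz.symm hxy hyz.symm
          all_goals
            rw [hx', hy'] at hxy
            rw [hx', hz'] at hxz
            rw [hy', hz'] at hyz
            first
              | exact G.irrefl hxy
              | exact G.irrefl hxz
              | exact G.irrefl hyz
    · rw [hU, card_insert_biUnion' hd hvS]
      congr 1
      exact Finset.sum_congr rfl fun w hw => (hS w hw).2.1
    · conv_lhs => rw [hU]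
      rw [card_leavesIn_insert_biUnion hd hvS huI (by rw [← hU]; exact hN)]
      congr 1
      refine Finset.sum_congr rfl fun w hw => ?_
      rw [← (hS w hw).2.2]
      congr 1
      ext y
      rw [mem_leavesIn, mem_leavesIn]
      refine and_congr_right fun hy => ?_
      rw [← hU, hnbeq w hw y hy]

end SimpleGraph

/-! ### Induced trees as pairs of branches -/

namespace SimpleGraph

variable {V : Type*} {G : SimpleGraph V}

/-- Without triangles a cycle is a local walk: vertices at distance two are distinct on a cycle and
cannot be adjacent. But local walks are paths, and a closed path is trivial. -/
theorem IsChordal.isAcyclic_induce (hG : G.IsChordal) {S : Finset V} (hS : G.TriangleFreeOn S) :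
    (G.induce (S : Set V)).IsAcyclic := by
  intro v c hc
  let f : G.induce (S : Set V) ↪g G := Embedding.induce (S : Set V)
  have hcm : (c.map f.toHom).IsCycle := (Walk.isCycle_map_iff_of_injective f.injective).2 hc
  have hmem : ∀ i, (c.map f.toHom).getVert i ∈ S := fun i => by
    rw [Walk.getVert_map]
    exact (c.getVert i).2
  generalize c.map f.toHom = d at hcm hmem
  have h3 := hcm.three_le_length
  have hloc : d.IsLocal := by
    intro i hi
    refine ⟨?_, ?_⟩
    · have := hcm.getVert_sub_one_ne_getVert_add_one (i := i + 1) (by omega)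
      simpa using this
    · exact hS _ (hmem _) _ (hmem _) _ (hmem _) (d.adj_getVert_succ (by omega))
        (d.adj_getVert_succ (by omega))
  have := (hG.isPath_of_isLocal d hloc).1
  have := Walk.length_eq_zero_iff.2 (Walk.isPath_iff_nil.1 this)
  omega

theorem TriangleFreeOn.of_isAcyclic {S : Finset V} (h : (G.induce (S : Set V)).IsAcyclic) :
    G.TriangleFreeOn S := by
  intro x hx y hy z hz hxy hyz hxz
  let H := G.induce (S : Set V)
  have hxy' : H.Adj ⟨x, hx⟩ ⟨y, hy⟩ := hxy
  have hyz' : H.Adj ⟨y, hy⟩ ⟨z, hz⟩ := hyz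
  have hzx' : H.Adj ⟨z, hz⟩ ⟨x, hx⟩ := hxz.symm
  refine h (.cons hxy' (.cons hyz' (.cons hzx' .nil))) ?_
  rw [Walk.cons_isCycle_iff]
  have h1 := hxy.ne
  have h2 := hyz.ne
  have h3 := hxz.ne
  refine ⟨?_, ?_⟩
  · simp [Walk.cons_isPath_iff, h1.symm, h2, h3.symm]
  · simp [h1, h2, h3, h1.symm]

theorem ncard_neighborSet_induce (S : Finset V) (v : (S : Set V)) :
    ((G.induce (S : Set V)).neighborSet v).ncard = (G.nbrsIn S v).card := by
  rw [← Set.ncard_image_of_injective _ Subtype.val_injective, ← Set.ncard_coe_finset]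
  congr 1
  ext z
  simp only [Set.mem_image, mem_neighborSet, comap_adj, Finset.mem_coe, mem_nbrsIn]
  constructor
  · rintro ⟨w, hw, rfl⟩
    exact ⟨w.2, hw⟩
  · rintro ⟨hz, hvz⟩
    exact ⟨⟨z, hz⟩, hvz, rfl⟩

theorem ncard_isLeaf_induce (S : Finset V) :
    {v : (S : Set V) | (G.induce (S : Set V)).IsLeaf v}.ncard = (G.leavesIn S S).card := by
  rw [← Set.ncard_image_of_injective _ Subtype.val_injective, ← Set.ncard_coe_finset]
  congr 1
  ext z
  simp only [Set.mem_image, IsLeaf, ncard_neighborSet_induce, Finset.mem_coe, mem_leavesIn]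
  constructor
  · rintro ⟨w, hw, rfl⟩
    exact ⟨w.2, hw⟩
  · rintro ⟨hz, hvz⟩
    exact ⟨⟨z, hz⟩, hvz, rfl⟩

theorem LocalReach.reachable {S : Set V} {k : ℕ} {u v y : V} (h : G.LocalReach S k u v y) :
    (G.induce S).Reachable ⟨v, h.snd_mem⟩ ⟨y, h.mem⟩ := by
  induction h with
  | edge => rfl
  | cons h hv hne hna hr ih =>
    refine Reachable.trans (Adj.reachable ?_) ih
    exact hr.adj

open Classical in
-- Local walks from the two ends of the edge `v₀ w` glue along this edge, so `v₀ w` is the only edge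
-- between the two vertex sets. Degrees and leaves are then those in the single branches. The
-- condition `2 ≤ i₂` provides a neighbour of `v₀` other than `w`, which makes `v₀` internal.
theorem hasRestrictedLeafedInducedSubtree_of_hasBranch (hG : G.IsChordal) {v₀ w : V}
    {a b i₁ l₁ i₂ l₂ : ℕ} (hw : G.Adj v₀ w) (h₁ : G.HasBranch v₀ w i₁ l₁)
    (h₂ : G.HasBranch w v₀ i₂ l₂) (hi₂ : 2 ≤ i₂) (ha : i₁ + i₂ = a) (hb : b ≤ l₁ + l₂) :
    G.HasRestrictedLeafedInducedSubtree v₀ a b := by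
  obtain ⟨S₁, hS₁, hc₁, hl₁⟩ := h₁.exists_isBranchSet hG hw
  obtain ⟨S₂, hS₂, hc₂, hl₂⟩ := h₂.exists_isBranchSet hG hw.symm
  have hcross : ∀ y ∈ S₁, ∀ y' ∈ S₂, y ≠ y' ∧ (G.Adj y y' → y = w ∧ y' = v₀) := by
    intro y hy y' hy'
    obtain ⟨k, hk⟩ := hS₁.reach y hy
    obtain ⟨l, hl⟩ := hS₂.reach y' hy'
    obtain ⟨z, hz⟩ := (hk.mono (Set.subset_univ _)).glue (hl.mono (Set.subset_univ _))
    refine ⟨hz.ne hG, fun hadj => ?_⟩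
    have hk1 := hk.pos
    have hl1 := hl.pos
    by_cases h2 : 2 ≤ k + l - 1
    · exact absurd hadj (hz.not_adj hG h2)
    · obtain rfl : k = 1 := by omega
      obtain rfl : l = 1 := by omega
      refine ⟨?_, ?_⟩
      · cases hk with
        | edge => rfl
        | cons _ _ _ _ hr => have := hr.pos; omega
      · cases hl with
        | edge => rfl
        | cons _ _ _ _ hr => have := hr.pos; omega
  have hd : Disjoint S₁ S₂ := by
    rw [Finset.disjoint_left]
    intro y hy hy'
    exact (hcross y hy y hy').1 rfl
  set S := S₁ ∪ S₂ with hS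
  have h1S : S₁ ⊆ S := Finset.subset_union_left
  have h2S : S₂ ⊆ S := Finset.subset_union_right
  have hv₀ : v₀ ∈ S := h2S hS₂.root_mem
  have hwS : w ∈ S := h1S hS₁.root_mem
  have hnb₁ : ∀ y ∈ S₁, ∀ z ∈ S, G.Adj y z → z ∈ insert v₀ S₁ := by
    intro y hy z hz hyz
    rcases Finset.mem_union.1 hz with hz | hz
    · exact Finset.mem_insert_of_mem hz
    · rw [((hcross y hy z hz).2 hyz).2]
      exact Finset.mem_insert_self _ _
  have hnb₂ : ∀ y ∈ S₂, ∀ z ∈ S, G.Adj y z → z ∈ insert w S₂ := by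
    intro y hy z hz hyz
    rcases Finset.mem_union.1 hz with hz | hz
    · rw [((hcross z hz y hy).2 hyz.symm).1]
      exact Finset.mem_insert_self _ _
    · exact Finset.mem_insert_of_mem hz
  have hi₁ : insert v₀ S₁ ⊆ S := Finset.insert_subset hv₀ h1S
  have hi₂' : insert w S₂ ⊆ S := Finset.insert_subset hwS h2S
  have hN₁ : ∀ y ∈ S₁, G.nbrsIn S y = G.nbrsIn (insert v₀ S₁) y := by
    intro y hy
    ext z
    rw [mem_nbrsIn, mem_nbrsIn]
    exact ⟨fun h => ⟨hnb₁ y hy z h.1 h.2, h.2⟩, fun h => ⟨hi₁ h.1, h.2⟩⟩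
  have hN₂ : ∀ y ∈ S₂, G.nbrsIn S y = G.nbrsIn (insert w S₂) y := by
    intro y hy
    ext z
    rw [mem_nbrsIn, mem_nbrsIn]
    exact ⟨fun h => ⟨hnb₂ y hy z h.1 h.2, h.2⟩, fun h => ⟨hi₂' h.1, h.2⟩⟩
  have htf : G.TriangleFreeOn S := by
    intro x hx y hy z hz hxy hyz hxz
    rcases Finset.mem_union.1 hx with hx' | hx'
    · exact hS₁.triangleFree x (Finset.mem_insert_of_mem hx') y (hnb₁ x hx' y hy hxy)
        z (hnb₁ x hx' z hz hxz) hxy hyz hxz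
    · exact hS₂.triangleFree x (Finset.mem_insert_of_mem hx') y (hnb₂ x hx' y hy hxy)
        z (hnb₂ x hx' z hz hxz) hxy hyz hxz
  refine ⟨S, ⟨?_, hG.isAcyclic_induce htf⟩, ?_, ⟨hv₀, ?_⟩, ?_⟩
  · have hreach : ∀ y : (S : Set V), (G.induce (S : Set V)).Reachable ⟨v₀, hv₀⟩ y := by
      rintro ⟨y, hy⟩
      rcases Finset.mem_union.1 hy with hy' | hy'
      · obtain ⟨k, hk⟩ := hS₁.reach y hy'
        refine Reachable.trans (Adj.reachable ?_)
          (hk.mono (T := (S : Set V)) (by exact_mod_cast h1S)).reachable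
        exact hw
      · obtain ⟨k, hk⟩ := hS₂.reach y hy'
        exact (hk.mono (T := (S : Set V)) (by exact_mod_cast h2S)).reachable
    have : Nonempty (S : Set V) := ⟨⟨v₀, hv₀⟩⟩
    exact ⟨fun x y => (hreach x).symm.trans (hreach y)⟩
  · rw [hS, Finset.card_union_of_disjoint hd, hc₁, hc₂, ha]
  · rw [IsInternal, ncard_neighborSet_induce]
    obtain ⟨y, hy, hyv⟩ : ∃ y ∈ S₂, y ≠ v₀ := Finset.exists_mem_ne (by omega) v₀
    obtain ⟨l, hl⟩ := hS₂.reach y hy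
    cases hl with
    | edge => exact absurd rfl hyv
    | @cons k _ _ w₂ _ h hv hne hna hr =>
      have hsub : ({w, w₂} : Finset V) ⊆ G.nbrsIn S v₀ := by
        intro z hz
        rw [Finset.mem_insert, Finset.mem_singleton] at hz
        rw [mem_nbrsIn]
        rcases hz with rfl | rfl
        · exact ⟨hwS, hw⟩
        · exact ⟨h2S hr.snd_mem, hr.adj⟩
      have := Finset.card_le_card hsub
      rwa [Finset.card_pair hne] at this
  · rw [ncard_isLeaf_induce]
    refine hb.trans (le_of_eq ?_)
    rw [← hl₁, ← hl₂]
    have : G.leavesIn S S =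
        G.leavesIn (insert v₀ S₁) S₁ ∪ G.leavesIn (insert w S₂) S₂ := by
      ext y
      rw [Finset.mem_union, mem_leavesIn, mem_leavesIn, mem_leavesIn]
      constructor
      · rintro ⟨hy, h⟩
        rcases Finset.mem_union.1 hy with hy | hy
        · exact .inl ⟨hy, by rwa [← hN₁ y hy]⟩
        · exact .inr ⟨hy, by rwa [← hN₂ y hy]⟩
      · rintro (⟨hy, h⟩ | ⟨hy, h⟩)
        · exact ⟨h1S hy, by rwa [hN₁ y hy]⟩
        · exact ⟨h2S hy, by rwa [hN₂ y hy]⟩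
    rw [this, Finset.card_union_of_disjoint]
    exact Finset.disjoint_filter_filter hd

open Classical in
/-- The vertices of `S` on the side of `v` of the edge `u v`. -/
noncomputable def sideOf (G : SimpleGraph V) (S : Finset V) (u v : V) : Finset V :=
  S.filter fun y => ∃ k, G.LocalReach S k u v y

theorem mem_sideOf {S : Finset V} {u v y : V} :
    y ∈ G.sideOf S u v ↔ ∃ k, G.LocalReach S k u v y := by
  classical
  rw [sideOf, Finset.mem_filter]
  exact ⟨fun h => h.2, fun h => ⟨h.choose_spec.mem, h⟩⟩

open Classical in
-- The children of `v` are its neighbours in `S` other than `u`. They are adjacent neither to each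
-- other nor to `u`, as this would create a triangle with `v`. Their sides partition the rest of the
-- side of `v` and are smaller, so induction on the size applies.
theorem hasBranch_sideOf (hG : G.IsChordal) {S : Finset V} (hS : G.TriangleFreeOn S) {u v : V}
    (hu : u ∈ S) (hv : v ∈ S) (huv : G.Adj u v) :
    G.HasBranch u v (G.sideOf S u v).card (G.leavesIn S (G.sideOf S u v)).card := by
  induction hn : (G.sideOf S u v).card using Nat.strong_induction_on generalizing u v with
  | _ n ih =>
  subst hn
  set I : Finset V := S.filter fun w => G.Adj v w ∧ w ≠ u with hI
  have hmI : ∀ w ∈ I, w ∈ S ∧ G.Adj v w ∧ w ≠ u := fun w hw => Finset.mem_filter.1 hw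
  have hna : ∀ w ∈ I, ¬ G.Adj u w := fun w hw =>
    hS u hu v hv w (hmI w hw).1 huv (hmI w hw).2.1
  have hind : ∀ w ∈ I, ∀ w' ∈ I, ¬ G.Adj w w' := fun w hw w' hw' =>
    hS w (hmI w hw).1 v hv w' (hmI w' hw').1 (hmI w hw).2.1.symm (hmI w' hw').2.1
  have hside : G.sideOf S u v = insert v (I.biUnion fun w => G.sideOf S v w) := by
    ext y
    rw [Finset.mem_insert, Finset.mem_biUnion, mem_sideOf]
    constructor
    · rintro ⟨k, hk⟩
      cases hk with
      | edge => exact .inl rfl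
      | @cons k _ _ w _ h hv hne hna hr =>
        exact .inr ⟨w, Finset.mem_filter.2 ⟨hr.snd_mem, hr.adj, hne.symm⟩, mem_sideOf.2 ⟨k, hr⟩⟩
    · rintro (rfl | ⟨w, hw, hy⟩)
      · exact ⟨1, .edge huv hv⟩
      · obtain ⟨k, hk⟩ := mem_sideOf.1 hy
        exact ⟨k + 1, .cons huv hv (hmI w hw).2.2.symm (hna w hw) hk⟩
  have hvs : ∀ w ∈ I, v ∉ G.sideOf S v w := fun w hw h => by
    obtain ⟨k, hk⟩ := mem_sideOf.1 h
    exact hk.ne hG rfl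
  have hd : ∀ w ∈ I, ∀ w' ∈ I, w ≠ w' → Disjoint (G.sideOf S v w) (G.sideOf S v w') := by
    intro w hw w' hw' hne
    rw [Finset.disjoint_left]
    intro y hy hy'
    obtain ⟨k, hk⟩ := mem_sideOf.1 hy
    obtain ⟨k', hk'⟩ := mem_sideOf.1 hy'
    exact (hk.glue_of_not_adj hG hk' hne (hind w hw w' hw')).1 rfl
  have huI : u ∉ I := fun h => (hmI u h).2.2 rfl
  have hN : G.nbrsIn S v = insert u I := by
    ext z
    rw [mem_nbrsIn, Finset.mem_insert, hI, Finset.mem_filter]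
    constructor
    · rintro ⟨hz, hvz⟩
      by_cases hzu : z = u
      · exact .inl hzu
      · exact .inr ⟨hz, hvz, hzu⟩
    · rintro (rfl | ⟨hz, hvz, -⟩)
      · exact ⟨hu, huv.symm⟩
      · exact ⟨hz, hvz⟩
  have hcard := card_insert_biUnion' (S := fun w => G.sideOf S v w) hd hvs
  have hleaf := card_leavesIn_insert_biUnion hd hvs huI hN
  rw [hside, hcard, hleaf]
  refine .mk u v I (fun w => (G.sideOf S v w).card) _
    (fun w hw => ⟨(hmI w hw).2.1, (hmI w hw).2.2, hna w hw⟩) hind fun w hw => ?_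
  refine ih _ ?_ hv (hmI w hw).1 (hmI w hw).2.1 rfl
  rw [hside, hcard]
  have := Finset.single_le_sum (f := fun w => (G.sideOf S v w).card) (fun _ _ => Nat.zero_le _) hw
  omega

open Classical in
-- The tree is cut at an edge from `v₀` to any neighbour `w` in the tree. Since `v₀` is internal, it
-- has a second neighbour `w'`, which lies on the side of `v₀` and gives `2 ≤ i₂`.
theorem HasRestrictedLeafedInducedSubtree.exists_hasBranch (hG : G.IsChordal) {v₀ : V} {a b : ℕ}
    (h : G.HasRestrictedLeafedInducedSubtree v₀ a b) :
    ∃ w i₁ l₁ i₂ l₂, G.Adj v₀ w ∧ G.HasBranch v₀ w i₁ l₁ ∧ G.HasBranch w v₀ i₂ l₂ ∧ 2 ≤ i₂ ∧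
      i₁ + i₂ = a ∧ b ≤ l₁ + l₂ := by
  obtain ⟨S, hT, ha, ⟨hv₀, hint⟩, hb⟩ := h
  have hS : G.TriangleFreeOn S := .of_isAcyclic hT.isAcyclic
  rw [IsInternal, ncard_neighborSet_induce] at hint
  rw [ncard_isLeaf_induce] at hb
  obtain ⟨w, hw, w', hw', hne⟩ := Finset.one_lt_card.1 hint
  rw [mem_nbrsIn] at hw hw'
  obtain ⟨hwS, hw⟩ := hw
  obtain ⟨hwS', hw'⟩ := hw'
  have hv₀' : v₀ ∈ S := hv₀
  have hcover : S = G.sideOf S v₀ w ∪ G.sideOf S w v₀ := by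
    ext y
    rw [Finset.mem_union, mem_sideOf, mem_sideOf]
    constructor
    · intro hy
      by_cases hyv : y = v₀
      · subst hyv
        exact .inr ⟨1, .edge hw.symm hv₀⟩
      · obtain ⟨p⟩ := hT.connected.preconnected ⟨v₀, hv₀⟩ ⟨y, hy⟩
        let f : G.induce (S : Set V) ↪g G := Embedding.induce (S : Set V)
        obtain ⟨k, v, hk⟩ := Walk.exists_localReach (T := (S : Set V)) (p.map f.toHom) (by
          intro z hz
          rw [Walk.support_map, List.mem_map] at hz
          obtain ⟨z', -, rfl⟩ := hz
          exact z'.2) (fun h => hyv h.symm)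
        -- A local walk from `v₀` to `y` either starts through `w`, or can be extended backwards by
        -- `w`, because two neighbours of `v₀` in the tree are not adjacent.
        by_cases hvw : v = w
        · subst hvw
          exact .inl ⟨k, hk⟩
        · refine .inr ⟨k + 1, .cons hw.symm hv₀ (Ne.symm hvw) ?_ hk⟩
          exact hS w hwS v₀ hv₀' v hk.snd_mem hw.symm hk.adj
    · rintro (⟨k, hk⟩ | ⟨k, hk⟩)
      · exact hk.mem
      · exact hk.mem
  have hd : Disjoint (G.sideOf S v₀ w) (G.sideOf S w v₀) := by
    rw [Finset.disjoint_left]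
    intro y hy hy'
    obtain ⟨k, hk⟩ := mem_sideOf.1 hy
    obtain ⟨k', hk'⟩ := mem_sideOf.1 hy'
    obtain ⟨z, hz⟩ := hk.glue hk'
    exact hz.ne hG rfl
  refine ⟨w, _, _, _, _, hw, hasBranch_sideOf hG hS hv₀' hwS hw,
    hasBranch_sideOf hG hS hwS hv₀' hw.symm, ?_, ?_, ?_⟩
  · have hsub : ({v₀, w'} : Finset V) ⊆ G.sideOf S w v₀ := by
      intro z hz
      rw [Finset.mem_insert, Finset.mem_singleton] at hz
      rw [mem_sideOf]
      rcases hz with rfl | rfl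
      · exact ⟨1, .edge hw.symm hv₀⟩
      · exact ⟨2, .cons hw.symm hv₀ hne (hS w hwS v₀ hv₀' _ hwS' hw.symm hw') (.edge hw' hwS')⟩
    have := Finset.card_le_card hsub
    rwa [Finset.card_pair hw'.ne] at this
  · rw [← Finset.card_union_of_disjoint hd, ← hcover, ha]
  · refine hb.trans (le_of_eq ?_)
    conv_lhs => rw [leavesIn, hcover, Finset.filter_union]
    rw [Finset.card_union_of_disjoint (Finset.disjoint_filter_filter hd), ← hcover]
    rfl

/-- In a chordal graph, Restricted Leafed Induced Subtree is a question about branches. -/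
theorem IsChordal.hasRestrictedLeafedInducedSubtree_iff (hG : G.IsChordal) {v₀ : V} {a b : ℕ} :
    G.HasRestrictedLeafedInducedSubtree v₀ a b ↔
      ∃ w i₁ l₁ i₂ l₂, G.Adj v₀ w ∧ G.HasBranch v₀ w i₁ l₁ ∧ G.HasBranch w v₀ i₂ l₂ ∧ 2 ≤ i₂ ∧
        i₁ + i₂ = a ∧ b ≤ l₁ + l₂ :=
  ⟨fun h => h.exists_hasBranch hG, fun ⟨_, _, _, _, _, hw, h₁, h₂, h2, ha, hb⟩ =>
    hasRestrictedLeafedInducedSubtree_of_hasBranch hG hw h₁ h₂ h2 ha hb⟩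

end SimpleGraph

/-! ### Transport of branches, and elimination trees -/

namespace SimpleGraph

/-- The predicate `P` singles out the vertices on which `g` inverts `f`. It is closed under taking
neighbours, so a branch that starts in `P` stays there. This permits labellings that are arbitrary
outside the range of the true labels. -/
theorem HasBranch.map {V W : Type*} {G : SimpleGraph V} {H : SimpleGraph W} (f : V → W) (g : W → V)
    (P : V → Prop) (hg : ∀ v, P v → g (f v) = v) (hP : ∀ v w, G.Adj v w → P w)
    (hadj : ∀ v w, P v → P w → (G.Adj v w ↔ H.Adj (f v) (f w)))
    {u v : V} {i l : ℕ} (h : G.HasBranch u v i l) (hu : P u) (hv : P v) :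
    H.HasBranch (f u) (f v) i l := by
  classical
  induction h with
  | mk u v I sz lf hI hind hb ih =>
    have hPI : ∀ w ∈ I, P w := fun w hw => hP v w (hI w hw).1
    have hinj : ∀ x ∈ I, ∀ y ∈ I, f x = f y → x = y := fun x hx y hy hxy => by
      rw [← hg x (hPI x hx), hxy, hg y (hPI y hy)]
    have key : H.HasBranch (f u) (f v) (1 + ∑ w ∈ I.image f, sz (g w))
        (if (I.image f).Nonempty then ∑ w ∈ I.image f, lf (g w) else 1) := by
      refine .mk _ _ _ _ _ ?_ ?_ ?_
      · intro w hw
        obtain ⟨w, hw', rfl⟩ := Finset.mem_image.1 hw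
        obtain ⟨h1, h2, h3⟩ := hI w hw'
        refine ⟨(hadj _ _ hv (hPI w hw')).1 h1, fun h => h2 ?_,
          fun h => h3 ((hadj _ _ hu (hPI w hw')).2 h)⟩
        rw [← hg w (hPI w hw'), h, hg u hu]
      · intro w hw w' hw'
        obtain ⟨w, hw₁, rfl⟩ := Finset.mem_image.1 hw
        obtain ⟨w', hw₁', rfl⟩ := Finset.mem_image.1 hw'
        exact fun h => hind w hw₁ w' hw₁' ((hadj _ _ (hPI w hw₁) (hPI w' hw₁')).2 h)
      · intro w hw
        obtain ⟨w, hw₁, rfl⟩ := Finset.mem_image.1 hw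
        rw [hg w (hPI w hw₁)]
        exact ih w hw₁ hv (hPI w hw₁)
    simp only [Finset.image_nonempty] at key
    have hs : ∀ φ : V → ℕ, ∑ w ∈ I.image f, φ (g w) = ∑ w ∈ I, φ w := fun φ => by
      rw [Finset.sum_image hinj]
      exact Finset.sum_congr rfl fun x hx => by rw [hg x (hPI x hx)]
    rw [hs, hs] at key
    exact key

variable {H : SimpleGraph ℕ} {n : ℕ} {par : ℕ → ℕ}

/-- The graph `H` lives on `1, …, n`, this order is a perfect elimination order, and `par x` is the
first neighbour of `x` after `x`, or `n + 1` if there is none. -/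
structure IsElimination (H : SimpleGraph ℕ) (n : ℕ) (par : ℕ → ℕ) : Prop where
  bounds : ∀ x y, H.Adj x y → 1 ≤ x ∧ x ≤ n
  adj_of_lt : ∀ x y z, H.Adj x y → H.Adj x z → x < y → x < z → y ≠ z → H.Adj y z
  lt_par : ∀ x, 1 ≤ x → x ≤ n → x < par x
  par_le : ∀ x, 1 ≤ x → x ≤ n → par x ≤ n + 1
  par_le_of_adj : ∀ x z, H.Adj x z → x < z → par x ≤ z
  adj_par : ∀ x, 1 ≤ x → x ≤ n → par x ≤ n → H.Adj x (par x)

/-- The last child of `q` in the elimination tree among `1, …, x`, or `0`. -/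
def lastChildUpTo (par : ℕ → ℕ) : ℕ → ℕ → ℕ
  | 0, _ => 0
  | x + 1, q => if par (x + 1) = q then x + 1 else lastChildUpTo par x q

/-- The descendants of those children of `q` in the elimination tree that are among `1, …, x`. -/
def descUpTo (par : ℕ → ℕ) : ℕ → ℕ → Finset ℕ
  | 0, _ => ∅
  | x + 1, q => if par (x + 1) = q then
      insert (x + 1) (descUpTo par x q ∪ descUpTo par x (x + 1)) else descUpTo par x q

/-- The descendants of `x` and of its earlier siblings in the elimination tree. -/
def descSib (par : ℕ → ℕ) (x : ℕ) : Finset ℕ := descUpTo par x (par x)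

theorem lastChildUpTo_le (x q : ℕ) : lastChildUpTo par x q ≤ x := by
  induction x with
  | zero => simp [lastChildUpTo]
  | succ x ih => rw [lastChildUpTo]; split_ifs <;> omega

/-- A set of descendants of several siblings is thus addressed by a single number, the last of these
siblings. The number `0` stands for the empty set. -/
theorem descSib_lastChildUpTo (x q : ℕ) :
    descSib par (lastChildUpTo par x q) = descUpTo par x q := by
  induction x with
  | zero => simp [lastChildUpTo, descUpTo, descSib]
  | succ x ih =>
    rw [lastChildUpTo]
    split_ifs with h
    · rw [descSib, h]
    · rw [ih, descUpTo, if_neg h]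

theorem mem_descUpTo_bounds {x q y : ℕ} (h : y ∈ descUpTo par x q) : 1 ≤ y ∧ y ≤ x := by
  induction x generalizing q with
  | zero => simp [descUpTo] at h
  | succ x ih =>
    rw [descUpTo] at h
    split_ifs at h
    · rw [Finset.mem_insert, Finset.mem_union] at h
      rcases h with rfl | h | h
      · omega
      · have := ih h; omega
      · have := ih h; omega
    · have := ih h; omega

namespace IsElimination

variable (hE : IsElimination H n par)
include hE

/-- Later neighbours of a vertex are pairwise adjacent and the parent is the first of them, so the
parent inherits all later neighbours of its child except itself. Iterated up the tree, this carries
a neighbour `z` of `y` to the ancestor `q`. -/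
theorem eq_or_adj_of_mem_descUpTo {x q y z : ℕ} (hx : x ≤ n) (hy : y ∈ descUpTo par x q)
    (hz : x < z) (hyz : H.Adj y z) : q ≤ z ∧ (z = q ∨ H.Adj q z) := by
  induction x generalizing q with
  | zero => simp [descUpTo] at hy
  | succ x ih =>
    rw [descUpTo] at hy
    split_ifs at hy with h
    · have hx1 : ∀ z, x + 1 < z → H.Adj (x + 1) z → q ≤ z ∧ (z = q ∨ H.Adj q z) := by
        intro z hz hxz
        have h1 := hE.par_le_of_adj _ _ hxz hz
        rw [h] at h1
        refine ⟨h1, ?_⟩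
        by_cases hzq : z = q
        · exact .inl hzq
        · right
          have h2 := hE.bounds z (x + 1) hxz.symm
          have h3 := hE.adj_par (x + 1) (by omega) hx (by omega)
          have h4 := hE.lt_par (x + 1) (by omega) hx
          rw [h] at h3 h4
          exact hE.adj_of_lt _ _ _ h3 hxz h4 hz (Ne.symm hzq)
      rw [Finset.mem_insert, Finset.mem_union] at hy
      rcases hy with rfl | hy | hy
      · exact hx1 z hz hyz
      · exact ih (by omega) hy (by omega)
      · rcases (ih (by omega) hy (by omega)).2 with h1 | h1
        · omega
        · exact hx1 z hz h1
    · exact ih (by omega) hy (by omega)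

/-- Edges join only comparable vertices of the elimination tree. When `x + 1` is added below `q`, a
neighbour of it among the descendants of another pending parent `q'` would force `q' ≤ x + 1` by the
previous lemma. -/
theorem descUpTo_separate {x q q' y y' : ℕ} (hx : x ≤ n) (hq : x < q) (hq' : x < q')
    (hne : q ≠ q') (hy : y ∈ descUpTo par x q) (hy' : y' ∈ descUpTo par x q') :
    y ≠ y' ∧ ¬ H.Adj y y' := by
  induction x generalizing q q' y y' with
  | zero => simp [descUpTo] at hy
  | succ x ih =>
    have key : ∀ {q q' y y'}, x + 1 < q → x + 1 < q' → q ≠ q' → par (x + 1) = q →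
        y ∈ insert (x + 1) (descUpTo par x q ∪ descUpTo par x (x + 1)) →
        y' ∈ descUpTo par x q' → y ≠ y' ∧ ¬ H.Adj y y' := by
      intro q q' y y' hq hq' hne hp hy hy'
      rw [Finset.mem_insert, Finset.mem_union] at hy
      rcases hy with rfl | hy | hy
      · refine ⟨fun h => ?_, fun h => ?_⟩
        · have := mem_descUpTo_bounds hy'
          omega
        · have := (hE.eq_or_adj_of_mem_descUpTo (by omega) hy' (by omega) h.symm).1
          omega
      · exact ih (by omega) (by omega) (by omega) hne hy hy'
      · exact ih (by omega) (by omega) (by omega) (by omega) hy hy'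
    rw [descUpTo] at hy hy'
    split_ifs at hy hy' with h1 h2 h2
    · omega
    · exact key hq hq' hne h1 hy hy'
    · have := key hq' hq hne.symm h2 hy' hy
      exact ⟨this.1.symm, fun h => this.2 h.symm⟩
    · exact ih (by omega) (by omega) (by omega) hne hy hy'

theorem exists_mem_descUpTo {x y : ℕ} (hx : x ≤ n) (hy : 1 ≤ y) (hyx : y ≤ x) :
    ∃ q, x < q ∧ q ≤ n + 1 ∧ y ∈ descUpTo par x q := by
  induction x with
  | zero => omega
  | succ x ih =>
    have h1 := hE.lt_par (x + 1) (by omega) hx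
    have h2 := hE.par_le (x + 1) (by omega) hx
    by_cases hyx' : y = x + 1
    · subst hyx'
      exact ⟨par (x + 1), h1, h2, by simp [descUpTo]⟩
    · obtain ⟨q, hq, hqn, hy'⟩ := ih (by omega) (by omega)
      by_cases hqx : q = x + 1
      · subst hqx
        exact ⟨par (x + 1), h1, h2, by simp [descUpTo, hy']⟩
      · refine ⟨q, by omega, hqn, ?_⟩
        rw [descUpTo]
        split_ifs
        · simp [hy']
        · exact hy'

theorem descUpTo_eq_Icc : descUpTo par n (n + 1) = Finset.Icc 1 n := by
  ext y
  rw [Finset.mem_Icc]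
  refine ⟨mem_descUpTo_bounds, fun h => ?_⟩
  obtain ⟨q, hq, hqn, hy⟩ := hE.exists_mem_descUpTo le_rfl h.1 h.2
  rwa [show q = n + 1 by omega] at hy

/-- All roots count as siblings under the fictitious parent `n + 1`, and `n` is the last of them. So
the index `n` addresses the whole vertex set. -/
theorem descSib_self (hn : 1 ≤ n) : descSib par n = Finset.Icc 1 n := by
  have h1 := hE.lt_par n hn le_rfl
  have h2 := hE.par_le n hn le_rfl
  rw [descSib, show par n = n + 1 by omega, hE.descUpTo_eq_Icc]

theorem lastChildUpTo_eq {x : ℕ} (hx : 1 ≤ x) {y : ℕ} (hy : y ≤ n) (hxy : x ≤ y) :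
    lastChildUpTo par y x = lastChildUpTo par (x - 1) x := by
  induction y with
  | zero => omega
  | succ y ih =>
    rw [lastChildUpTo, if_neg]
    · by_cases h : x = y + 1
      · subst h; rfl
      · exact ih (by omega) (by omega)
    · have := hE.lt_par (y + 1) (by omega) hy
      omega

theorem lastChildUpTo_lt {x : ℕ} (hx : 1 ≤ x) (hxn : x ≤ n) : lastChildUpTo par n x < x := by
  rw [hE.lastChildUpTo_eq hx le_rfl hxn]
  have := lastChildUpTo_le (par := par) (x - 1) x
  omega

theorem descSib_lastChild {x : ℕ} (hx : 1 ≤ x) (hxn : x ≤ n) :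
    descSib par (lastChildUpTo par n x) = descUpTo par (x - 1) x := by
  rw [hE.lastChildUpTo_eq hx le_rfl hxn, descSib_lastChildUpTo]

/-- The left-child right-sibling decomposition: what belongs to the previous sibling, then `x`, then
what belongs to the last child of `x`. -/
theorem descSib_eq {x : ℕ} (hx : 1 ≤ x) (hxn : x ≤ n) :
    descSib par x = descSib par (lastChildUpTo par (x - 1) (par x)) ∪
      insert x (descSib par (lastChildUpTo par n x)) := by
  rw [hE.descSib_lastChild hx hxn, descSib_lastChildUpTo]
  obtain ⟨x, rfl⟩ : ∃ y, x = y + 1 := ⟨x - 1, by omega⟩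
  rw [descSib, descUpTo, if_pos rfl, Nat.add_sub_cancel, Finset.union_insert]

end IsElimination

/-! ### Choosing independent children along the elimination tree -/

/-- `Choice H u v A i l`: some set of pairwise nonadjacent vertices in `A` can be the children of `v`
in a branch below `u`, with `i` vertices and at least `l` leaves below them. -/
def Choice (H : SimpleGraph ℕ) (u v : ℕ) (A : Finset ℕ) (i l : ℕ) : Prop :=
  ∃ I ⊆ A, ∃ sz lf : ℕ → ℕ, (∀ w ∈ I, H.Adj v w ∧ w ≠ u ∧ ¬ H.Adj u w) ∧
    (∀ w ∈ I, ∀ w' ∈ I, ¬ H.Adj w w') ∧ (∀ w ∈ I, H.HasBranch v w (sz w) (lf w)) ∧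
    ∑ w ∈ I, sz w = i ∧ l ≤ ∑ w ∈ I, lf w

open Classical in
/-- The vertices of `A` that are not adjacent to `s`. -/
noncomputable def avoiding (H : SimpleGraph ℕ) (s : ℕ) (A : Finset ℕ) : Finset ℕ :=
  A.filter fun y => ¬ H.Adj s y

theorem mem_avoiding {s y : ℕ} {A : Finset ℕ} : y ∈ avoiding H s A ↔ y ∈ A ∧ ¬ H.Adj s y := by
  simp [avoiding]

/-- Like `Choice`, where `x` is chosen together with vertices in `B` not adjacent to it. -/
def ChoiceWith (H : SimpleGraph ℕ) (u v x : ℕ) (B : Finset ℕ) (i l : ℕ) : Prop :=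
  (H.Adj v x ∧ x ≠ u ∧ ¬ H.Adj u x) ∧ ∃ i₁ i₂ l₁ l₂, i₁ + i₂ = i ∧ l ≤ l₁ + l₂ ∧
    H.HasBranch v x i₁ l₁ ∧ Choice H u v (avoiding H x B) i₂ l₂

theorem Choice.leaves_le {u v i l : ℕ} {A : Finset ℕ} (h : Choice H u v A i l) : l ≤ i := by
  obtain ⟨I, -, sz, lf, -, -, hb, hi, hl⟩ := h
  rw [← hi]
  exact hl.trans (Finset.sum_le_sum fun w hw => (hb w hw).leaves_le)

theorem ChoiceWith.leaves_le {u v x i l : ℕ} {A : Finset ℕ} (h : ChoiceWith H u v x A i l) :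
    l ≤ i := by
  obtain ⟨-, i₁, i₂, l₁, l₂, hi, hl, hb, hc⟩ := h
  have := hb.leaves_le
  have := hc.leaves_le
  omega

theorem choice_zero {u v l : ℕ} {A : Finset ℕ} : Choice H u v A 0 l ↔ l = 0 := by
  refine ⟨fun h => by have := h.leaves_le; omega, ?_⟩
  rintro rfl
  exact ⟨∅, by simp, 0, 0, by simp⟩

theorem choice_empty {u v i l : ℕ} : Choice H u v ∅ i l ↔ i = 0 ∧ l = 0 := by
  constructor
  · rintro ⟨I, hI, sz, lf, -, -, -, h1, h2⟩
    rw [Finset.subset_empty] at hI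
    subst hI
    simp at h1 h2
    exact ⟨h1.symm, h2⟩
  · rintro ⟨rfl, rfl⟩
    exact choice_zero.2 rfl

theorem exists_hasBranch_one {u v l : ℕ} : (∃ l', l ≤ l' ∧ H.HasBranch u v 1 l') ↔ l ≤ 1 := by
  constructor
  · rintro ⟨l', hl, h⟩
    exact hl.trans h.leaves_le
  · intro hl
    refine ⟨1, hl, ?_⟩
    simpa using HasBranch.mk (G := H) u v ∅ 0 0 (by simp) (by simp) (by simp)

/-- For `i ≠ 0` the root has a child, so it adds a vertex but no leaf. The case `i = 0` differs, as
the root is then the only leaf. -/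
theorem exists_hasBranch_succ (hb : ∀ x y, H.Adj x y → 1 ≤ x ∧ x ≤ n) {u v i l : ℕ} (hi : i ≠ 0) :
    (∃ l', l ≤ l' ∧ H.HasBranch u v (i + 1) l') ↔ Choice H u v (Finset.Icc 1 n) i l := by
  constructor
  · rintro ⟨l', hl, h⟩
    generalize hj : i + 1 = j at h
    cases h with
    | mk _ _ I sz lf hI hind hbr =>
      refine ⟨I, fun w hw => Finset.mem_Icc.2 (hb w v (hI w hw).1.symm), sz, lf, hI, hind, hbr,
        by omega, ?_⟩
      rw [if_pos] at hl
      · exact hl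
      · rw [Finset.nonempty_iff_ne_empty]
        rintro rfl
        simp at hj
        exact hi hj
  · rintro ⟨I, hA, sz, lf, hI, hind, hbr, h1, h2⟩
    have hne : I.Nonempty := by
      rw [Finset.nonempty_iff_ne_empty]
      rintro rfl
      exact hi (by simpa using h1.symm)
    refine ⟨_, h2, ?_⟩
    have := HasBranch.mk u v I sz lf hI hind hbr
    rwa [if_pos hne, h1, add_comm] at this

/-- Without edges between `A` and `B`, choices in the two sets are independent. The sizes and leaf
numbers are combined piecewise. -/
theorem choice_union {u v i l : ℕ} {A B : Finset ℕ}
    (hAB : ∀ x ∈ A, ∀ y ∈ B, x ≠ y ∧ ¬ H.Adj x y) :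
    Choice H u v (A ∪ B) i l ↔ ∃ i₁ i₂ l₁ l₂, i₁ + i₂ = i ∧ l ≤ l₁ + l₂ ∧
      Choice H u v A i₁ l₁ ∧ Choice H u v B i₂ l₂ := by
  classical
  constructor
  · rintro ⟨I, hI, sz, lf, h1, h2, h3, h4, h5⟩
    have hsplit : I = I.filter (· ∈ A) ∪ I.filter (· ∈ B) := by
      ext x
      simp only [Finset.mem_union, Finset.mem_filter]
      refine ⟨fun h => ?_, by tauto⟩
      have := Finset.mem_union.1 (hI h)
      tauto
    have hd : Disjoint (I.filter (· ∈ A)) (I.filter (· ∈ B)) := by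
      rw [Finset.disjoint_left]
      intro x hx hx'
      exact (hAB x (Finset.mem_filter.1 hx).2 x (Finset.mem_filter.1 hx').2).1 rfl
    rw [hsplit, Finset.sum_union hd] at h4 h5
    refine ⟨_, _, _, _, h4, h5, ⟨I.filter (· ∈ A), fun x hx => (Finset.mem_filter.1 hx).2, sz, lf,
      ?_, ?_, ?_, rfl, le_rfl⟩, ⟨I.filter (· ∈ B), fun x hx => (Finset.mem_filter.1 hx).2, sz, lf,
      ?_, ?_, ?_, rfl, le_rfl⟩⟩
    · exact fun w hw => h1 w (Finset.mem_filter.1 hw).1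
    · exact fun w hw w' hw' => h2 w (Finset.mem_filter.1 hw).1 w' (Finset.mem_filter.1 hw').1
    · exact fun w hw => h3 w (Finset.mem_filter.1 hw).1
    · exact fun w hw => h1 w (Finset.mem_filter.1 hw).1
    · exact fun w hw w' hw' => h2 w (Finset.mem_filter.1 hw).1 w' (Finset.mem_filter.1 hw').1
    · exact fun w hw => h3 w (Finset.mem_filter.1 hw).1
  · rintro ⟨i₁, i₂, l₁, l₂, rfl, hl, ⟨I, hI, sz, lf, h1, h2, h3, rfl, h5⟩,
      ⟨J, hJ, sz', lf', h1', h2', h3', rfl, h5'⟩⟩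
    have hd : Disjoint I J := by
      rw [Finset.disjoint_left]
      intro x hx hx'
      exact (hAB x (hI hx) x (hJ hx')).1 rfl
    have e1 : ∀ f g : ℕ → ℕ, ∑ w ∈ I ∪ J, (if w ∈ I then f w else g w) =
        ∑ w ∈ I, f w + ∑ w ∈ J, g w := by
      intro f g
      rw [Finset.sum_union hd]
      congr 1
      · exact Finset.sum_congr rfl fun w hw => if_pos hw
      · exact Finset.sum_congr rfl fun w hw => if_neg fun h => Finset.disjoint_left.1 hd h hw
    refine ⟨I ∪ J, Finset.union_subset_union hI hJ, fun w => if w ∈ I then sz w else sz' w,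
      fun w => if w ∈ I then lf w else lf' w, ?_, ?_, ?_, e1 _ _, ?_⟩
    · intro w hw
      rcases Finset.mem_union.1 hw with hw | hw
      exacts [h1 w hw, h1' w hw]
    · intro w hw w' hw'
      rcases Finset.mem_union.1 hw with hw | hw <;> rcases Finset.mem_union.1 hw' with hw' | hw'
      · exact h2 w hw w' hw'
      · exact (hAB w (hI hw) w' (hJ hw')).2
      · exact fun h => (hAB w' (hI hw') w (hJ hw)).2 h.symm
      · exact h2' w hw w' hw'
    · intro w hw
      simp only
      split_ifs with hwI
      · exact h3 w hwI
      · exact h3' w ((Finset.mem_union.1 hw).resolve_left hwI)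
    · rw [e1]
      omega

theorem choice_insert {u v x i l : ℕ} {B : Finset ℕ} (hx : x ∉ B) :
    Choice H u v (insert x B) i l ↔ Choice H u v B i l ∨ ChoiceWith H u v x B i l := by
  classical
  constructor
  · rintro ⟨I, hI, sz, lf, h1, h2, h3, h4, h5⟩
    by_cases hxI : x ∈ I
    · right
      rw [← Finset.add_sum_erase I _ hxI] at h4 h5
      refine ⟨h1 x hxI, _, _, _, _, h4, h5, h3 x hxI, I.erase x, ?_, sz, lf, ?_, ?_, ?_, rfl,
        le_rfl⟩
      · intro y hy
        obtain ⟨hyx, hyI⟩ := Finset.mem_erase.1 hy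
        exact mem_avoiding.2 ⟨(Finset.mem_insert.1 (hI hyI)).resolve_left hyx, h2 x hxI y hyI⟩
      · exact fun w hw => h1 w (Finset.mem_of_mem_erase hw)
      · exact fun w hw w' hw' => h2 w (Finset.mem_of_mem_erase hw) w' (Finset.mem_of_mem_erase hw')
      · exact fun w hw => h3 w (Finset.mem_of_mem_erase hw)
    · left
      refine ⟨I, fun y hy => ?_, sz, lf, h1, h2, h3, h4, h5⟩
      refine (Finset.mem_insert.1 (hI hy)).resolve_left ?_
      rintro rfl
      exact hxI hy
  · rintro (⟨I, hI, h⟩ | ⟨hv, i₁, i₂, l₁, l₂, hi, hl, hb, hc⟩)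
    · exact ⟨I, hI.trans (Finset.subset_insert _ _), h⟩
    · have h1 : Choice H u v {x} i₁ l₁ := by
        refine ⟨{x}, subset_rfl, fun _ => i₁, fun _ => l₁, ?_, ?_, ?_, by simp, by simp⟩
        · intro w hw
          rw [Finset.mem_singleton.1 hw]
          exact hv
        · intro w hw w' hw'
          rw [Finset.mem_singleton.1 hw, Finset.mem_singleton.1 hw']
          exact H.irrefl
        · intro w hw
          rw [Finset.mem_singleton.1 hw]
          exact hb
      obtain ⟨I, hI, h⟩ := (choice_union (H := H) (A := {x}) (B := avoiding H x B) (by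
        intro a ha y hy
        rw [Finset.mem_singleton.1 ha]
        obtain ⟨h1, h2⟩ := mem_avoiding.1 hy
        exact ⟨fun h => hx (h ▸ h1), h2⟩)).2 ⟨i₁, i₂, l₁, l₂, hi, hl, h1, hc⟩
      refine ⟨I, hI.trans ?_, h⟩
      intro y hy
      rcases Finset.mem_union.1 hy with h | h
      · rw [Finset.mem_singleton.1 h]; exact Finset.mem_insert_self _ _
      · exact Finset.mem_insert_of_mem (mem_avoiding.1 h).1

/-- The recurrence for the choices among the descendants of `x` and of its earlier siblings. -/
theorem IsElimination.choice_descSib (hE : IsElimination H n par) {u v x s i l : ℕ} (hx : 1 ≤ x)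
    (hxn : x ≤ n) (hs : x < s) :
    Choice H u v (avoiding H s (descSib par x)) i l ↔ ∃ i₁ i₂ l₁ l₂, i₁ + i₂ = i ∧ l ≤ l₁ + l₂ ∧
      Choice H u v (avoiding H s (descSib par (lastChildUpTo par (x - 1) (par x)))) i₁ l₁ ∧
      (Choice H u v (avoiding H s (descSib par (lastChildUpTo par n x))) i₂ l₂ ∨
        ¬ H.Adj x s ∧ ChoiceWith H u v x (descSib par (lastChildUpTo par n x)) i₂ l₂) := by
  have hp := hE.lt_par x hx hxn
  set A := descSib par (lastChildUpTo par (x - 1) (par x)) with hA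
  set B := descSib par (lastChildUpTo par n x) with hB
  have hA' : A = descUpTo par (x - 1) (par x) := descSib_lastChildUpTo _ _
  have hB' : B = descUpTo par (x - 1) x := hE.descSib_lastChild hx hxn
  have hxB : x ∉ B := fun h => by
    rw [hB'] at h
    have := mem_descUpTo_bounds h
    omega
  have hAB : ∀ a ∈ A, ∀ b ∈ insert x B, a ≠ b ∧ ¬ H.Adj a b := by
    intro a ha b hb
    rw [hA'] at ha
    rcases Finset.mem_insert.1 hb with rfl | hb
    · refine ⟨fun h => ?_, fun h => ?_⟩
      · have := mem_descUpTo_bounds ha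
        omega
      · have := (hE.eq_or_adj_of_mem_descUpTo (by omega) ha (by omega) h).1
        omega
    · rw [hB'] at hb
      exact hE.descUpTo_separate (by omega) (by omega) (by omega) hp.ne' ha hb
  have hun : avoiding H s (descSib par x) = avoiding H s A ∪ avoiding H s (insert x B) := by
    rw [hE.descSib_eq hx hxn, avoiding, Finset.filter_union]
    rfl
  rw [hun, choice_union fun a ha b hb => hAB a (mem_avoiding.1 ha).1 b (mem_avoiding.1 hb).1]
  have key : ∀ i l, Choice H u v (avoiding H s (insert x B)) i l ↔
      Choice H u v (avoiding H s B) i l ∨ ¬ H.Adj x s ∧ ChoiceWith H u v x B i l := by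
    intro i l
    by_cases hxs : H.Adj x s
    · have : avoiding H s (insert x B) = avoiding H s B := by
        ext y
        rw [mem_avoiding, mem_avoiding, Finset.mem_insert]
        refine ⟨fun h => ⟨h.1.resolve_left ?_, h.2⟩, fun h => ⟨.inr h.1, h.2⟩⟩
        rintro rfl
        exact h.2 hxs.symm
      simp [this, hxs]
    · have : avoiding H s (insert x B) = insert x (avoiding H s B) := by
        ext y
        rw [mem_avoiding, Finset.mem_insert, Finset.mem_insert, mem_avoiding]
        refine ⟨fun h => h.1.imp_right fun h' => ⟨h', h.2⟩, ?_⟩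
        rintro (rfl | h)
        · exact ⟨.inl rfl, fun h => hxs h.symm⟩
        · exact ⟨.inr h.1, h.2⟩
      rw [this, choice_insert fun h => hxB (mem_avoiding.1 h).1]
      -- The point of the recurrence: a neighbour of `s` below `x` would make `x` adjacent to `s`.
      -- So once `x` is chosen, avoiding `x` already implies avoiding `s`, and one forbidden vertex
      -- is enough.
      have h2 : avoiding H x (avoiding H s B) = avoiding H x B := by
        ext y
        rw [mem_avoiding, mem_avoiding, mem_avoiding]
        refine ⟨fun h => ⟨h.1.1, h.2⟩, fun h => ⟨⟨h.1, fun hsy => ?_⟩, h.2⟩⟩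
        have hy := h.1
        rw [hB'] at hy
        rcases (hE.eq_or_adj_of_mem_descUpTo (by omega) hy (by omega) hsy.symm).2 with h3 | h3
        · omega
        · exact hxs h3
      simp [ChoiceWith, h2, hxs]
  simp only [key]

end SimpleGraph

/-! ### A calculus for running time and word size -/

namespace RAM

variable {W : ℕ} {s : State}

theorem State.ext' {s s' : State} (h₁ : ∀ x, s.reg x = s'.reg x)
    (h₂ : ∀ A i, s.arr A i = s'.arr A i) : s = s' := by
  cases s; cases s'
  congr
  · exact funext h₁
  · exact funext fun A => funext (h₂ A)

@[simp] theorem State.setReg_reg (s : State) (x v y : ℕ) :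
    (s.setReg x v).reg y = if y = x then v else s.reg y := by
  simp [State.setReg, Function.update_apply]

@[simp] theorem State.setReg_arr (s : State) (x v : ℕ) : (s.setReg x v).arr = s.arr := rfl

@[simp] theorem State.setArr_reg (s : State) (A i v : ℕ) : (s.setArr A i v).reg = s.reg := rfl

theorem State.setArr_arr (s : State) (A i v B j : ℕ) :
    (s.setArr A i v).arr B j = if B = A ∧ j = i then v else s.arr B j := by
  by_cases h : B = A
  · subst h; simp [State.setArr, Function.update_apply]
  · simp [State.setArr, h]

theorem State.setArr_arr_of_ne (s : State) {A B : ℕ} (i v : ℕ) (h : B ≠ A) :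
    (s.setArr A i v).arr B = s.arr B := by
  funext j; simp [State.setArr_arr, h]

theorem State.setArr_arr_self (s : State) (A i v j : ℕ) :
    (s.setArr A i v).arr A j = if j = i then v else s.arr A j := by
  simp [State.setArr_arr]

namespace Exp

instance : Add Exp := ⟨.bin .add⟩
instance : Sub Exp := ⟨.bin .sub⟩
instance : Mul Exp := ⟨.bin .mul⟩

/-- The comparison `e < f`. -/
def less (e f : Exp) : Exp := .bin .lt e f

/-- The comparison `e = f`. -/
def same (e f : Exp) : Exp := .bin .eq e f

end Exp

/-- The truth value of a proposition as a number. -/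
noncomputable def ind (p : Prop) : ℕ := open Classical in if p then 1 else 0

theorem ind_true {p : Prop} (h : p) : ind p = 1 := by simp [ind, h]

theorem ind_false {p : Prop} (h : ¬ p) : ind p = 0 := by simp [ind, h]

theorem ind_le (p : Prop) : ind p ≤ 1 := by
  by_cases h : p <;> simp [ind, h]

theorem ind_eq_zero {p : Prop} : ind p = 0 ↔ ¬ p := by
  by_cases h : p <;> simp [ind, h]

theorem one_sub_ind (p : Prop) : 1 - ind p = ind (¬ p) := by
  by_cases h : p <;> simp [ind, h]

theorem ind_mul (p q : Prop) : ind p * ind q = ind (p ∧ q) := by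
  by_cases h : p <;> by_cases h' : q <;> simp [ind, h, h']

/-- Values are characterised throughout by the numbers below them. In this form, multiplication by
an indicator is a guard that replaces a branch of the program. -/
theorem lt_ind_mul {p : Prop} {l m : ℕ} : l < ind p * m ↔ p ∧ l < m := by
  by_cases h : p <;> simp [ind, h]

/-- In the state `s` the expression `e` can be evaluated with words bounded by `W`, with value `v`. -/
def Evals (W : ℕ) (s : State) (e : Exp) (v : ℕ) : Prop := e.Fits W s ∧ e.eval s = v

namespace Evals

variable {e f : Exp} {v w : ℕ}

theorem le (h : Evals W s e v) : v ≤ W := by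
  obtain ⟨h₁, rfl⟩ := h
  cases e with
  | const c => exact h₁
  | reg x => exact h₁
  | arr A i => exact h₁.2
  | bin o e f => exact h₁.2.2

theorem const {c : ℕ} (h : c ≤ W) : Evals W s (.const c) c := ⟨h, rfl⟩

theorem reg {x : ℕ} (h : s.reg x = v) (hv : v ≤ W) : Evals W s (.reg x) v :=
  ⟨by rw [Exp.Fits, h]; exact hv, h⟩

theorem arr {A : ℕ} (he : Evals W s e w) (h : s.arr A w = v) (hv : v ≤ W) :
    Evals W s (.arr A e) v := by
  obtain ⟨h₁, rfl⟩ := he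
  exact ⟨⟨h₁, by rw [h]; exact hv⟩, h⟩

theorem add (he : Evals W s e v) (hf : Evals W s f w) (h : v + w ≤ W) :
    Evals W s (e + f) (v + w) := by
  obtain ⟨h₁, rfl⟩ := he
  obtain ⟨h₂, rfl⟩ := hf
  exact ⟨⟨h₁, h₂, h⟩, rfl⟩

theorem sub (he : Evals W s e v) (hf : Evals W s f w) : Evals W s (e - f) (v - w) := by
  have := he.le
  obtain ⟨h₁, rfl⟩ := he
  obtain ⟨h₂, rfl⟩ := hf
  exact ⟨⟨h₁, h₂, (Nat.sub_le _ _).trans this⟩, rfl⟩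

theorem mul (he : Evals W s e v) (hf : Evals W s f w) (h : v * w ≤ W) :
    Evals W s (e * f) (v * w) := by
  obtain ⟨h₁, rfl⟩ := he
  obtain ⟨h₂, rfl⟩ := hf
  exact ⟨⟨h₁, h₂, h⟩, rfl⟩

theorem ind_mul {p : Prop} (he : Evals W s e (ind p)) (hf : Evals W s f w) :
    Evals W s (e * f) (ind p * w) := by
  refine he.mul hf ?_
  calc ind p * w ≤ 1 * w := Nat.mul_le_mul_right _ (ind_le p)
    _ ≤ W := by rw [one_mul]; exact hf.le

theorem and {p q : Prop} (he : Evals W s e (ind p)) (hf : Evals W s f (ind q)) :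
    Evals W s (e * f) (ind (p ∧ q)) := by
  rw [← RAM.ind_mul]
  exact he.ind_mul hf

theorem not {p : Prop} (hW : 1 ≤ W) (he : Evals W s e (ind p)) :
    Evals W s (.const 1 - e) (ind (¬ p)) := by
  rw [← one_sub_ind]
  exact (const hW).sub he

theorem less (hW : 1 ≤ W) (he : Evals W s e v) (hf : Evals W s f w) :
    Evals W s (e.less f) (ind (v < w)) := by
  obtain ⟨h₁, rfl⟩ := he
  obtain ⟨h₂, rfl⟩ := hf
  have h : (Exp.bin .lt e f).eval s = ind (e.eval s < f.eval s) := by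
    simp only [Exp.eval, Op.eval, ind]
    split_ifs <;> rfl
  refine ⟨⟨h₁, h₂, ?_⟩, h⟩
  exact h.le.trans ((ind_le _).trans hW)

theorem same (hW : 1 ≤ W) (he : Evals W s e v) (hf : Evals W s f w) :
    Evals W s (e.same f) (ind (v = w)) := by
  obtain ⟨h₁, rfl⟩ := he
  obtain ⟨h₂, rfl⟩ := hf
  have h : (Exp.bin .eq e f).eval s = ind (e.eval s = f.eval s) := by
    simp only [Exp.eval, Op.eval, ind]
    split_ifs <;> rfl
  refine ⟨⟨h₁, h₂, ?_⟩, h⟩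
  exact h.le.trans ((ind_le _).trans hW)

end Evals

/-- With words bounded by `W`, the program `p` started in `s` halts after at most `t` steps in a
state that satisfies `Q`. -/
def WP (W : ℕ) (p : Prog) (t : ℕ) (Q : State → Prop) (s : State) : Prop :=
  ∃ t' s', Exec W p s t' s' ∧ t' ≤ t ∧ Q s'

/-- Repeat `p` and increase the register `x` as long as it is less than `e`. -/
def forLoop (x : ℕ) (e : Exp) (p : Prog) : Prog :=
  .loop ((Exp.reg x).less e) (.seq p (.assign x (.reg x + .const 1)))

/-- Replace the register `t` by its maximum with the values of `e` where the register `j` runs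
through the numbers less than `m`. -/
def maxLoop (j t : ℕ) (m e : Exp) : Prog :=
  .seq (.assign j (.const 0))
    (forLoop j m (.branch ((Exp.reg t).less e) (.assign t e) .nop))

namespace WP

variable {p q : Prog} {t t₁ t₂ : ℕ} {Q R : State → Prop} {e f : Exp} {x v w : ℕ}

theorem mono (h : WP W p t₁ Q s) (ht : t₁ ≤ t₂) (hQ : ∀ s, Q s → R s) : WP W p t₂ R s := by
  obtain ⟨t', s', h₁, h₂, h₃⟩ := h
  exact ⟨t', s', h₁, h₂.trans ht, hQ _ h₃⟩

theorem assign (he : Evals W s e v) (ht : e.cost + 1 ≤ t) (hQ : Q (s.setReg x v)) :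
    WP W (.assign x e) t Q s := by
  obtain ⟨h₁, rfl⟩ := he
  exact ⟨_, _, .assign s x e h₁, ht, hQ⟩

theorem store {A : ℕ} (he : Evals W s e v) (hf : Evals W s f w) (ht : e.cost + f.cost + 1 ≤ t)
    (hQ : Q (s.setArr A v w)) : WP W (.store A e f) t Q s := by
  obtain ⟨h₁, rfl⟩ := he
  obtain ⟨h₂, rfl⟩ := hf
  exact ⟨_, _, .store s A e f h₁ h₂, ht, hQ⟩

theorem seq (h : WP W p t₁ (WP W q t₂ Q) s) (ht : t₁ + t₂ ≤ t) : WP W (.seq p q) t Q s := by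
  obtain ⟨t', s', h₁, h₂, t'', s'', h₃, h₄, h₅⟩ := h
  exact ⟨_, _, .seq h₁ h₃, by omega, h₅⟩

theorem branch (he : Evals W s e v) (hp : v ≠ 0 → WP W p t₁ Q s) (hq : v = 0 → WP W q t₁ Q s)
    (ht : e.cost + 1 + t₁ ≤ t) : WP W (.branch e p q) t Q s := by
  obtain ⟨h₁, rfl⟩ := he
  by_cases h : e.eval s = 0
  · obtain ⟨t', s', h₂, h₃, h₄⟩ := hq h
    exact ⟨_, _, .branch_false h₁ h h₂, by omega, h₄⟩
  · obtain ⟨t', s', h₂, h₃, h₄⟩ := hp h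
    exact ⟨_, _, .branch_true h₁ h h₂, by omega, h₄⟩

theorem nop (ht : 1 ≤ t) (hQ : Q s) : WP W .nop t Q s := ⟨_, _, .nop s, ht, hQ⟩

theorem forLoop_aux {m k₀ tb : ℕ} {Inv : ℕ → State → Prop} (hk : k₀ ≤ m) (hW : 1 ≤ W)
    (hreg : ∀ k s, Inv k s → s.reg x = k) (he : ∀ k s, k ≤ m → Inv k s → Evals W s e m)
    (hb : ∀ k s, k₀ ≤ k → k < m → Inv k s →
      WP W p tb (fun s' => s'.reg x = k ∧ Inv (k + 1) (s'.setReg x (k + 1))) s)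
    (h0 : Inv k₀ s) :
    WP W (forLoop x e p) ((m - k₀) * (tb + e.cost + 7) + (e.cost + 3)) (Inv m) s := by
  have key : ∀ d k s, k + d = m → k₀ ≤ k → Inv k s →
      WP W (forLoop x e p) (d * (tb + e.cost + 7) + (e.cost + 3)) (Inv m) s := by
    intro d
    induction d with
    | zero =>
      intro k s hkd _ hI
      obtain rfl : k = m := by omega
      have h1 := he k s le_rfl hI
      have h2 := (Evals.reg (W := W) (hreg k s hI) h1.le).less hW h1
      rw [ind_false (by omega)] at h2
      exact ⟨_, _, .loop_done h2.1 h2.2, by simp [Exp.cost, Exp.less]; omega, hI⟩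
    | succ d ih =>
      intro k s hkd hk0 hI
      have h1 := he k s (by omega) hI
      have hmW := h1.le
      have h2 := (Evals.reg (W := W) (hreg k s hI) (by omega)).less hW h1
      rw [ind_true (by omega)] at h2
      obtain ⟨t', s', h3, h4, h5, h6⟩ := hb k s hk0 (by omega) hI
      obtain ⟨t'', s'', h7, h8, h9⟩ := ih (k + 1) _ (by omega) (by omega) h6
      have h10 : Evals W s' (.reg x + .const 1) (k + 1) :=
        (Evals.reg h5 (by omega)).add (.const hW) (by omega)
      have h11 := Exec.assign (W := W) s' x _ h10.1
      rw [h10.2] at h11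
      refine ⟨_, _, .loop_step h2.1 (by rw [h2.2]; omega) (.seq h3 h11) h7, ?_, h9⟩
      have hc : (Exp.reg x + Exp.const 1 : Exp).cost = 3 := rfl
      have hc' : ((Exp.reg x).less e).cost = e.cost + 2 := by simp [Exp.cost, Exp.less]; omega
      rw [hc, hc', Nat.succ_mul]
      omega
  exact key (m - k₀) k₀ s (by omega) le_rfl h0

/-- Since `X` and `L` are positive, the additive overhead of the tests and increments is absorbed
into the constant in front of `L * X`. Bounds for nested loops thus remain a numeral times a
product. -/
theorem forLoop {m k₀ c X L : ℕ} {Inv : ℕ → State → Prop} (hk : k₀ ≤ m) (hW : 1 ≤ W)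
    (hreg : ∀ k s, Inv k s → s.reg x = k) (he : ∀ k s, k ≤ m → Inv k s → Evals W s e m)
    (hb : ∀ k s, k₀ ≤ k → k < m → Inv k s →
      WP W p (c * X) (fun s' => s'.reg x = k ∧ Inv (k + 1) (s'.setReg x (k + 1))) s)
    (h0 : Inv k₀ s) (hX : 1 ≤ X) (hL : 1 ≤ L) (hmL : m - k₀ ≤ L)
    (ht : (c + 2 * e.cost + 10) * (L * X) ≤ t) (hQ : ∀ s, Inv m s → Q s) :
    WP W (RAM.forLoop x e p) t Q s := by
  refine (forLoop_aux hk hW hreg he hb h0).mono (le_trans ?_ ht) hQ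
  calc (m - k₀) * (c * X + e.cost + 7) + (e.cost + 3)
      ≤ L * (c * X + e.cost + 7) + (e.cost + 3) := by gcongr
    _ ≤ L * (c * X + e.cost * X + 7 * X) + (e.cost + 3) * (L * X) := by
        gcongr
        · exact Nat.le_mul_of_pos_right _ hX
        · omega
        · exact Nat.le_mul_of_pos_right _ (Nat.mul_pos hL hX)
    _ = (c + 2 * e.cost + 10) * (L * X) := by ring

/-- The result is described by its strict lower bounds, which turns the maximum into an existential
quantifier and matches the recurrences for feasibility. The expressions must evaluate for all
contents of the two registers that the loop changes. -/
theorem maxLoop {j r m L : ℕ} {M : Exp} {g : ℕ → ℕ} (hjr : j ≠ r) (hW : 1 ≤ W)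
    (hM : ∀ k y, Evals W ((s.setReg r y).setReg j k) M m)
    (he : ∀ k y, k < m → y ≤ W → Evals W ((s.setReg r y).setReg j k) e (g k))
    (hr : s.reg r ≤ W) (hL : 1 ≤ L) (hmL : m ≤ L)
    (ht : (2 * e.cost + 2 * M.cost + 20) * L ≤ t)
    (hQ : ∀ y, (∀ l, l < y ↔ l < s.reg r ∨ ∃ k < m, l < g k) →
      Q ((s.setReg r y).setReg j m)) :
    WP W (RAM.maxLoop j r M e) t Q s := by
  let Inv : ℕ → State → Prop := fun k s' => ∃ y ≤ W, s' = (s.setReg r y).setReg j k ∧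
    ∀ l, l < y ↔ l < s.reg r ∨ ∃ k' < k, l < g k'
  refine seq (t₁ := 2 * L) (t₂ := (2 * e.cost + 2 * M.cost + 18) * L)
    (assign (v := 0) (.const (by omega)) (by simp [Exp.cost]; omega) ?_) (by
      rw [← Nat.add_mul]; refine le_trans (le_of_eq ?_) ht; congr 1; omega)
  refine forLoop (m := m) (k₀ := 0) (c := 2 * e.cost + 8) (X := 1) (L := L) (Inv := Inv)
    (Nat.zero_le _) hW ?_ ?_ ?_ ?_ le_rfl hL (by omega) (by
      refine le_of_eq ?_; rw [mul_one]; congr 1; omega) ?_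
  · rintro k _ ⟨y, -, rfl, -⟩
    simp
  · rintro k _ - ⟨y, -, rfl, -⟩
    exact hM k y
  · rintro k _ - hk ⟨y, hyW, rfl, hy⟩
    have hg := he k y hk hyW
    have hrj : r ≠ j := Ne.symm hjr
    have hry : ((s.setReg r y).setReg j k).reg r = y := by simp [hrj]
    refine branch (t₁ := e.cost + 1) ((Evals.reg hry hyW).less hW hg) ?_ ?_ ?_
    · intro h
      have hlt : y < g k := by
        by_contra h'
        exact h (ind_false h')
      refine assign hg le_rfl ⟨by simp [hjr], g k, hg.le, ?_, ?_⟩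
      · refine State.ext' (fun z => ?_) (fun A i => rfl)
        simp only [State.setReg_reg]
        split_ifs <;> simp_all
      · intro l
        have := hy l
        constructor
        · intro hl
          exact .inr ⟨k, by omega, hl⟩
        · rintro (hl | ⟨k', hk', hl⟩)
          · have := this.2 (.inl hl)
            omega
          · by_cases hkk : k' = k
            · rwa [hkk] at hl
            · have := this.2 (.inr ⟨k', by omega, hl⟩)
              omega
    · intro h
      have hle : ¬ y < g k := ind_eq_zero.1 h
      refine nop (by omega) ⟨by simp, y, hyW, ?_, ?_⟩
      · refine State.ext' (fun z => ?_) (fun A i => rfl)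
        simp only [State.setReg_reg]
        split_ifs <;> rfl
      · intro l
        rw [hy l]
        constructor
        · rintro (hl | ⟨k', hk', hl⟩)
          · exact .inl hl
          · exact .inr ⟨k', by omega, hl⟩
        · rintro (hl | ⟨k', hk', hl⟩)
          · exact .inl hl
          · by_cases hkk : k' = k
            · rw [hkk] at hl
              exact (hy l).1 (by omega)
            · exact .inr ⟨k', by omega, hl⟩
    · simp [Exp.cost, Exp.less]; omega
  · refine ⟨s.reg r, hr, ?_, by simp⟩
    refine State.ext' (fun z => ?_) (fun A i => rfl)
    simp only [State.setReg_reg]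
    split_ifs with h1 h2 <;> simp_all
  · rintro _ ⟨y, hyW, rfl, hy⟩
    exact hQ y hy

end WP

end RAM

/-! ### Computing a perfect elimination order -/

namespace RAM

open SimpleGraph

/-- The adjacency of `G`, as a relation on natural numbers. -/
def NatAdj {n : ℕ} (G : SimpleGraph (Fin n)) (i j : ℕ) : Prop :=
  ∃ u v : Fin n, (u : ℕ) = i ∧ (v : ℕ) = j ∧ G.Adj u v

theorem natAdj_fin {n : ℕ} {G : SimpleGraph (Fin n)} {u v : Fin n} :
    NatAdj G u v ↔ G.Adj u v := by
  constructor
  · rintro ⟨u', v', hu, hv, h⟩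
    rwa [Fin.ext hu, Fin.ext hv] at h
  · exact fun h => ⟨u, v, rfl, rfl, h⟩

theorem NatAdj.symm {n i j : ℕ} {G : SimpleGraph (Fin n)} (h : NatAdj G i j) : NatAdj G j i := by
  obtain ⟨u, v, hu, hv, h⟩ := h
  exact ⟨v, u, hv, hu, h.symm⟩

theorem NatAdj.ne {n i j : ℕ} {G : SimpleGraph (Fin n)} (h : NatAdj G i j) : i ≠ j := by
  obtain ⟨u, v, rfl, rfl, h⟩ := h
  exact fun h' => h.ne (Fin.ext h')

theorem input_arr_zero {n : ℕ} (G : SimpleGraph (Fin n)) (v₀ : Fin n) (a b : ℕ) {i j : ℕ}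
    (hj : j < n) : (input G v₀ a b).arr 0 (i * n + j) = ind (NatAdj G i j) := by
  have key : (∃ u v : Fin n, i * n + j = u * n + v ∧ G.Adj u v) ↔ NatAdj G i j := by
    constructor
    · rintro ⟨u, v, h, hadj⟩
      have h1 : i = u := by
        have := congrArg (· / n) h
        simpa [Nat.add_div_of_dvd_right, Nat.mul_div_cancel _ (show 0 < n by omega),
          Nat.div_eq_of_lt hj, Nat.div_eq_of_lt v.2] using this
      subst h1
      exact ⟨u, v, rfl, by omega, hadj⟩
    · rintro ⟨u, v, rfl, rfl, hadj⟩
      exact ⟨u, v, rfl, hadj⟩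
  by_cases h : NatAdj G i j
  · rw [ind_true h, input]
    exact if_pos ⟨rfl, key.2 h⟩
  · rw [ind_false h, input]
    exact if_neg fun h' => h (key.1 h'.2)

/-- The states agree in the registers below `r` and in all arrays. -/
def SameBelow (r : ℕ) (s s' : State) : Prop := (∀ x < r, s'.reg x = s.reg x) ∧ s'.arr = s.arr

theorem SameBelow.refl (r : ℕ) (s : State) : SameBelow r s s := ⟨fun _ _ => rfl, rfl⟩

theorem SameBelow.setReg {r x v : ℕ} {s s' : State} (h : SameBelow r s s') (hx : r ≤ x) :
    SameBelow r s (s'.setReg x v) :=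
  ⟨fun y hy => by rw [State.setReg_reg, if_neg (by omega)]; exact h.1 y hy, h.2⟩

theorem SameBelow.trans {r r' : ℕ} {s s' s'' : State} (h : SameBelow r s s')
    (h' : SameBelow r' s' s'') (hr : r ≤ r') : SameBelow r s s'' :=
  ⟨fun y hy => (h'.1 y (by omega)).trans (h.1 y hy), h'.2.trans h.2⟩

/-- The adjacency of two vertices of the input graph. -/
def adjE (u v : Exp) : Exp := .arr 0 (u * .reg 0 + v)

theorem Evals.adjE {W n u v : ℕ} {G : SimpleGraph (Fin n)} {s : State} {e f : Exp} (hW : 1 ≤ W)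
    (hn : s.reg 0 = n) (harr : ∀ i j, j < n → s.arr 0 (i * n + j) = ind (NatAdj G i j))
    (hnW : n * n ≤ W) (he : Evals W s e u) (hf : Evals W s f v) (hu : u < n) (hv : v < n) :
    Evals W s (adjE e f) (ind (NatAdj G u v)) := by
  have h1 : u * n + v ≤ n * n := by nlinarith
  exact .arr (.add (.mul he (.reg hn (by nlinarith)) (by omega)) hf (by omega)) (harr _ _ hv)
    ((ind_le _).trans hW)

/-- The vertices in the registers 7, 8 are two nonadjacent remaining neighbours of the vertex in
the register 6. -/
def badPairE : Exp :=
  adjE (.reg 6) (.reg 7) * (adjE (.reg 6) (.reg 8) * ((.const 1 - .arr 1 (.reg 7)) *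
    ((.const 1 - .arr 1 (.reg 8)) * ((.const 1 - (Exp.reg 7).same (.reg 8)) *
      (.const 1 - adjE (.reg 7) (.reg 8))))))

/-- Set the register 9 to zero if the vertex in the register 6 is simplicial in the remaining graph,
and to one otherwise. -/
def testSimplicial : Prog :=
  .seq (.assign 9 (.arr 1 (.reg 6)))
    (.seq (.assign 7 (.const 0)) (forLoop 7 (.reg 0) (maxLoop 8 9 (.reg 0) badPairE)))

/-- Find a simplicial vertex of the remaining graph. -/
def findSimplicial : Prog :=
  .seq (.assign 6 (.const 0))
    (forLoop 6 (.reg 0) (.seq testSimplicial (.branch (.reg 9) .nop (.assign 10 (.reg 6)))))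

/-- Compute a perfect elimination order in the array 2. -/
def orderProg : Prog :=
  .seq (.assign 5 (.const 1))
    (forLoop 5 (.reg 0 + .const 1)
      (.seq findSimplicial (.seq (.store 2 (.reg 5) (.reg 10)) (.store 1 (.reg 10) (.const 1)))))

/-- The vertices `x` and `y` refute that `v` is simplicial among the vertices not in `D`. -/
def BadPair {n : ℕ} (G : SimpleGraph (Fin n)) (D : ℕ → Prop) (v x y : ℕ) : Prop :=
  NatAdj G v x ∧ NatAdj G v y ∧ ¬ D x ∧ ¬ D y ∧ x ≠ y ∧ ¬ NatAdj G x y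

section Order

variable {W n : ℕ} {G : SimpleGraph (Fin n)} {s₀ s : State} {D : ℕ → Prop}

theorem wp_testSimplicial {v : ℕ} {Q : State → Prop} (hn1 : 1 ≤ n) (hW : 1 ≤ W)
    (hnW : n * n ≤ W) (hn : s.reg 0 = n) (hv : s.reg 6 = v) (hvn : v < n)
    (harr : ∀ i j, j < n → s.arr 0 (i * n + j) = ind (NatAdj G i j))
    (hD : ∀ x, s.arr 1 x = ind (D x))
    (hQ : ∀ s', SameBelow 7 s s' → s'.reg 9 ≤ W → s'.reg 10 = s.reg 10 →
      (s'.reg 9 = 0 ↔ ¬ D v ∧ ∀ x < n, ∀ y < n, ¬ BadPair G D v x y) → Q s') :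
    WP W testSimplicial (200 * (n * n)) Q s := by
  have hnW' : n ≤ W := by nlinarith
  have hD' : ∀ x, ind (D x) ≤ W := fun x => (ind_le _).trans hW
  have hnn : n ≤ n * n := by nlinarith
  refine .seq (t₁ := 3 * (n * n)) (t₂ := 197 * (n * n))
    (.assign (v := ind (D v)) ((Evals.reg hv (by omega)).arr (hD v) (hD' v))
      (by simp [Exp.cost]; omega) ?_) (by omega)
  refine .seq (t₁ := 2 * (n * n)) (t₂ := 195 * (n * n)) (.assign (.const (by omega))
    (by simp [Exp.cost]; omega) ?_) (by omega)
  let Inv : ℕ → State → Prop := fun m s' => SameBelow 7 s s' ∧ s'.reg 7 = m ∧ s'.reg 9 ≤ W ∧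
    s'.reg 10 = s.reg 10 ∧
    (∀ l, l < s'.reg 9 ↔ l < ind (D v) ∨ ∃ x < m, ∃ y < n, l < ind (BadPair G D v x y))
  refine WP.forLoop (m := n) (k₀ := 0) (c := 150) (X := n) (L := n) (Inv := Inv) (by omega) hW
    (fun k s' h => h.2.1) (fun k s' _ h => .reg (by rw [h.1.1 0 (by omega), hn]) hnW') ?_ ?_ hn1
    hn1 (by omega) ?_ ?_
  · rintro k s' - hk ⟨hs, h7, h9, h10, hl⟩
    have h0 : s'.reg 0 = n := by rw [hs.1 0 (by omega), hn]
    have h6 : s'.reg 6 = v := by rw [hs.1 6 (by omega), hv]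
    refine .maxLoop (m := n) (L := n) (g := fun y => ind (BadPair G D v k y)) (by omega) hW
      (fun _ _ => .reg (by simp [h0]) hnW') ?_ h9 hn1 le_rfl
      (Nat.mul_le_mul_right _ (by decide)) ?_
    · intro y z hy hz
      have e6 : Evals W ((s'.setReg 9 z).setReg 8 y) (.reg 6) v := .reg (by simp [h6]) (by omega)
      have e7 : Evals W ((s'.setReg 9 z).setReg 8 y) (.reg 7) k := .reg (by simp [h7]) (by omega)
      have e8 : Evals W ((s'.setReg 9 z).setReg 8 y) (.reg 8) y := .reg (by simp) (by omega)
      have harr' : ∀ i j, j < n →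
          ((s'.setReg 9 z).setReg 8 y).arr 0 (i * n + j) = ind (NatAdj G i j) := fun i j hj => by
        simpa [hs.2] using harr i j hj
      have hd : ∀ x, ((s'.setReg 9 z).setReg 8 y).arr 1 x = ind (D x) := fun x => by
        simpa [hs.2] using hD x
      have h0' : ((s'.setReg 9 z).setReg 8 y).reg 0 = n := by simp [h0]
      exact (Evals.adjE hW h0' harr' hnW e6 e7 hvn hk).and
        ((Evals.adjE hW h0' harr' hnW e6 e8 hvn hy).and
        (((e7.arr (hd k) (hD' k)).not hW).and (((e8.arr (hd y) (hD' y)).not hW).and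
        (((e7.same hW e8).not hW).and ((Evals.adjE hW h0' harr' hnW e7 e8 hk hy).not hW)))))
    · intro y hy
      have hyW : y ≤ W := by
        by_contra h
        rcases (hy W).1 (by omega) with h | ⟨x, -, h⟩
        · omega
        · have := ind_le (BadPair G D v k x)
          omega
      refine ⟨by simp [h7], ?_, by simp, by simp [hyW], by simp [h10], ?_⟩
      · exact ((hs.setReg (by omega)).setReg (by omega)).setReg (by omega)
      · intro l
        have e : (((s'.setReg 9 y).setReg 8 n).setReg 7 (k + 1)).reg 9 = y := by simp
        rw [e, hy l, hl l]
        constructor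
        · rintro ((h | ⟨x, hx, h⟩) | h)
          · exact .inl h
          · exact .inr ⟨x, by omega, h⟩
          · exact .inr ⟨k, by omega, h⟩
        · rintro (h | ⟨x, hx, h⟩)
          · exact .inl (.inl h)
          · by_cases hxk : x = k
            · subst hxk; exact .inr h
            · exact .inl (.inr ⟨x, by omega, h⟩)
  · exact ⟨((SameBelow.refl 7 s).setReg (by omega)).setReg (by omega), by simp,
      by simpa using hD' v, by simp, by simp⟩
  · exact Nat.mul_le_mul_right _ (by decide)
  · rintro s' ⟨hs, h7, h9, h10, hl⟩
    refine hQ s' hs h9 h10 ?_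
    constructor
    · intro h
      rw [h] at hl
      have := hl 0
      refine ⟨fun hd => ?_, fun x hx y hy hb => ?_⟩
      · rw [ind_true hd] at this
        omega
      · exact absurd (this.2 (.inr ⟨x, hx, y, hy, by rw [ind_true hb]; omega⟩)) (by omega)
    · rintro ⟨hd, hb⟩
      by_contra h
      rcases (hl 0).1 (by omega) with h | ⟨x, hx, y, hy, h⟩
      · rw [ind_false hd] at h; omega
      · rw [ind_false (hb x hx y hy)] at h; omega

theorem wp_findSimplicial {Q : State → Prop} (hn1 : 1 ≤ n) (hW : 1 ≤ W)
    (hnW : n * n ≤ W) (hn : s.reg 0 = n)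
    (harr : ∀ i j, j < n → s.arr 0 (i * n + j) = ind (NatAdj G i j))
    (hD : ∀ x, s.arr 1 x = ind (D x))
    (hex : ∃ v < n, ¬ D v ∧ ∀ x < n, ∀ y < n, ¬ BadPair G D v x y)
    (hQ : ∀ s', SameBelow 6 s s' → s'.reg 10 < n → ¬ D (s'.reg 10) →
      (∀ x < n, ∀ y < n, ¬ BadPair G D (s'.reg 10) x y) → Q s') :
    WP W findSimplicial (300 * (n * (n * n))) Q s := by
  have hnW' : n ≤ W := by nlinarith
  have hnn : 1 ≤ n * n := Nat.mul_pos hn1 hn1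
  have hnnn : 1 ≤ n * (n * n) := Nat.mul_pos hn1 hnn
  refine .seq (t₁ := 2 * (n * (n * n))) (t₂ := 298 * (n * (n * n))) (.assign (.const (by omega))
    (by simp [Exp.cost]; omega) ?_) (by omega)
  let OK : ℕ → Prop := fun v => v < n ∧ ¬ D v ∧ ∀ x < n, ∀ y < n, ¬ BadPair G D v x y
  -- The register 10 is overwritten by every suitable vertex, so its content is meaningful only once
  -- a suitable vertex has been met.
  let Inv : ℕ → State → Prop := fun m s' => SameBelow 6 s s' ∧ s'.reg 6 = m ∧
    ((∃ v < m, OK v) → OK (s'.reg 10))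
  refine WP.forLoop (m := n) (k₀ := 0) (c := 210) (X := n * n) (L := n) (Inv := Inv) (by omega) hW
    (fun k s' h => h.2.1) (fun k s' _ h => .reg (by rw [h.1.1 0 (by omega), hn]) hnW') ?_ ?_ hnn
    hn1 (by omega) (Nat.mul_le_mul_right _ (by decide)) ?_
  · rintro k s' - hk ⟨hs, h6, h10⟩
    refine .seq (t₁ := 200 * (n * n)) (t₂ := 10 * (n * n)) (wp_testSimplicial (G := G) (D := D) hn1
      hW hnW (by rw [hs.1 0 (by omega), hn]) h6 hk (by rw [hs.2]; exact harr)
      (by rw [hs.2]; exact hD) ?_) (by omega)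
    intro s'' hs'' h9W h10' h9
    have h6' : s''.reg 6 = k := by rw [hs''.1 6 (by omega), h6]
    have hsame : SameBelow 6 s s'' := hs.trans hs'' (by omega)
    by_cases h : s''.reg 9 = 0
    · have hOK : OK k := ⟨hk, h9.1 h⟩
      refine .branch (t₁ := 2) (v := 0) (.reg h (by omega)) (fun h => absurd rfl h) (fun _ => ?_)
        (by simp [Exp.cost]; omega)
      refine .assign (.reg h6' (by omega)) (by simp [Exp.cost]) ⟨by simp [h6'], ?_, by simp, ?_⟩
      · exact (hsame.setReg (by omega)).setReg (by omega)
      · intro _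
        simpa using hOK
    · have hn0 : ¬ OK k := fun hok => h (h9.2 hok.2)
      refine .branch (t₁ := 2) (.reg rfl h9W) (fun _ => ?_) (fun h' => absurd h' h)
        (by simp [Exp.cost]; omega)
      refine .nop (by omega) ⟨h6', hsame.setReg (by omega), by simp, ?_⟩
      rintro ⟨v, hv, hok⟩
      have hvk : v ≠ k := fun h' => hn0 (h' ▸ hok)
      have := h10 ⟨v, by omega, hok⟩
      simpa [h10'] using this
  · exact ⟨(SameBelow.refl 6 s).setReg (by omega), by simp, fun ⟨v, hv, _⟩ => by omega⟩
  · rintro s' ⟨hs, -, h10⟩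
    obtain ⟨v, hv, hv'⟩ := hex
    have := h10 ⟨v, hv, hv, hv'⟩
    exact hQ s' hs this.1 this.2.1 this.2.2

/-- The order `ord 1, …, ord (k - 1)` is an initial segment of a perfect elimination order. -/
structure IsOrder (G : SimpleGraph (Fin n)) (k : ℕ) (ord : ℕ → ℕ) : Prop where
  lt : ∀ x, 1 ≤ x → x < k → ord x < n
  inj : ∀ x y, 1 ≤ x → x < k → 1 ≤ y → y < k → ord x = ord y → x = y
  adj : ∀ x y z, 1 ≤ x → x < k → y < n → z < n → (∀ w, 1 ≤ w → w ≤ x → ord w ≠ y) →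
    (∀ w, 1 ≤ w → w ≤ x → ord w ≠ z) → NatAdj G (ord x) y → NatAdj G (ord x) z → y ≠ z →
    NatAdj G y z

/-- Fewer than `n` vertices have been placed, so some remain, and Dirac's theorem applies to the
subgraph that they induce. -/
theorem IsOrder.exists_next (hG : G.IsChordal) {k : ℕ} {ord : ℕ → ℕ} (hk : 1 ≤ k) (hkn : k ≤ n) :
    ∃ v < n, ¬ (∃ w, 1 ≤ w ∧ w < k ∧ ord w = v) ∧
      ∀ x < n, ∀ y < n, ¬ BadPair G (fun v => ∃ w, 1 ≤ w ∧ w < k ∧ ord w = v) v x y := by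
  classical
  set D : ℕ → Prop := fun v => ∃ w, 1 ≤ w ∧ w < k ∧ ord w = v
  let R : Finset (Fin n) := Finset.univ.filter fun v => ¬ D v
  have hR : R.Nonempty := by
    by_contra h
    rw [Finset.not_nonempty_iff_eq_empty, Finset.filter_eq_empty_iff] at h
    have hsub : Finset.range n ⊆ (Finset.Ico 1 k).image ord := by
      intro v hv
      obtain ⟨w, h1, h2, h3⟩ := not_not.1 (h (Finset.mem_univ ⟨v, Finset.mem_range.1 hv⟩))
      exact Finset.mem_image.2 ⟨w, Finset.mem_Ico.2 ⟨h1, h2⟩, h3⟩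
    have := (Finset.card_le_card hsub).trans Finset.card_image_le
    simp at this
    omega
  obtain ⟨v, hv, hs⟩ := hG.exists_isSimplicialIn hR
  refine ⟨v, v.2, (Finset.mem_filter.1 hv).2, ?_⟩
  rintro x hx y hy ⟨h1, h2, h3, h4, h5, h6⟩
  have hvx : G.Adj v ⟨x, hx⟩ := natAdj_fin.1 h1
  have hvy : G.Adj v ⟨y, hy⟩ := natAdj_fin.1 h2
  exact h6 (natAdj_fin.2 (hs ⟨x, hx⟩ (by simpa [R] using h3) ⟨y, hy⟩ (by simpa [R] using h4) hvx hvy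
    fun h => h5 (congrArg Fin.val h)))

theorem IsOrder.succ {k : ℕ} {ord ord' : ℕ → ℕ} (h : IsOrder G k ord)
    (ho : ∀ x, x ≠ k → ord' x = ord x) (hv : ord' k < n)
    (hD : ¬ ∃ w, 1 ≤ w ∧ w < k ∧ ord w = ord' k)
    (hb : ∀ x < n, ∀ y < n,
      ¬ BadPair G (fun v => ∃ w, 1 ≤ w ∧ w < k ∧ ord w = v) (ord' k) x y) :
    IsOrder G (k + 1) ord' := by
  have hne : ∀ x, 1 ≤ x → x < k → ord' x ≠ ord' k := fun x h1 h2 h3 =>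
    hD ⟨x, h1, h2, by rw [← ho x (by omega), h3]⟩
  refine ⟨fun x h1 h2 => ?_, fun x y h1 h2 h3 h4 h5 => ?_, ?_⟩
  · by_cases hx : x = k
    · rwa [hx]
    · rw [ho x hx]
      exact h.lt x h1 (by omega)
  · by_cases hx : x = k <;> by_cases hy : y = k
    · omega
    · subst hx
      exact absurd h5.symm (hne y h3 (by omega))
    · subst hy
      exact absurd h5 (hne x h1 (by omega))
    · rw [ho x hx, ho y hy] at h5
      exact h.inj x y h1 (by omega) h3 (by omega) h5
  · intro x y z h1 h2 hy hz hwy hwz hxy hxz hyz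
    by_cases hx : x = k
    · subst hx
      by_contra hna
      refine hb y hy z hz ⟨hxy, hxz, ?_, ?_, hyz, hna⟩
      · rintro ⟨w, h3, h4, h5⟩
        exact hwy w h3 (by omega) (by rw [ho w (by omega), h5])
      · rintro ⟨w, h3, h4, h5⟩
        exact hwz w h3 (by omega) (by rw [ho w (by omega), h5])
    · rw [ho x hx] at hxy hxz
      refine h.adj x y z h1 (by omega) hy hz (fun w h3 h4 => ?_) (fun w h3 h4 => ?_) hxy hxz hyz
      · rw [← ho w (by omega)]; exact hwy w h3 h4
      · rw [← ho w (by omega)]; exact hwz w h3 h4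

/-- Exhaustive search takes `O(n³)` steps per position and `O(n⁴)` in total, which is within the
target as soon as `1 ≤ a`. The array 1 marks the vertices that have already been placed. -/
theorem wp_orderProg {Q : State → Prop} (hG : G.IsChordal) (hn1 : 1 ≤ n)
    (hnW : n * n + 1 ≤ W) (hn : s.reg 0 = n)
    (harr : ∀ i j, j < n → s.arr 0 (i * n + j) = ind (NatAdj G i j)) (hD : ∀ x, s.arr 1 x = 0)
    (hQ : ∀ s', (∀ r < 5, s'.reg r = s.reg r) → (∀ A, A ≠ 1 → A ≠ 2 → s'.arr A = s.arr A) →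
      IsOrder G (n + 1) (s'.arr 2) → Q s') :
    WP W orderProg (400 * (n * (n * (n * n)))) Q s := by
  have hnW' : n + 1 ≤ W := by nlinarith
  have hX : 1 ≤ n * (n * n) := Nat.mul_pos hn1 (Nat.mul_pos hn1 hn1)
  have hX' : 1 ≤ n * (n * (n * n)) := Nat.mul_pos hn1 hX
  refine .seq (t₁ := 2 * (n * (n * (n * n)))) (t₂ := 398 * (n * (n * (n * n))))
    (.assign (.const (by omega)) (by simp [Exp.cost]; omega) ?_) (by omega)
  let Inv : ℕ → State → Prop := fun k s' => (∀ r < 5, s'.reg r = s.reg r) ∧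
    (∀ A, A ≠ 1 → A ≠ 2 → s'.arr A = s.arr A) ∧ s'.reg 5 = k ∧
    (∀ v, s'.arr 1 v = ind (∃ w, 1 ≤ w ∧ w < k ∧ s'.arr 2 w = v)) ∧ IsOrder G k (s'.arr 2)
  refine WP.forLoop (m := n + 1) (k₀ := 1) (c := 310) (X := n * (n * n)) (L := n) (Inv := Inv)
    (by omega) (by omega) (fun k s' h => h.2.2.1) (fun k s' _ h => .add (.reg (by
      rw [h.1 0 (by omega), hn]) (by omega)) (.const (by omega)) hnW') ?_ ?_ hX hn1 (by omega)
    (Nat.mul_le_mul_right _ (by decide)) ?_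
  · rintro k s' hk1 hk ⟨hr, hA, h5, h1, ho⟩
    have hA0 : s'.arr 0 = s.arr 0 := hA 0 (by omega) (by omega)
    refine .seq (t₁ := 300 * (n * (n * n))) (t₂ := 10 * (n * (n * n)))
      (wp_findSimplicial (G := G) (D := fun v => ∃ w, 1 ≤ w ∧ w < k ∧ s'.arr 2 w = v) hn1
      (by omega) (by omega) (by rw [hr 0 (by omega), hn]) (by rw [hA0]; exact harr) h1
      (IsOrder.exists_next hG hk1 (by omega)) ?_) (by omega)
    intro s'' hs'' hlt hnd hnb
    have h5' : s''.reg 5 = k := by rw [hs''.1 5 (by omega), h5]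
    refine .seq (t₁ := 3) (t₂ := 3) (.store (.reg h5' (by omega)) (.reg rfl (by omega))
      (by simp [Exp.cost]) ?_) (by omega)
    set v := s''.reg 10 with hv
    refine .store (v := v) (.reg rfl (by omega)) (.const (by omega)) (by simp [Exp.cost]) ?_
    have h2 : ∀ x, x ≠ k → (s''.setArr 2 k v).arr 2 x = s'.arr 2 x := fun x hx => by
      rw [State.setArr_arr_self, if_neg hx, hs''.2]
    have h2k : (s''.setArr 2 k v).arr 2 k = v := by
      rw [State.setArr_arr_self, if_pos rfl]
    have h2' : ((s''.setArr 2 k v).setArr 1 v 1).arr 2 = (s''.setArr 2 k v).arr 2 :=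
      State.setArr_arr_of_ne _ _ _ (by omega)
    refine ⟨h5', fun r hr' => ?_, fun A h1A h2A => ?_, by simp, fun x => ?_, ?_⟩
    · rw [State.setReg_reg, if_neg (by omega)]
      exact (hs''.1 r (by omega)).trans (hr r hr')
    · show ((s''.setArr 2 k v).setArr 1 v 1).arr A = _
      rw [State.setArr_arr_of_ne _ _ _ h1A, State.setArr_arr_of_ne _ _ _ h2A, hs''.2, hA A h1A h2A]
    · rw [State.setReg_arr, h2', State.setArr_arr_self]
      split_ifs with hx
      · exact (ind_true ⟨k, hk1, by omega, by rw [h2k, hx]⟩).symm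
      · have e : (s''.setArr 2 k v).arr 1 x = s'.arr 1 x := by
          rw [State.setArr_arr_of_ne _ _ _ (by omega), hs''.2]
        rw [e, h1]
        congr 1
        apply propext
        constructor
        · rintro ⟨w, h3, h4, h6⟩
          exact ⟨w, h3, by omega, by rw [h2 w (by omega), h6]⟩
        · rintro ⟨w, h3, h4, h6⟩
          have hwk : w ≠ k := by
            rintro rfl
            exact hx (by rw [← h6, h2k])
          exact ⟨w, h3, by omega, by rw [← h2 w hwk, h6]⟩
    · rw [State.setReg_arr, h2']
      exact ho.succ h2 (by rw [h2k]; exact hlt) (by rw [h2k]; exact hnd) (by rw [h2k]; exact hnb)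
  · refine ⟨fun r hr => ?_, fun _ _ _ => rfl, by simp, fun v => ?_, ?_⟩
    · rw [State.setReg_reg, if_neg (by omega)]
    · rw [State.setReg_arr, hD, ind_false]
      rintro ⟨w, h1, h2, -⟩
      omega
    · exact ⟨fun x h1 h2 => by omega, fun x y h1 h2 => by omega, fun x y z h1 h2 => by omega⟩
  · rintro s' ⟨hr, hA, -, -, ho⟩
    exact hQ s' hr hA ho

end Order

end RAM

/-! ### The relabelled graph and its elimination tree -/

namespace RAM

open SimpleGraph

/-- The graph `G` with its vertices renamed to their positions in the order `ord`. -/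
def relabel {n : ℕ} (G : SimpleGraph (Fin n)) (ord : ℕ → ℕ) : SimpleGraph ℕ where
  Adj x y := (1 ≤ x ∧ x ≤ n) ∧ (1 ≤ y ∧ y ≤ n) ∧ NatAdj G (ord x) (ord y)
  symm := ⟨fun _ _ h => ⟨h.2.1, h.1, h.2.2.symm⟩⟩
  loopless := ⟨fun _ h => h.2.2.ne rfl⟩

open Classical in
/-- The first neighbour of `x` after `x`, or `n + 1` if there is none. -/
noncomputable def firstLater (H : SimpleGraph ℕ) (n x : ℕ) : ℕ :=
  sInf {z | z = n + 1 ∨ x < z ∧ H.Adj x z}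

theorem firstLater_mem (H : SimpleGraph ℕ) (n x : ℕ) :
    firstLater H n x = n + 1 ∨ x < firstLater H n x ∧ H.Adj x (firstLater H n x) :=
  Nat.sInf_mem (s := {z | z = n + 1 ∨ x < z ∧ H.Adj x z}) ⟨n + 1, .inl rfl⟩

theorem firstLater_le {H : SimpleGraph ℕ} {n x z : ℕ} (h : z = n + 1 ∨ x < z ∧ H.Adj x z) :
    firstLater H n x ≤ z :=
  Nat.sInf_le h

section

variable {W n : ℕ} {G : SimpleGraph (Fin n)} {ord : ℕ → ℕ}

theorem IsOrder.isElimination (h : IsOrder G (n + 1) ord) :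
    IsElimination (relabel G ord) n (firstLater (relabel G ord) n) where
  bounds x y h := h.1
  adj_of_lt x y z hxy hxz hlt hlt' hne := by
    refine ⟨hxy.2.1, hxz.2.1, h.adj x _ _ hxy.1.1 (by have := hxy.1.2; omega)
      (h.lt y hxy.2.1.1 (by have := hxy.2.1.2; omega))
      (h.lt z hxz.2.1.1 (by have := hxz.2.1.2; omega)) ?_ ?_ hxy.2.2 hxz.2.2 ?_⟩
    · intro w h1 h2 h3
      have := h.inj w y h1 (by have := hxy.1.2; omega) hxy.2.1.1 (by have := hxy.2.1.2; omega) h3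
      omega
    · intro w h1 h2 h3
      have := h.inj w z h1 (by have := hxy.1.2; omega) hxz.2.1.1 (by have := hxz.2.1.2; omega) h3
      omega
    · intro h3
      exact hne (h.inj y z hxy.2.1.1 (by have := hxy.2.1.2; omega) hxz.2.1.1
        (by have := hxz.2.1.2; omega) h3)
  lt_par x h1 h2 := by
    rcases firstLater_mem (relabel G ord) n x with h3 | h3
    · omega
    · exact h3.1
  par_le x _ _ := firstLater_le (.inl rfl)
  par_le_of_adj x z hxz hlt := firstLater_le (.inr ⟨hlt, hxz⟩)
  adj_par x _ _ h3 := by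
    rcases firstLater_mem (relabel G ord) n x with h4 | h4
    · omega
    · exact h4.2

theorem IsOrder.exists_eq (h : IsOrder G (n + 1) ord) {v : ℕ} (hv : v < n) :
    ∃ x, (1 ≤ x ∧ x ≤ n) ∧ ord x = v := by
  have hs : (Finset.Icc 1 n).image ord = Finset.range n := by
    refine Finset.eq_of_subset_of_card_le (fun y hy => ?_) ?_
    · obtain ⟨x, hx, rfl⟩ := Finset.mem_image.1 hy
      rw [Finset.mem_Icc] at hx
      exact Finset.mem_range.2 (h.lt x hx.1 (by omega))
    · rw [Finset.card_image_of_injOn]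
      · simp
      · intro x hx y hy hxy
        rw [Finset.mem_coe, Finset.mem_Icc] at hx hy
        exact h.inj x y hx.1 (by omega) hy.1 (by omega) hxy
  have hv' := Finset.mem_range.2 hv
  rw [← hs, Finset.mem_image] at hv'
  obtain ⟨x, hx, hxv⟩ := hv'
  exact ⟨x, Finset.mem_Icc.1 hx, hxv⟩

theorem IsOrder.hasRestrictedLeafedInducedSubtree_iff (h : IsOrder G (n + 1) ord)
    (hG : G.IsChordal) {v₀ : Fin n} {p₀ a b : ℕ} (hp : 1 ≤ p₀ ∧ p₀ ≤ n) (hv : ord p₀ = v₀) :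
    G.HasRestrictedLeafedInducedSubtree v₀ a b ↔
      ∃ w i₁ l₁ i₂ l₂, (relabel G ord).Adj p₀ w ∧ (relabel G ord).HasBranch p₀ w i₁ l₁ ∧
        (relabel G ord).HasBranch w p₀ i₂ l₂ ∧ 2 ≤ i₂ ∧ i₁ + i₂ = a ∧ b ≤ l₁ + l₂ := by
  rw [hG.hasRestrictedLeafedInducedSubtree_iff]
  choose pos hpos using fun v : Fin n => h.exists_eq v.2
  have hpo : ∀ x, 1 ≤ x → x ≤ n → ∀ v : Fin n, ord x = v → pos v = x := fun x h1 h2 v hx =>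
    h.inj _ _ (hpos v).1.1 (by have := (hpos v).1.2; omega) h1 (by omega) (by rw [(hpos v).2, hx])
  have hp₀ : pos v₀ = p₀ := hpo p₀ hp.1 hp.2 v₀ hv
  have hn : 0 < n := by omega
  -- The default vertex plays no role: branches are transported only along labels between `1` and
  -- `n`, where `lab` inverts `pos`.
  let lab : ℕ → Fin n := fun x => if hx : ord x < n then ⟨ord x, hx⟩ else ⟨0, hn⟩
  have hlab : ∀ x, 1 ≤ x ∧ x ≤ n → (lab x : ℕ) = ord x := fun x hx => by
    have := h.lt x hx.1 (by omega)
    simp [lab, this]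
  have hlp : ∀ v, lab (pos v) = v := fun v => by
    apply Fin.ext
    rw [hlab _ (hpos v).1, (hpos v).2]
  have hpl : ∀ x, 1 ≤ x ∧ x ≤ n → pos (lab x) = x := fun x hx =>
    hpo x hx.1 hx.2 _ (hlab x hx).symm
  have hadj : ∀ v w, G.Adj v w ↔ (relabel G ord).Adj (pos v) (pos w) := fun v w => by
    refine ⟨fun h => ⟨(hpos v).1, (hpos w).1, ?_⟩, fun h => ?_⟩
    · rw [(hpos v).2, (hpos w).2]
      exact natAdj_fin.2 h
    · have := h.2.2
      rw [(hpos v).2, (hpos w).2] at this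
      exact natAdj_fin.1 this
  have hto : ∀ {u v i l}, G.HasBranch u v i l → (relabel G ord).HasBranch (pos u) (pos v) i l :=
    fun h => h.map pos lab (fun _ => True) (fun v _ => hlp v) (fun _ _ _ => trivial)
      (fun v w _ _ => hadj v w) trivial trivial
  have hfrom : ∀ {u v i l}, 1 ≤ u ∧ u ≤ n → 1 ≤ v ∧ v ≤ n → (relabel G ord).HasBranch u v i l →
      G.HasBranch (lab u) (lab v) i l :=
    fun hu hv h => h.map lab pos (fun x => 1 ≤ x ∧ x ≤ n) hpl (fun v w (h : (relabel G ord).Adj v w) => h.2.1)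
      (fun v w hv hw => by rw [hadj, hpl v hv, hpl w hw]) hu hv
  constructor
  · rintro ⟨w, i₁, l₁, i₂, l₂, hw, h₁, h₂, h3⟩
    rw [hadj, hp₀] at hw
    exact ⟨pos w, i₁, l₁, i₂, l₂, hw, hp₀ ▸ hto h₁, hp₀ ▸ hto h₂, h3⟩
  · rintro ⟨w, i₁, l₁, i₂, l₂, hw, h₁, h₂, h3⟩
    have hl : lab p₀ = v₀ := by rw [← hp₀, hlp]
    refine ⟨lab w, i₁, l₁, i₂, l₂, ?_, hl ▸ hfrom hp hw.2.1 h₁, hl ▸ hfrom hw.2.1 hp h₂, h3⟩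
    rw [hadj, hp₀, hpl w hw.2.1]
    exact hw

end

/-- Store the adjacency matrix of the relabelled graph in the array 3. -/
def relabelProg : Prog :=
  .seq (.assign 4 (.reg 0 + .const 2)) (.seq (.assign 5 (.const 1))
    (forLoop 5 (.reg 0 + .const 1)
      (.seq (.branch ((Exp.arr 2 (.reg 5)).same (.reg 1)) (.assign 11 (.reg 5)) .nop)
        (.seq (.assign 6 (.const 1)) (forLoop 6 (.reg 0 + .const 1)
          (.store 3 (.reg 5 * .reg 4 + .reg 6) (adjE (.arr 2 (.reg 5)) (.arr 2 (.reg 6)))))))))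

/-- Whether the vertex in the register 6 is a later neighbour of the one in the register 5,
weighted such that early vertices are preferred. -/
def laterE : Exp :=
  (.arr 3 (.reg 5 * .reg 4 + .reg 6) * (Exp.reg 5).less (.reg 6)) *
    ((.reg 0 + .const 1) - .reg 6)

/-- Compute the last children and the previous siblings in the elimination tree. -/
def parentProg : Prog :=
  .seq (.assign 5 (.const 1)) (forLoop 5 (.reg 0 + .const 1)
    (.seq (.assign 9 (.const 0)) (.seq (maxLoop 6 9 (.reg 0 + .const 1) laterE)
      (.seq (.assign 9 ((.reg 0 + .const 1) - .reg 9))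
        (.seq (.store 5 (.reg 5) (.arr 4 (.reg 9))) (.store 4 (.reg 9) (.reg 5)))))))

theorem mul_add_inj {N x y x' y' : ℕ} (hy : y < N) (hy' : y' < N) (h : x * N + y = x' * N + y') :
    x = x' ∧ y = y' := by
  have h1 : x = x' := by
    have := congrArg (· / N) h
    simpa [Nat.mul_add_div (show 0 < N by omega), mul_comm _ N, Nat.div_eq_of_lt hy,
      Nat.div_eq_of_lt hy'] using this
  subst h1
  exact ⟨rfl, by omega⟩

section

variable {W n : ℕ} {G : SimpleGraph (Fin n)} {ord : ℕ → ℕ} {s : State}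

theorem wp_relabelProg {v₀ : ℕ} {Q : State → Prop} (hn1 : 1 ≤ n) (hv : v₀ < n)
    (hnW : (n + 2) * (n + 2) ≤ W) (hn : s.reg 0 = n) (hs1 : s.reg 1 = v₀)
    (harr : ∀ i j, j < n → s.arr 0 (i * n + j) = ind (NatAdj G i j))
    (ho : IsOrder G (n + 1) (s.arr 2)) (h3 : ∀ i, s.arr 3 i = 0)
    (hQ : ∀ s', (∀ r < 4, s'.reg r = s.reg r) → (∀ A, A ≠ 3 → s'.arr A = s.arr A) →
      s'.reg 4 = n + 2 → (1 ≤ s'.reg 11 ∧ s'.reg 11 ≤ n) → s.arr 2 (s'.reg 11) = v₀ →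
      (∀ x y, x ≤ n + 1 → y ≤ n + 1 →
        s'.arr 3 (x * (n + 2) + y) = ind ((relabel G (s.arr 2)).Adj x y)) → Q s') :
    WP W relabelProg (200 * (n * n)) Q s := by
  have hnW' : n + 2 ≤ W := by nlinarith
  have hnnW : n * n ≤ W := by nlinarith
  have hidx : ∀ x y, x ≤ n + 1 → y ≤ n + 1 → x * (n + 2) + y ≤ W := fun x y hx hy => by nlinarith
  have hnn : n ≤ n * n := by nlinarith
  set H := relabel G (s.arr 2) with hH
  refine .seq (t₁ := 5 * (n * n)) (t₂ := 195 * (n * n)) (.assign (v := n + 2)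
    (.add (.reg hn (by omega)) (.const (by omega)) (by omega)) ?_ ?_) (by omega)
  · have : (Exp.reg 0 + Exp.const 2 : Exp).cost = 3 := rfl
    omega
  refine .seq (t₁ := 2 * (n * n)) (t₂ := 193 * (n * n)) (.assign (.const (by omega))
    (by simp [Exp.cost]; omega) ?_) (by omega)
  let Pre : State → Prop := fun s' => (∀ r < 4, s'.reg r = s.reg r) ∧
    (∀ A, A ≠ 3 → s'.arr A = s.arr A) ∧ s'.reg 4 = n + 2
  -- Rows before `k` are complete and the other cells are still zero. The rows and columns `0` and
  -- `n + 1` are never written, and zero is their correct value.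
  let Inv : ℕ → State → Prop := fun k s' => Pre s' ∧ s'.reg 5 = k ∧
    (∀ x, 1 ≤ x → x < k → s.arr 2 x = v₀ → s'.reg 11 = x) ∧
    (∀ x y, x ≤ n + 1 → y ≤ n + 1 → s'.arr 3 (x * (n + 2) + y) = ind (H.Adj x y ∧ x < k))
  refine WP.forLoop (m := n + 1) (k₀ := 1) (c := 100) (X := n) (L := n) (Inv := Inv)
    (by omega) (by omega) (fun k s' h => h.2.1) (fun k s' _ h => .add (.reg (by
      rw [h.1.1 0 (by omega), hn]) (by omega)) (.const (by omega)) (by omega)) ?_ ?_ hn1 hn1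
    (by omega) (Nat.mul_le_mul_right _ (by decide)) ?_
  · rintro k s' hk1 hk ⟨⟨hr, hA, h4⟩, h5, h11, hadj⟩
    have hA2 : s'.arr 2 = s.arr 2 := hA 2 (by omega)
    have hok := ho.lt k hk1 hk
    have hbr : WP W (.branch ((Exp.arr 2 (.reg 5)).same (.reg 1)) (.assign 11 (.reg 5)) .nop) (8 * n)
        (fun s'' => Pre s'' ∧ s''.reg 5 = k ∧
          (∀ x, 1 ≤ x → x < k + 1 → s.arr 2 x = v₀ → s''.reg 11 = x) ∧ s''.arr 3 = s'.arr 3) s' := by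
      refine .branch (t₁ := 2) (.same (by omega) (.arr (.reg h5 (by omega))
        (congrFun hA2 k) (by omega)) (.reg ((hr 1 (by omega)).trans hs1) (by omega))) ?_ ?_
        (by simp [Exp.cost, Exp.same]; omega)
      · intro hne
        have heq : s.arr 2 k = v₀ := by
          by_contra h
          exact hne (ind_false h)
        refine .assign (.reg h5 (by omega)) (by simp [Exp.cost]) ⟨⟨fun r hr' => ?_, hA, ?_⟩, ?_, ?_, rfl⟩
        · rw [State.setReg_reg, if_neg (by omega), hr r hr']
        · simp [h4]
        · simp [h5]
        · intro x h1 h2 hx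
          rw [State.setReg_reg, if_pos rfl]
          exact ho.inj k x hk1 hk h1 (by omega) (heq.trans hx.symm)
      · intro hne
        have heq : s.arr 2 k ≠ v₀ := ind_eq_zero.1 hne
        refine .nop (by omega) ⟨⟨hr, hA, h4⟩, h5, fun x h1 h2 hx => ?_, rfl⟩
        have hxk : x ≠ k := by
          rintro rfl
          exact heq hx
        exact h11 x h1 (by omega) hx
    refine .seq (t₁ := 8 * n) (t₂ := 92 * n) (hbr.mono le_rfl ?_) (by omega)
    rintro s'' ⟨⟨hr, hA, h4⟩, h5, h11, h3'⟩
    refine .seq (t₁ := 2 * n) (t₂ := 90 * n) (.assign (.const (by omega))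
      (by simp [Exp.cost]; omega) ?_) (by omega)
    let Inv' : ℕ → State → Prop := fun m s' => Pre s' ∧ s'.reg 5 = k ∧
      (∀ x, 1 ≤ x → x < k + 1 → s.arr 2 x = v₀ → s'.reg 11 = x) ∧ s'.reg 6 = m ∧
      (∀ x y, x ≤ n + 1 → y ≤ n + 1 →
        s'.arr 3 (x * (n + 2) + y) = ind (H.Adj x y ∧ (x < k ∨ x = k ∧ y < m)))
    refine WP.forLoop (m := n + 1) (k₀ := 1) (c := 40) (X := 1) (L := n) (Inv := Inv')
      (by omega) (by omega) (fun k s' h => h.2.2.2.1) (fun k s' _ h => .add (.reg (by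
        rw [h.1.1 0 (by omega), hn]) (by omega)) (.const (by omega)) (by omega)) ?_ ?_ le_rfl hn1
      (by omega) (by rw [mul_one]; exact Nat.mul_le_mul_right _ (by decide)) ?_
    · rintro m s₃ hm1 hm ⟨⟨hr, hA, h4⟩, h5, h11, h6, hadj⟩
      have hA2 : s₃.arr 2 = s.arr 2 := hA 2 (by omega)
      have hom := ho.lt m hm1 hm
      have e5 : Evals W s₃ (.reg 5) k := .reg h5 (by omega)
      have e6 : Evals W s₃ (.reg 6) m := .reg h6 (by omega)
      have hi := hidx k m (by omega) (by omega)
      refine .store (((e5.mul (.reg h4 (by omega)) (by omega))).add e6 hi)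
        (Evals.adjE (G := G) (by omega) (by rw [hr 0 (by omega), hn])
          (by rw [hA 0 (by omega)]; exact harr) hnnW
          (e5.arr (congrFun hA2 k) (by omega)) (e6.arr (congrFun hA2 m) (by omega)) hok hom)
        (by decide) ?_
      refine ⟨h6, ⟨fun r hr' => ?_, fun A hA' => ?_, ?_⟩, ?_, fun x h1 h2 hx => ?_, by simp,
        fun x y hx hy => ?_⟩
      · rw [State.setReg_reg, if_neg (by omega)]
        exact hr r hr'
      · rw [State.setReg_arr, State.setArr_arr_of_ne _ _ _ hA', hA A hA']
      · simpa using h4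
      · simpa using h5
      · simpa using h11 x h1 h2 hx
      · rw [State.setReg_arr, State.setArr_arr_self]
        split_ifs with h
        · obtain ⟨rfl, rfl⟩ := mul_add_inj (by omega) (by omega) h
          congr 1
          apply propext
          constructor
          · intro h
            exact ⟨⟨⟨by omega, by omega⟩, ⟨by omega, by omega⟩, h⟩, .inr ⟨rfl, by omega⟩⟩
          · intro h
            exact h.1.2.2
        · rw [hadj x y hx hy]
          congr 1
          apply propext
          refine and_congr_right fun _ => ?_
          have : ¬ (x = k ∧ y = m) := by
            rintro ⟨rfl, rfl⟩
            exact h rfl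
          omega
    · refine ⟨⟨fun r hr' => ?_, hA, ?_⟩, ?_, fun x h1 h2 hx => ?_, by simp, fun x y hx hy => ?_⟩
      · rw [State.setReg_reg, if_neg (by omega)]
        exact hr r hr'
      · simpa using h4
      · simpa using h5
      · simpa using h11 x h1 h2 hx
      · rw [State.setReg_arr, h3', hadj x y hx hy]
        congr 1
        apply propext
        refine and_congr_right fun hxy => ?_
        have := hxy.2.1.1
        omega
    · rintro s₃ ⟨⟨hr, hA, h4⟩, h5, h11, h6, hadj⟩
      refine ⟨h5, ⟨fun r hr' => ?_, hA, ?_⟩, by simp, fun x h1 h2 hx => ?_, fun x y hx hy => ?_⟩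
      · rw [State.setReg_reg, if_neg (by omega)]
        exact hr r hr'
      · simpa using h4
      · simpa using h11 x h1 h2 hx
      · rw [State.setReg_arr, hadj x y hx hy]
        congr 1
        apply propext
        refine and_congr_right fun hxy => ?_
        have := hxy.2.1.2
        omega
  · refine ⟨⟨fun r hr' => ?_, fun A _ => rfl, by simp⟩, by simp, fun x h1 h2 => by omega,
      fun x y hx hy => ?_⟩
    · rw [State.setReg_reg, if_neg (by omega), State.setReg_reg, if_neg (by omega)]
    · rw [State.setReg_arr, State.setReg_arr, h3, ind_false]
      rintro ⟨hxy, hx⟩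
      have := hxy.1.1
      omega
  · rintro s' ⟨⟨hr, hA, h4⟩, h5, h11, hadj⟩
    obtain ⟨x, hx, hxv⟩ := ho.exists_eq hv
    have h11' := h11 x hx.1 (by omega) hxv
    refine hQ s' hr hA h4 (by rwa [h11']) (by rwa [h11']) fun x y hx hy => ?_
    rw [hadj x y hx hy]
    congr 1
    apply propext
    refine ⟨fun h => h.1, fun h => ⟨h, ?_⟩⟩
    have := h.1.2
    omega

theorem wp_parentProg {H : SimpleGraph ℕ} {par : ℕ → ℕ} {Q : State → Prop}
    (hpar : par = firstLater H n) (hb : ∀ x y, H.Adj x y → 1 ≤ x ∧ x ≤ n) (hn1 : 1 ≤ n)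
    (hnW : (n + 2) * (n + 2) ≤ W) (hn : s.reg 0 = n) (hN : s.reg 4 = n + 2)
    (harr : ∀ x y, x ≤ n + 1 → y ≤ n + 1 → s.arr 3 (x * (n + 2) + y) = ind (H.Adj x y))
    (h4 : ∀ i, s.arr 4 i = 0)
    (hQ : ∀ s', (∀ r < 5, s'.reg r = s.reg r) → s'.reg 11 = s.reg 11 →
      (∀ A, A ≠ 4 → A ≠ 5 → s'.arr A = s.arr A) →
      (∀ x, s'.arr 4 x = lastChildUpTo par n x) →
      (∀ x, 1 ≤ x → x ≤ n → s'.arr 5 x = lastChildUpTo par (x - 1) (par x)) → Q s') :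
    WP W parentProg (200 * (n * (2 * n))) Q s := by
  have hnW' : n + 2 ≤ W := by nlinarith
  have hidx : ∀ x y, x ≤ n + 1 → y ≤ n + 1 → x * (n + 2) + y ≤ W := fun x y hx hy => by nlinarith
  have hnn : n ≤ n * (2 * n) := by nlinarith
  have e0 : ∀ {s : State}, s.reg 0 = n → Evals W s (.reg 0 + .const 1) (n + 1) := fun h =>
    .add (.reg h (by omega)) (.const (by omega)) (by omega)
  refine .seq (t₁ := 2 * (n * (2 * n))) (t₂ := 198 * (n * (2 * n))) (.assign (.const (by omega))
    (by simp [Exp.cost]; omega) ?_) (by omega)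
  let Inv : ℕ → State → Prop := fun k s' => (∀ r < 5, s'.reg r = s.reg r) ∧
    s'.reg 11 = s.reg 11 ∧ (∀ A, A ≠ 4 → A ≠ 5 → s'.arr A = s.arr A) ∧ s'.reg 5 = k ∧
    (∀ x, s'.arr 4 x = lastChildUpTo par (k - 1) x) ∧
    (∀ x, 1 ≤ x → x < k → s'.arr 5 x = lastChildUpTo par (x - 1) (par x))
  refine WP.forLoop (m := n + 1) (k₀ := 1) (c := 150) (X := 2 * n) (L := n) (Inv := Inv)
    (by omega) (by omega) (fun k s' h => h.2.2.2.1) (fun k s' _ h => e0 (by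
      rw [h.1 0 (by omega), hn])) ?_ ?_ (by omega) hn1
    (by omega) (Nat.mul_le_mul_right _ (by decide)) ?_
  · rintro k s' hk1 hk ⟨hr, h11, hA, h5, h4, hprev⟩
    refine .seq (t₁ := 2) (t₂ := 150 * (2 * n) - 2) (.assign (.const (by omega))
      (by simp [Exp.cost]) ?_) (by omega)
    refine .seq (t₁ := 100 * (2 * n)) (t₂ := 20) ?_ (by omega)
    have h0 : s'.reg 0 = n := by rw [hr 0 (by omega), hn]
    have h4' : s'.reg 4 = n + 2 := by rw [hr 4 (by omega), hN]
    refine .maxLoop (m := n + 1) (L := 2 * n)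
      (g := fun z => ind (H.Adj k z ∧ k < z) * (n + 1 - z)) (by omega) (by omega)
      (fun _ _ => e0 (by simp [h0])) ?_ (by simp) (by omega) (by omega)
      (Nat.mul_le_mul_right _ (by decide)) ?_
    · intro z y hz hy
      have e5 : Evals W (((s'.setReg 9 0).setReg 9 y).setReg 6 z) (.reg 5) k :=
        .reg (by simp [h5]) (by omega)
      have e6 : Evals W (((s'.setReg 9 0).setReg 9 y).setReg 6 z) (.reg 6) z :=
        .reg (by simp) (by omega)
      have hi := hidx k z (by omega) (by omega)
      refine .ind_mul (.and (.arr (.add (.mul e5 (.reg (by simpa using h4') (by omega)) (by omega)) e6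
        hi) ?_ ?_) (e5.less (by omega) e6)) ((e0 (by simp [h0])).sub e6)
      · rw [State.setReg_arr, State.setReg_arr, State.setReg_arr, hA 3 (by omega) (by omega)]
        exact harr k z (by omega) (by omega)
      · exact (ind_le _).trans (by omega)
    · intro y hy
      have hy0 : ∀ l, l < y ↔ ∃ z < n + 1, (H.Adj k z ∧ k < z) ∧ l < n + 1 - z := fun l => by
        rw [hy l]
        simp [lt_ind_mul]
      have hyn : y ≤ n + 1 := by
        by_contra h
        obtain ⟨z, -, -, h⟩ := (hy0 (n + 1)).1 (by omega)
        omega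
      -- The largest `n + 1 - z` over later neighbours `z` belongs to the first of them. Without
      -- later neighbours the maximum is `0`, which yields the fictitious parent `n + 1`.
      have hpk : n + 1 - y = par k := by
        rw [hpar]
        apply le_antisymm
        · rcases firstLater_mem H n k with h | ⟨h1, h2⟩
          · omega
          · have h3 := hb _ _ h2.symm
            have := (hy0 (n - firstLater H n k)).2 ⟨_, by omega, ⟨h2, h1⟩, by omega⟩
            omega
        · rcases Nat.eq_zero_or_pos y with h | h
          · exact firstLater_le (.inl (by omega))
          · obtain ⟨z, hz, ⟨h1, h2⟩, h3⟩ := (hy0 (y - 1)).1 (by omega)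
            exact (firstLater_le (.inr ⟨h2, h1⟩)).trans (by omega)
      have hpn : par k ≤ n + 1 := by omega
      set s₁ := ((s'.setReg 9 0).setReg 9 y).setReg 6 (n + 1) with hs₁
      refine .seq (t₁ := 6) (t₂ := 14) (.assign (v := par k) ?_ (by decide) ?_) (by omega)
      · rw [← hpk]
        exact (e0 (by simp [hs₁, h0])).sub (.reg (by simp [hs₁]) (by omega))
      have e9 : ∀ {s : State}, s.reg 9 = par k → Evals W s (.reg 9) (par k) := fun h =>
        .reg h (by omega)
      have hlast := lastChildUpTo_le (par := par) (k - 1) (par k)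
      have h5₁ : (s₁.setReg 9 (par k)).reg 5 = k := by simp [hs₁, h5]
      -- At this moment the array 4 holds, at the parent of `k`, the last child before `k`, which is
      -- the previous sibling of `k`. It is saved before `k` overwrites it.
      refine .seq (t₁ := 4) (t₂ := 10) (.store (.reg h5₁ (by omega)) ((e9 (by simp)).arr (h4 _)
        (by omega)) (by decide) ?_) (by omega)
      refine .store (e9 (by simp)) (.reg (v := k) h5₁ (by omega)) (by decide) ?_
      set s₂ := ((s₁.setReg 9 (par k)).setArr 5 k (lastChildUpTo par (k - 1) (par k))).setArr 4
        (par k) k with hs₂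
      have hreg : s₂.reg = (s₁.setReg 9 (par k)).reg := rfl
      refine ⟨h5₁, fun r hr' => ?_, ?_, fun A hA4 hA5 => ?_, by simp, fun x => ?_,
        fun x h1 h2 => ?_⟩
      · rw [State.setReg_reg, if_neg (by omega), hreg, State.setReg_reg, if_neg (by omega), hs₁,
          State.setReg_reg, if_neg (by omega), State.setReg_reg, if_neg (by omega),
          State.setReg_reg, if_neg (by omega), hr r hr']
      · simp [hs₂, hs₁, h11]
      · rw [State.setReg_arr, hs₂, State.setArr_arr_of_ne _ _ _ hA4,
          State.setArr_arr_of_ne _ _ _ hA5]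
        exact hA A hA4 hA5
      · rw [State.setReg_arr, hs₂, State.setArr_arr_self]
        obtain ⟨k, rfl⟩ : ∃ k', k = k' + 1 := ⟨k - 1, by omega⟩
        have e : lastChildUpTo par (k + 1 + 1 - 1) x =
          if par (k + 1) = x then k + 1 else lastChildUpTo par k x := rfl
        rw [e]
        by_cases hx : x = par (k + 1)
        · rw [if_pos hx, if_pos hx.symm]
        · rw [if_neg hx, if_neg (Ne.symm hx), State.setArr_arr_of_ne _ _ _ (by omega)]
          exact h4 x
      · rw [State.setReg_arr, hs₂, State.setArr_arr_of_ne _ _ _ (by omega), State.setArr_arr_self]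
        split_ifs with hx
        · rw [hx]
        · exact hprev x h1 (by omega)
  · refine ⟨fun r hr => ?_, by simp, fun _ _ _ => rfl, by simp, fun x => ?_, fun x h1 h2 => by omega⟩
    · rw [State.setReg_reg, if_neg (by omega)]
    · rw [State.setReg_arr, h4]
      rfl
  · rintro s' ⟨hr, h11, hA, -, h4, hprev⟩
    exact hQ s' hr h11 hA h4 fun x h1 h2 => hprev x h1 (by omega)

end

end RAM

/-! ### The dynamic programming table -/

namespace RAM

open SimpleGraph

/-- Combine two optimal values, where `0` means infeasible and `l + 1` stands for the value `l`. -/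
noncomputable def comb (A B : ℕ) : ℕ := ind (0 < A) * (ind (0 < B) * (A + B - 1))

/-- With the shift by one in both arguments, the optimum `(A - 1) + (B - 1)` is stored as `A + B -
1`. The guards keep an infeasible part from being ignored. -/
theorem lt_comb {A B l : ℕ} : l < comb A B ↔ ∃ l₁ l₂, l ≤ l₁ + l₂ ∧ l₁ < A ∧ l₂ < B := by
  rw [comb, lt_ind_mul, lt_ind_mul]
  constructor
  · rintro ⟨h1, h2, h3⟩
    exact ⟨min l (A - 1), l - min l (A - 1), by omega, by omega, by omega⟩
  · rintro ⟨l₁, l₂, h1, h2, h3⟩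
    omega

/-- What the entry of the table for the size `i` and the parameters `u v x z` decides. -/
def Feasible (H : SimpleGraph ℕ) (par : ℕ → ℕ) (n i u v x z l : ℕ) : Prop :=
  if z = x ∧ 1 ≤ x then ChoiceWith H u v x (descSib par (lastChildUpTo par n x)) i l
  else Choice H u v (avoiding H z (descSib par x)) i l

theorem Feasible.leaves_le {H : SimpleGraph ℕ} {par : ℕ → ℕ} {n i u v x z l : ℕ}
    (h : Feasible H par n i u v x z l) : l ≤ i := by
  rw [Feasible] at h
  split_ifs at h
  · exact ChoiceWith.leaves_le h
  · exact Choice.leaves_le h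

section

variable {H : SimpleGraph ℕ} {par : ℕ → ℕ} {n i u v x z : ℕ}

theorem feasible_zero {l : ℕ} : Feasible H par n i u v 0 z l ↔ l < ind (i = 0) := by
  rw [Feasible, if_neg (by omega)]
  have : avoiding H z (descSib par 0) = ∅ := by
    simp [avoiding, descSib, descUpTo]
  rw [this, choice_empty]
  by_cases h : i = 0
  · rw [ind_true h]; omega
  · rw [ind_false h]; omega

/-- The number `n + 1` has no neighbours, so as the forbidden vertex it forbids nothing. -/
theorem feasible_root {l : ℕ} (hE : IsElimination H n par) (hn : 1 ≤ n) :
    Feasible H par n i u v n (n + 1) l ↔ Choice H u v (Finset.Icc 1 n) i l := by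
  rw [Feasible, if_neg (by omega), hE.descSib_self hn]
  have : avoiding H (n + 1) (Finset.Icc 1 n) = Finset.Icc 1 n := by
    ext y
    rw [mem_avoiding]
    refine and_iff_left fun h => ?_
    have := hE.bounds _ _ h
    omega
  rw [this]

/-- For `i = 0` the table counts no leaf, whereas a branch without children has its root as a leaf.
The indicator corrects this by one. -/
theorem lt_branch_value {l A : ℕ} (hE : IsElimination H n par) (hn : 1 ≤ n)
    (hA : ∀ l, l < A ↔ Feasible H par n i u v n (n + 1) l) :
    l < A + ind (i = 0) ↔ ∃ l', l ≤ l' ∧ H.HasBranch u v (i + 1) l' := by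
  by_cases h : i = 0
  · subst h
    rw [ind_true rfl, zero_add, exists_hasBranch_one]
    have h1 : A = 1 := by
      have h0 := hA 0
      have h1 := hA 1
      rw [feasible_root hE hn, choice_zero] at h0 h1
      have := h0.2 rfl
      omega
    omega
  · rw [ind_false h, add_zero, hA, feasible_root hE hn, exists_hasBranch_succ hE.bounds h]

/-- The diagonal `z = x` is not needed for a forbidden vertex, which always comes after `x`, so it
stores the value of choosing `x`. The branch at `x` takes `j + 1` vertices, which leaves `i - 1 - j`
for the descendants of `x` that avoid `x`. Only entries of smaller size are used. -/
theorem feasible_self {l : ℕ} {F B : ℕ → ℕ} (hE : IsElimination H n par) (hx : 1 ≤ x) (hxn : x ≤ n)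
    (hF : ∀ j < i, ∀ l, l < F j ↔ ∃ l', l ≤ l' ∧ H.HasBranch v x (j + 1) l')
    (hB : ∀ j < i, ∀ l, l < B j ↔ Feasible H par n j u v (lastChildUpTo par n x) x l) :
    Feasible H par n i u v x x l ↔
      ∃ j < i, l < ind (H.Adj v x ∧ ¬ x = u ∧ ¬ H.Adj u x) * comb (F j) (B (i - 1 - j)) := by
  have hlt := hE.lastChildUpTo_lt hx hxn
  rw [Feasible, if_pos ⟨rfl, hx⟩, ChoiceWith]
  simp only [lt_ind_mul, lt_comb]
  constructor
  · rintro ⟨hv, i₁, i₂, l₁, l₂, hi, hl, hb, hc⟩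
    have := hb.pos
    refine ⟨i₁ - 1, by omega, hv, l₁, l₂, hl, (hF _ (by omega) _).2 ⟨l₁, le_rfl, ?_⟩,
      (hB _ (by omega) _).2 ?_⟩
    · rwa [show i₁ - 1 + 1 = i₁ by omega]
    · rw [Feasible, if_neg (by omega)]
      rwa [show i - 1 - (i₁ - 1) = i₂ by omega]
  · rintro ⟨j, hj, hv, l₁, l₂, hl, h1, h2⟩
    obtain ⟨l', hl', hb⟩ := (hF j hj _).1 h1
    have h3 := (hB _ (by omega) _).1 h2
    rw [Feasible, if_neg (by omega)] at h3
    exact ⟨hv, j + 1, i - 1 - j, l', l₂, by omega, by omega, hb, h3⟩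

/-- Either `x` is skipped and `z` stays forbidden, or `x` is taken and the diagonal entry takes
over. The entries used may have the same size `i`, but they have a smaller `x`, or the same `x` and
the smaller last coordinate `x < z`. -/
theorem feasible_of_lt {l : ℕ} {A B F : ℕ → ℕ} (hE : IsElimination H n par) (hx : 1 ≤ x)
    (hxn : x ≤ n) (hz : x < z)
    (hA : ∀ j < i + 1, ∀ l, l < A j ↔
      Feasible H par n j u v (lastChildUpTo par (x - 1) (par x)) z l)
    (hB : ∀ j < i + 1, ∀ l, l < B j ↔ Feasible H par n j u v (lastChildUpTo par n x) z l)
    (hF : ∀ j < i + 1, ∀ l, l < F j ↔ Feasible H par n j u v x x l) :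
    Feasible H par n i u v x z l ↔ (∃ j < i + 1, l < comb (A j) (B (i - j))) ∨
      ∃ j < i + 1, l < ind (¬ H.Adj x z) * comb (A j) (F (i - j)) := by
  have hlt := hE.lastChildUpTo_lt hx hxn
  have hlt' := lastChildUpTo_le (par := par) (x - 1) (par x)
  have eA : ∀ j l, Feasible H par n j u v (lastChildUpTo par (x - 1) (par x)) z l ↔
      Choice H u v (avoiding H z (descSib par (lastChildUpTo par (x - 1) (par x)))) j l :=
    fun j l => by rw [Feasible, if_neg (by omega)]
  have eB : ∀ j l, Feasible H par n j u v (lastChildUpTo par n x) z l ↔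
      Choice H u v (avoiding H z (descSib par (lastChildUpTo par n x))) j l :=
    fun j l => by rw [Feasible, if_neg (by omega)]
  have eF : ∀ j l, Feasible H par n j u v x x l ↔
      ChoiceWith H u v x (descSib par (lastChildUpTo par n x)) j l :=
    fun j l => by rw [Feasible, if_pos ⟨rfl, hx⟩]
  rw [Feasible, if_neg (by omega), hE.choice_descSib hx hxn hz]
  simp only [lt_ind_mul, lt_comb]
  constructor
  · rintro ⟨i₁, i₂, l₁, l₂, hi, hl, h1, h2 | ⟨h2, h3⟩⟩
    · refine .inl ⟨i₁, by omega, l₁, l₂, hl, (hA _ (by omega) _).2 ((eA _ _).2 h1),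
        (hB _ (by omega) _).2 ((eB _ _).2 ?_)⟩
      rwa [show i - i₁ = i₂ by omega]
    · refine .inr ⟨i₁, by omega, h2, l₁, l₂, hl, (hA _ (by omega) _).2 ((eA _ _).2 h1),
        (hF _ (by omega) _).2 ((eF _ _).2 ?_)⟩
      rwa [show i - i₁ = i₂ by omega]
  · rintro (⟨j, hj, l₁, l₂, hl, h1, h2⟩ | ⟨j, hj, hxz, l₁, l₂, hl, h1, h2⟩)
    · exact ⟨j, i - j, l₁, l₂, by omega, hl, (eA _ _).1 ((hA _ hj _).1 h1),
        .inl ((eB _ _).1 ((hB _ (by omega) _).1 h2))⟩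
    · exact ⟨j, i - j, l₁, l₂, by omega, hl, (eA _ _).1 ((hA _ hj _).1 h1),
        .inr ⟨hxz, (eF _ _).1 ((hF _ (by omega) _).1 h2)⟩⟩

end

/-- The index of an entry of the table. -/
def cellIndex (N i u v x z : ℕ) : ℕ := (((i * N + u) * N + v) * N + x) * N + z

theorem cellIndex_inj {N i u v x z i' u' v' x' z' : ℕ} (hu : u < N) (hv : v < N) (hx : x < N)
    (hz : z < N) (hu' : u' < N) (hv' : v' < N) (hx' : x' < N) (hz' : z' < N)
    (h : cellIndex N i u v x z = cellIndex N i' u' v' x' z') :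
    i = i' ∧ u = u' ∧ v = v' ∧ x = x' ∧ z = z' := by
  obtain ⟨h₁, ez⟩ := mul_add_inj hz hz' h
  obtain ⟨h₂, ex⟩ := mul_add_inj hx hx' h₁
  obtain ⟨h₃, ev⟩ := mul_add_inj hv hv' h₂
  obtain ⟨ei, eu⟩ := mul_add_inj hu hu' h₃
  exact ⟨ei, eu, ev, ex, ez⟩

/-- The lexicographic order in which the table is filled. -/
def Before (i u v x z i' u' v' x' z' : ℕ) : Prop :=
  i < i' ∨ i = i' ∧ (u < u' ∨ u = u' ∧ (v < v' ∨ v = v' ∧ (x < x' ∨ x = x' ∧ z < z')))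

/-- The entries of the table `T` before the given one are correct. -/
def TableUpTo (H : SimpleGraph ℕ) (par : ℕ → ℕ) (n : ℕ) (T : ℕ → ℕ) (i u v x z : ℕ) : Prop :=
  ∀ i' u' v' x' z', 1 ≤ u' → u' ≤ n → 1 ≤ v' → v' ≤ n → x' ≤ n → x' ≤ z' → z' ≤ n + 1 →
    Before i' u' v' x' z' i u v x z →
    ∀ l, l < T (cellIndex (n + 2) i' u' v' x' z') ↔ Feasible H par n i' u' v' x' z' l

/-- The state holds the relabelled graph and its elimination tree. -/
structure Setup (H : SimpleGraph ℕ) (par : ℕ → ℕ) (n a b p₀ : ℕ) (s : State) : Prop where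
  reg0 : s.reg 0 = n
  reg2 : s.reg 2 = a
  reg3 : s.reg 3 = b
  reg4 : s.reg 4 = n + 2
  reg11 : s.reg 11 = p₀
  adj : ∀ x y, x ≤ n + 1 → y ≤ n + 1 → s.arr 3 (x * (n + 2) + y) = ind (H.Adj x y)
  last : ∀ x, s.arr 4 x = lastChildUpTo par n x
  prev : ∀ x, 1 ≤ x → x ≤ n → s.arr 5 x = lastChildUpTo par (x - 1) (par x)

/-- The adjacency of two vertices of the relabelled graph. -/
def relAdjE (x y : Exp) : Exp := .arr 3 (x * .reg 4 + y)

/-- An entry of the table. -/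
def cellE (i u v x z : Exp) : Exp :=
  (((i * .reg 4 + u) * .reg 4 + v) * .reg 4 + x) * .reg 4 + z

/-- The expression that computes `comb`. -/
def combE (A B : Exp) : Exp :=
  (Exp.const 0).less A * ((Exp.const 0).less B * ((A + B) - .const 1))

theorem Evals.combE {W A B : ℕ} {s : State} {e f : Exp} (hW : 1 ≤ W) (he : Evals W s e A)
    (hf : Evals W s f B) (h : A + B ≤ W) : Evals W s (combE e f) (comb A B) :=
  (Evals.less hW (.const (by omega)) he).ind_mul
    ((Evals.less hW (.const (by omega)) hf).ind_mul ((he.add hf h).sub (.const hW)))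

section

variable {H : SimpleGraph ℕ} {par : ℕ → ℕ} {n a b p₀ W : ℕ} {s : State}

theorem Setup.setReg (h : Setup H par n a b p₀ s) {x v : ℕ} (hx : 5 ≤ x) (hx' : x ≠ 11) :
    Setup H par n a b p₀ (s.setReg x v) where
  reg0 := by rw [State.setReg_reg, if_neg (by omega), h.reg0]
  reg2 := by rw [State.setReg_reg, if_neg (by omega), h.reg2]
  reg3 := by rw [State.setReg_reg, if_neg (by omega), h.reg3]
  reg4 := by rw [State.setReg_reg, if_neg (by omega), h.reg4]
  reg11 := by rw [State.setReg_reg, if_neg (by omega), h.reg11]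
  adj := h.adj
  last := h.last
  prev := h.prev

theorem Setup.setArr (h : Setup H par n a b p₀ s) {i v : ℕ} :
    Setup H par n a b p₀ (s.setArr 6 i v) where
  reg0 := h.reg0
  reg2 := h.reg2
  reg3 := h.reg3
  reg4 := h.reg4
  reg11 := h.reg11
  adj := by rw [State.setArr_arr_of_ne _ _ _ (by omega)]; exact h.adj
  last := by rw [State.setArr_arr_of_ne _ _ _ (by omega)]; exact h.last
  prev := by rw [State.setArr_arr_of_ne _ _ _ (by omega)]; exact h.prev

theorem Setup.evals_relAdjE (h : Setup H par n a b p₀ s) (hW : (n + 2) * (n + 2) ≤ W)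
    {e f : Exp} {x y : ℕ} (he : Evals W s e x) (hf : Evals W s f y) (hx : x ≤ n + 1)
    (hy : y ≤ n + 1) : Evals W s (relAdjE e f) (ind (H.Adj x y)) := by
  have h1 : x * (n + 2) + y ≤ W := by nlinarith
  exact .arr (.add (.mul he (.reg h.reg4 (by nlinarith)) (by omega)) hf h1) (h.adj x y hx hy)
    ((ind_le _).trans (by nlinarith))

theorem Evals.radix {N A p u : ℕ} {e f : Exp} (h4 : s.reg 4 = N) (he : Evals W s e p)
    (hf : Evals W s f u) (hp : p < A) (hu : u < N) (hW : A * N ≤ W) :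
    Evals W s (e * .reg 4 + f) (p * N + u) ∧ p * N + u < A * N := by
  have h1 : p * N + u < A * N := by nlinarith
  have h2 : N ≤ W := by nlinarith
  exact ⟨.add (.mul he (.reg h4 h2) (by omega)) hf (by omega), h1⟩

theorem Setup.evals_cellE (h : Setup H par n a b p₀ s)
    (hW : a * (n + 2) * (n + 2) * (n + 2) * (n + 2) ≤ W)
    {ei eu ev ex ez : Exp} {i u v x z : ℕ} (hi : Evals W s ei i) (hu : Evals W s eu u)
    (hv : Evals W s ev v) (hx : Evals W s ex x) (hz : Evals W s ez z) (hia : i < a)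
    (hun : u ≤ n) (hvn : v ≤ n) (hxn : x ≤ n) (hzn : z ≤ n + 1) :
    Evals W s (cellE ei eu ev ex ez) (cellIndex (n + 2) i u v x z) := by
  have hN : ∀ y, y ≤ y * (n + 2) := fun y => Nat.le_mul_of_pos_right _ (by omega)
  have h3 := (hN _).trans hW
  have h2 := (hN _).trans h3
  have h1 := (hN _).trans h2
  have r1 := Evals.radix h.reg4 hi hu hia (by omega) h1
  have r2 := Evals.radix h.reg4 r1.1 hv r1.2 (by omega) h2
  have r3 := Evals.radix h.reg4 r2.1 hx r2.2 (by omega) h3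
  exact (Evals.radix h.reg4 r3.1 hz r3.2 (by omega) hW).1

/-- There are never more leaves than vertices. This is why table entries fit in a word. -/
theorem TableUpTo.le {T : ℕ → ℕ} {i u v x z : ℕ}
    (h : ∀ l, l < T (cellIndex (n + 2) i u v x z) ↔ Feasible H par n i u v x z l) :
    T (cellIndex (n + 2) i u v x z) ≤ i + 1 := by
  by_contra h'
  have := ((h (i + 1)).1 (by omega)).leaves_le
  omega

theorem Setup.evals_cell (h : Setup H par n a b p₀ s)
    (hW : a * (n + 2) * (n + 2) * (n + 2) * (n + 2) ≤ W) (haW : a ≤ W)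
    {ei eu ev ex ez : Exp} {i u v x z : ℕ}
    (hT : ∀ l, l < s.arr 6 (cellIndex (n + 2) i u v x z) ↔ Feasible H par n i u v x z l)
    (hi : Evals W s ei i) (hu : Evals W s eu u)
    (hv : Evals W s ev v) (hx : Evals W s ex x) (hz : Evals W s ez z) (hia : i < a)
    (hun : u ≤ n) (hvn : v ≤ n) (hxn : x ≤ n) (hzn : z ≤ n + 1) :
    Evals W s (.arr 6 (cellE ei eu ev ex ez)) (s.arr 6 (cellIndex (n + 2) i u v x z)) :=
  (h.evals_cellE hW hi hu hv hx hz hia hun hvn hxn hzn).arr rfl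
    ((TableUpTo.le hT).trans (by omega))

end

/-- The optimal branch with the root in `x` below `v` and one more vertex than `j`. -/
def branchE (j v x : Exp) : Exp :=
  .arr 6 (cellE j v x (.reg 0) (.reg 0 + .const 1)) + j.same (.const 0)

/-- The value of choosing `x`, with a branch with `j + 1` vertices. -/
def selfE : Exp :=
  (relAdjE (.reg 7) (.reg 8) * ((.const 1 - (Exp.reg 8).same (.reg 6)) *
    (.const 1 - relAdjE (.reg 6) (.reg 8)))) *
    combE (branchE (.reg 10) (.reg 7) (.reg 8))
      (.arr 6 (cellE ((.reg 5 - .const 1) - .reg 10) (.reg 6) (.reg 7) (.arr 4 (.reg 8)) (.reg 8)))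

/-- The value of not choosing `x`, with `j` vertices below the earlier siblings. -/
def skipE : Exp :=
  combE (.arr 6 (cellE (.reg 10) (.reg 6) (.reg 7) (.arr 5 (.reg 8)) (.reg 9)))
    (.arr 6 (cellE (.reg 5 - .reg 10) (.reg 6) (.reg 7) (.arr 4 (.reg 8)) (.reg 9)))

/-- The value of choosing `x`, with `j` vertices below the earlier siblings. -/
def takeE : Exp :=
  (.const 1 - relAdjE (.reg 8) (.reg 9)) *
    combE (.arr 6 (cellE (.reg 10) (.reg 6) (.reg 7) (.arr 5 (.reg 8)) (.reg 9)))
      (.arr 6 (cellE (.reg 5 - .reg 10) (.reg 6) (.reg 7) (.reg 8) (.reg 8)))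

/-- Compute an entry of the table in the register 12. -/
def entryProg : Prog :=
  .branch ((Exp.reg 8).same (.const 0)) (.assign 12 ((Exp.reg 5).same (.const 0)))
    (.seq (.assign 12 (.const 0))
      (.branch ((Exp.reg 9).same (.reg 8)) (maxLoop 10 12 (.reg 5) selfE)
        (.seq (maxLoop 10 12 (.reg 5 + .const 1) skipE)
          (maxLoop 10 12 (.reg 5 + .const 1) takeE))))

section

variable {H : SimpleGraph ℕ} {par : ℕ → ℕ} {n a b p₀ W : ℕ} {s : State}

/-- An entry needs at most two maxima, each over at most `i + 1 ≤ a` ways to split the size, which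
explains the linear time in `a`. Every cell that is read precedes the current one lexicographically,
so `TableUpTo` guarantees its content. -/
theorem wp_entryProg (hE : IsElimination H n par) (hS : Setup H par n a b p₀ s)
    (hW : (a + 2) * (n + 2) * (n + 2) * (n + 2) * (n + 2) ≤ W) {i u v x z : ℕ}
    (h5 : s.reg 5 = i) (h6 : s.reg 6 = u) (h7 : s.reg 7 = v) (h8 : s.reg 8 = x) (h9 : s.reg 9 = z)
    (hi : i < a) (hu1 : 1 ≤ u) (hu : u ≤ n) (hv1 : 1 ≤ v) (hv : v ≤ n) (hx : x ≤ n) (hxz : x ≤ z)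
    (hz : z ≤ n + 1) (hT : TableUpTo H par n (s.arr 6) i u v x z) :
    WP W entryProg (1000 * a) (fun s' => SameBelow 10 s s' ∧ s'.reg 11 = s.reg 11 ∧
      ∀ l, l < s'.reg 12 ↔ Feasible H par n i u v x z l) s := by
  have hN : ∀ y, y ≤ y * (n + 2) := fun y => Nat.le_mul_of_pos_right _ (by omega)
  have hW3 := (hN _).trans hW
  have hW2 := (hN _).trans hW3
  have hW1 : (a + 2) * (n + 2) ≤ W := (hN _).trans hW2
  have hW0 : 2 * (a + 2) ≤ W := by nlinarith
  have hnW : n + 2 ≤ W := by nlinarith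
  have hnn : (n + 2) * (n + 2) ≤ W := by nlinarith
  have hWa : a * (n + 2) * (n + 2) * (n + 2) * (n + 2) ≤ W := le_trans (by gcongr; omega) hW
  have h1W : 1 ≤ W := by omega
  refine .branch (t₁ := 990 * a) (.same h1W (.reg h8 (by omega)) (.const (by omega))) ?_ ?_
    (by simp [Exp.cost, Exp.same]; omega)
  · intro h
    have hx0 : x = 0 := by
      by_contra h'
      exact h (ind_false h')
    refine .assign (.same h1W (.reg h5 (by omega)) (.const (by omega)))
      (by simp [Exp.cost, Exp.same]; omega) ⟨(SameBelow.refl _ _).setReg (by omega), by simp, ?_⟩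
    intro l
    rw [State.setReg_reg, if_pos rfl, hx0, feasible_zero]
  intro h
  have hx1 : 1 ≤ x := by
    have := ind_eq_zero.1 h
    omega
  refine .seq (t₁ := 2) (t₂ := 988 * a) (.assign (.const (by omega)) (by simp [Exp.cost]) ?_)
    (by omega)
  have hlc := hE.lastChildUpTo_lt hx1 hx
  have hpc := lastChildUpTo_le (par := par) (x - 1) (par x)
  set s₁ := s.setReg 12 0 with hs₁
  have ctx : ∀ {s'}, SameBelow 10 s s' → s'.reg 11 = s.reg 11 → ∀ y j,
      Setup H par n a b p₀ ((s'.setReg 12 y).setReg 10 j) ∧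
      ((s'.setReg 12 y).setReg 10 j).reg 5 = i ∧ ((s'.setReg 12 y).setReg 10 j).reg 6 = u ∧
      ((s'.setReg 12 y).setReg 10 j).reg 7 = v ∧ ((s'.setReg 12 y).setReg 10 j).reg 8 = x ∧
      ((s'.setReg 12 y).setReg 10 j).reg 9 = z ∧ ((s'.setReg 12 y).setReg 10 j).reg 10 = j ∧
      ((s'.setReg 12 y).setReg 10 j).arr = s.arr := by
    intro s' hs' h11 y j
    refine ⟨Setup.setReg (Setup.setReg ⟨?_, ?_, ?_, ?_, ?_, ?_, ?_, ?_⟩ (by omega) (by omega))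
      (by omega) (by omega), ?_, ?_, ?_, ?_, ?_, ?_, ?_⟩
    · rw [hs'.1 0 (by omega), hS.reg0]
    · rw [hs'.1 2 (by omega), hS.reg2]
    · rw [hs'.1 3 (by omega), hS.reg3]
    · rw [hs'.1 4 (by omega), hS.reg4]
    · rw [h11, hS.reg11]
    · rw [hs'.2]; exact hS.adj
    · rw [hs'.2]; exact hS.last
    · rw [hs'.2]; exact hS.prev
    · simp [hs'.1 5, h5]
    · simp [hs'.1 6, h6]
    · simp [hs'.1 7, h7]
    · simp [hs'.1 8, h8]
    · simp [hs'.1 9, h9]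
    · simp
    · simp [hs'.2]
  have hsame₁ : SameBelow 10 s s₁ := (SameBelow.refl _ _).setReg (by omega)
  have h11₁ : s₁.reg 11 = s.reg 11 := by simp [hs₁]
  have h9₁ : s₁.reg 9 = z := by simp [hs₁, h9]
  have h8₁ : s₁.reg 8 = x := by simp [hs₁, h8]
  set T := s.arr 6 with hTdef
  refine .branch (t₁ := 900 * a) (.same h1W (.reg h9₁ (by omega)) (.reg h8₁ (by omega))) ?_ ?_
    (by simp [Exp.cost, Exp.same]; omega)
  · intro h
    have hzx : z = x := by
      by_contra h'
      exact h (ind_false h')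
    subst hzx
    have hF : ∀ j < i, ∀ l, l < T (cellIndex (n + 2) j v z n (n + 1)) ↔
        Feasible H par n j v z n (n + 1) l := fun j hj => hT j v z n (n + 1) hv1 hv hx1 hx le_rfl
      (by omega) le_rfl (.inl hj)
    have hB : ∀ j < i, ∀ l, l < T (cellIndex (n + 2) j u v (lastChildUpTo par n z) z) ↔
        Feasible H par n j u v (lastChildUpTo par n z) z l := fun j hj =>
      hT j u v _ z hu1 hu hv1 hv (by omega) (by omega) hz (.inl hj)
    refine .maxLoop (m := i) (L := a) (g := fun j => ind (H.Adj v z ∧ ¬ z = u ∧ ¬ H.Adj u z) *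
      comb (T (cellIndex (n + 2) j v z n (n + 1)) + ind (j = 0))
        (T (cellIndex (n + 2) (i - 1 - j) u v (lastChildUpTo par n z) z))) (by omega) h1W
      (fun k y => .reg (ctx hsame₁ h11₁ y k).2.1 (by omega)) ?_ (by simp [hs₁]) (by omega)
      (by omega) (Nat.mul_le_mul_right _ (by decide)) ?_
    · intro j y hj hy
      obtain ⟨hS', h5', h6', h7', h8', -, h10', harr⟩ := ctx hsame₁ h11₁ y j
      set s' := (s₁.setReg 12 y).setReg 10 j
      have e5 : Evals W s' (.reg 5) i := .reg h5' (by omega)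
      have e6 : Evals W s' (.reg 6) u := .reg h6' (by omega)
      have e7 : Evals W s' (.reg 7) v := .reg h7' (by omega)
      have e8 : Evals W s' (.reg 8) z := .reg h8' (by omega)
      have e10 : Evals W s' (.reg 10) j := .reg h10' (by omega)
      have e0 : Evals W s' (.reg 0) n := .reg hS'.reg0 (by omega)
      have hT' : s'.arr 6 = T := by rw [harr]
      have hFj := hF j hj
      have hBj := hB (i - 1 - j) (by omega)
      have l1 := TableUpTo.le hFj
      have l2 := TableUpTo.le hBj
      have l3 := ind_le (j = 0)
      rw [← hT'] at hFj hBj ⊢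
      rw [← hT'] at l1 l2
      refine .ind_mul (.and (hS'.evals_relAdjE hnn e7 e8 (by omega) (by omega))
        (.and ((e8.same h1W e6).not h1W)
          ((hS'.evals_relAdjE hnn e6 e8 (by omega) (by omega)).not h1W))) ?_
      refine .combE h1W (.add (hS'.evals_cell hWa (by omega) hFj e10 e7 e8 e0
        (e0.add (.const h1W) (by omega)) (by omega) hv hx le_rfl le_rfl)
        (e10.same h1W (.const (by omega))) (by omega)) ?_ (by omega)
      exact hS'.evals_cell hWa (by omega) hBj ((e5.sub (.const h1W)).sub e10) e6 e7
        (e8.arr (hS'.last z) (by omega)) e8 (by omega) hu hv (by omega) (by omega)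
    · intro y hy
      refine ⟨(hsame₁.setReg (by omega)).setReg (by omega), by simp [hs₁], fun l => ?_⟩
      rw [State.setReg_reg, if_neg (by omega), State.setReg_reg, if_pos rfl, hy l,
        feasible_self (F := fun j => T (cellIndex (n + 2) j v z n (n + 1)) + ind (j = 0))
          (B := fun j => T (cellIndex (n + 2) j u v (lastChildUpTo par n z) z)) hE hx1 hx
          (fun j hj l => lt_branch_value hE (by omega) (hF j hj)) hB]
      simp [hs₁]
  · intro h
    have hzx : x < z := by
      have := ind_eq_zero.1 h
      omega
    have hA : ∀ j < i + 1, ∀ l,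
        l < T (cellIndex (n + 2) j u v (lastChildUpTo par (x - 1) (par x)) z) ↔
        Feasible H par n j u v (lastChildUpTo par (x - 1) (par x)) z l := fun j hj =>
      hT j u v _ z hu1 hu hv1 hv (by omega) (by omega) hz (by unfold Before; omega)
    have hB : ∀ j < i + 1, ∀ l, l < T (cellIndex (n + 2) j u v (lastChildUpTo par n x) z) ↔
        Feasible H par n j u v (lastChildUpTo par n x) z l := fun j hj =>
      hT j u v _ z hu1 hu hv1 hv (by omega) (by omega) hz (by unfold Before; omega)
    have hF : ∀ j < i + 1, ∀ l, l < T (cellIndex (n + 2) j u v x x) ↔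
        Feasible H par n j u v x x l := fun j hj =>
      hT j u v x x hu1 hu hv1 hv hx le_rfl (by omega) (by unfold Before; omega)
    refine .seq (t₁ := 450 * a) (t₂ := 450 * a) ?_ (by omega)
    refine .maxLoop (m := i + 1) (L := a) (g := fun j =>
      comb (T (cellIndex (n + 2) j u v (lastChildUpTo par (x - 1) (par x)) z))
        (T (cellIndex (n + 2) (i - j) u v (lastChildUpTo par n x) z))) (by omega) h1W
      (fun k y => .add (.reg (ctx hsame₁ h11₁ y k).2.1 (by omega)) (.const h1W) (by omega)) ?_
      (by simp [hs₁]) (by omega) (by omega) (Nat.mul_le_mul_right _ (by decide)) ?_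
    · intro j y hj hy
      obtain ⟨hS', h5', h6', h7', h8', h9', h10', harr⟩ := ctx hsame₁ h11₁ y j
      set s' := (s₁.setReg 12 y).setReg 10 j
      have e5 : Evals W s' (.reg 5) i := .reg h5' (by omega)
      have e6 : Evals W s' (.reg 6) u := .reg h6' (by omega)
      have e7 : Evals W s' (.reg 7) v := .reg h7' (by omega)
      have e8 : Evals W s' (.reg 8) x := .reg h8' (by omega)
      have e9 : Evals W s' (.reg 9) z := .reg h9' (by omega)
      have e10 : Evals W s' (.reg 10) j := .reg h10' (by omega)
      have hT' : s'.arr 6 = T := by rw [harr]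
      have hAj := hA j hj
      have hBj := hB (i - j) (by omega)
      have l1 := TableUpTo.le hAj
      have l2 := TableUpTo.le hBj
      rw [← hT'] at hAj hBj ⊢
      rw [← hT'] at l1 l2
      exact .combE h1W (hS'.evals_cell hWa (by omega) hAj e10 e6 e7
          (e8.arr (hS'.prev x hx1 hx) (by omega)) e9 (by omega) hu hv (by omega) hz)
        (hS'.evals_cell hWa (by omega) hBj (e5.sub e10) e6 e7
          (e8.arr (hS'.last x) (by omega)) e9 (by omega) hu hv (by omega) hz) (by omega)
    intro y₁ hy₁
    -- The second loop starts from the first maximum, which therefore has to fit in a word. It is a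
    -- combination of two entries, each at most one more than its size.
    have hy₁W : y₁ ≤ W := by
      by_contra h'
      rcases (hy₁ (2 * i + 2)).1 (by omega) with h | ⟨k, hk, h⟩
      · simp [hs₁] at h
      · obtain ⟨l₁, l₂, h1, h2, h3⟩ := lt_comb.1 h
        have := TableUpTo.le (hA k hk)
        have := TableUpTo.le (hB (i - k) (by omega))
        omega
    set s₂ := (s₁.setReg 12 y₁).setReg 10 (i + 1) with hs₂
    have hsame₂ : SameBelow 10 s s₂ := (hsame₁.setReg (by omega)).setReg (by omega)
    have h11₂ : s₂.reg 11 = s.reg 11 := by simp [hs₂, hs₁]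
    have h12₂ : s₂.reg 12 = y₁ := by simp [hs₂]
    refine .maxLoop (m := i + 1) (L := a) (g := fun j => ind (¬ H.Adj x z) *
      comb (T (cellIndex (n + 2) j u v (lastChildUpTo par (x - 1) (par x)) z))
        (T (cellIndex (n + 2) (i - j) u v x x))) (by omega) h1W
      (fun k y => .add (.reg (ctx hsame₂ h11₂ y k).2.1 (by omega)) (.const h1W) (by omega)) ?_
      (by omega) (by omega) (by omega) (Nat.mul_le_mul_right _ (by decide)) ?_
    · intro j y hj hy
      obtain ⟨hS', h5', h6', h7', h8', h9', h10', harr⟩ := ctx hsame₂ h11₂ y j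
      set s' := (s₂.setReg 12 y).setReg 10 j
      have e5 : Evals W s' (.reg 5) i := .reg h5' (by omega)
      have e6 : Evals W s' (.reg 6) u := .reg h6' (by omega)
      have e7 : Evals W s' (.reg 7) v := .reg h7' (by omega)
      have e8 : Evals W s' (.reg 8) x := .reg h8' (by omega)
      have e9 : Evals W s' (.reg 9) z := .reg h9' (by omega)
      have e10 : Evals W s' (.reg 10) j := .reg h10' (by omega)
      have hT' : s'.arr 6 = T := by rw [harr]
      have hAj := hA j hj
      have hFj := hF (i - j) (by omega)
      have l1 := TableUpTo.le hAj
      have l2 := TableUpTo.le hFj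
      rw [← hT'] at hAj hFj ⊢
      rw [← hT'] at l1 l2
      exact .ind_mul ((hS'.evals_relAdjE hnn e8 e9 (by omega) hz).not h1W)
        (.combE h1W (hS'.evals_cell hWa (by omega) hAj e10 e6 e7
          (e8.arr (hS'.prev x hx1 hx) (by omega)) e9 (by omega) hu hv (by omega) hz)
        (hS'.evals_cell hWa (by omega) hFj (e5.sub e10) e6 e7 e8 e8 (by omega) hu hv hx
          (by omega)) (by omega))
    · intro y hy
      refine ⟨(hsame₂.setReg (by omega)).setReg (by omega), by simp [hs₂, hs₁], fun l => ?_⟩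
      rw [State.setReg_reg, if_neg (by omega), State.setReg_reg, if_pos rfl, hy l, h12₂, hy₁ l,
        feasible_of_lt hE hx1 hx hzx hA hB hF]
      simp [hs₁]

end

end RAM

/-! ### Filling the table and reading off the answer -/

namespace RAM

open SimpleGraph

/-- Compute and store an entry of the table. -/
def cellProg : Prog :=
  .seq entryProg (.store 6 (cellE (.reg 5) (.reg 6) (.reg 7) (.reg 8) (.reg 9)) (.reg 12))

/-- Fill the entries of the table for all values of the register 9. -/
def tableProg₁ : Prog := .seq (.assign 9 (.reg 8)) (forLoop 9 (.reg 0 + .const 2) cellProg)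

/-- Fill the entries of the table for all values of the registers 8, 9. -/
def tableProg₂ : Prog := .seq (.assign 8 (.const 0)) (forLoop 8 (.reg 0 + .const 1) tableProg₁)

/-- Fill the entries of the table for all values of the registers 7, 8, 9. -/
def tableProg₃ : Prog := .seq (.assign 7 (.const 1)) (forLoop 7 (.reg 0 + .const 1) tableProg₂)

/-- Fill the entries of the table for all values of the registers 6, 7, 8, 9. -/
def tableProg₄ : Prog := .seq (.assign 6 (.const 1)) (forLoop 6 (.reg 0 + .const 1) tableProg₃)

/-- Fill the table. -/
def tableProg : Prog := .seq (.assign 5 (.const 0)) (forLoop 5 (.reg 2) tableProg₄)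

theorem TableUpTo.mono {H : SimpleGraph ℕ} {par : ℕ → ℕ} {n : ℕ} {T : ℕ → ℕ}
    {i u v x z i₁ u₁ v₁ x₁ z₁ : ℕ} (h : TableUpTo H par n T i u v x z)
    (himp : ∀ i' u' v' x' z', 1 ≤ u' → u' ≤ n → 1 ≤ v' → v' ≤ n → x' ≤ n → x' ≤ z' → z' ≤ n + 1 →
      Before i' u' v' x' z' i₁ u₁ v₁ x₁ z₁ → Before i' u' v' x' z' i u v x z) :
    TableUpTo H par n T i₁ u₁ v₁ x₁ z₁ :=
  fun i' u' v' x' z' h1 h2 h3 h4 h5 h6 h7 hb =>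
    h i' u' v' x' z' h1 h2 h3 h4 h5 h6 h7 (himp i' u' v' x' z' h1 h2 h3 h4 h5 h6 h7 hb)

section

variable {H : SimpleGraph ℕ} {par : ℕ → ℕ} {n a b p₀ W i u v x z : ℕ} {s : State}

theorem wp_cellProg (hE : IsElimination H n par) (hS : Setup H par n a b p₀ s)
    (hW : (a + 2) * (n + 2) * (n + 2) * (n + 2) * (n + 2) ≤ W)
    (h5 : s.reg 5 = i) (h6 : s.reg 6 = u) (h7 : s.reg 7 = v) (h8 : s.reg 8 = x) (h9 : s.reg 9 = z)
    (hi : i < a) (hu1 : 1 ≤ u) (hu : u ≤ n) (hv1 : 1 ≤ v) (hv : v ≤ n) (hx : x ≤ n) (hxz : x ≤ z)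
    (hz : z ≤ n + 1) (hT : TableUpTo H par n (s.arr 6) i u v x z) :
    WP W cellProg (1100 * a) (fun s' => Setup H par n a b p₀ s' ∧ s'.reg 5 = i ∧ s'.reg 6 = u ∧
      s'.reg 7 = v ∧ s'.reg 8 = x ∧ s'.reg 9 = z ∧
      TableUpTo H par n (s'.arr 6) i u v x (z + 1)) s := by
  have hN : ∀ y, y ≤ y * (n + 2) := fun y => Nat.le_mul_of_pos_right _ (by omega)
  have hW1 : (a + 2) * (n + 2) ≤ W :=
    (hN _).trans ((hN _).trans ((hN _).trans hW))
  have hW0 : 2 * (a + 2) ≤ W := by nlinarith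
  have hnW : n + 2 ≤ W := by nlinarith
  have hWa : a * (n + 2) * (n + 2) * (n + 2) * (n + 2) ≤ W := le_trans (by gcongr; omega) hW
  refine .seq (t₁ := 1000 * a) (t₂ := 100 * a) ((wp_entryProg hE hS hW h5 h6 h7 h8 h9 hi hu1 hu hv1
    hv hx hxz hz hT).mono le_rfl ?_) (by omega)
  rintro s' ⟨hs', h11, h12⟩
  have hS' : Setup H par n a b p₀ s' := ⟨by rw [hs'.1 0 (by omega), hS.reg0],
    by rw [hs'.1 2 (by omega), hS.reg2], by rw [hs'.1 3 (by omega), hS.reg3],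
    by rw [hs'.1 4 (by omega), hS.reg4], by rw [h11, hS.reg11], by rw [hs'.2]; exact hS.adj,
    by rw [hs'.2]; exact hS.last, by rw [hs'.2]; exact hS.prev⟩
  have h5' : s'.reg 5 = i := by rw [hs'.1 5 (by omega), h5]
  have h6' : s'.reg 6 = u := by rw [hs'.1 6 (by omega), h6]
  have h7' : s'.reg 7 = v := by rw [hs'.1 7 (by omega), h7]
  have h8' : s'.reg 8 = x := by rw [hs'.1 8 (by omega), h8]
  have h9' : s'.reg 9 = z := by rw [hs'.1 9 (by omega), h9]
  have h12W : s'.reg 12 ≤ i + 1 := by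
    by_contra h
    have := ((h12 (i + 1)).1 (by omega)).leaves_le
    omega
  refine .store (hS'.evals_cellE hWa (.reg h5' (by omega)) (.reg h6' (by omega))
    (.reg h7' (by omega)) (.reg h8' (by omega)) (.reg h9' (by omega)) hi hu hv hx hz)
    (.reg rfl (by omega)) (le_trans (by decide) (Nat.le_mul_of_pos_right 100 (by omega))) ?_
  refine ⟨hS'.setArr, h5', h6', h7', h8', h9', ?_⟩
  intro i' u' v' x' z' h1 h2 h3 h4 h5 h6 h7 hb l
  rw [State.setArr_arr_self]
  -- By injectivity of `cellIndex` on the admissible range, the store touches no other relevant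
  -- cell.
  split_ifs with h
  · obtain ⟨rfl, rfl, rfl, rfl, rfl⟩ := cellIndex_inj (by omega) (by omega) (by omega) (by omega)
      (by omega) (by omega) (by omega) (by omega) h
    exact h12 l
  · rw [hs'.2]
    refine hT i' u' v' x' z' h1 h2 h3 h4 h5 h6 h7 ?_ l
    have : ¬ (i' = i ∧ u' = u ∧ v' = v ∧ x' = x ∧ z' = z) := by
      rintro ⟨rfl, rfl, rfl, rfl, rfl⟩
      exact h rfl
    unfold Before at hb ⊢
    omega

theorem evals_reg_zero_add (hS : Setup H par n a b p₀ s) {c : ℕ} (hc : n + c ≤ W) :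
    Evals W s (.reg 0 + .const c) (n + c) :=
  .add (.reg hS.reg0 (by omega)) (.const (by omega)) hc

theorem wp_tableProg₁ (hE : IsElimination H n par) (hS : Setup H par n a b p₀ s)
    (hW : (a + 2) * (n + 2) * (n + 2) * (n + 2) * (n + 2) ≤ W) (hnW : n + 2 ≤ W)
    (h5 : s.reg 5 = i) (h6 : s.reg 6 = u) (h7 : s.reg 7 = v) (h8 : s.reg 8 = x)
    (hi : i < a) (hu1 : 1 ≤ u) (hu : u ≤ n) (hv1 : 1 ≤ v) (hv : v ≤ n) (hx : x ≤ n)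
    (hT : TableUpTo H par n (s.arr 6) i u v x x) :
    WP W tableProg₁ (1150 * ((n + 2) * a)) (fun s' => Setup H par n a b p₀ s' ∧ s'.reg 5 = i ∧
      s'.reg 6 = u ∧ s'.reg 7 = v ∧ s'.reg 8 = x ∧
      TableUpTo H par n (s'.arr 6) i u v (x + 1) (x + 1)) s := by
  have hX : 1 ≤ (n + 2) * a := Nat.mul_pos (by omega) (by omega)
  refine .seq (t₁ := 2) (t₂ := 1120 * ((n + 2) * a)) (.assign (.reg h8 (by omega))
    (by simp [Exp.cost]) ?_) (by omega)
  refine WP.forLoop (m := n + 2) (k₀ := x) (c := 1100) (X := a) (L := n + 2)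
    (Inv := fun k s' => Setup H par n a b p₀ s' ∧ s'.reg 5 = i ∧ s'.reg 6 = u ∧ s'.reg 7 = v ∧
      s'.reg 8 = x ∧ s'.reg 9 = k ∧ TableUpTo H par n (s'.arr 6) i u v x k)
    (by omega) (by omega) (fun k s' h => h.2.2.2.2.2.1)
    (fun k s' _ h => evals_reg_zero_add h.1 hnW) ?_ ?_ (by omega) (by omega) (by omega)
    (Nat.mul_le_mul_right _ (by decide)) ?_
  · rintro k s' hk1 hk ⟨hS, h5, h6, h7, h8, h9, hT⟩
    refine (wp_cellProg hE hS hW h5 h6 h7 h8 h9 hi hu1 hu hv1 hv hx hk1 (by omega) hT).mono le_rfl ?_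
    rintro s'' ⟨hS, h5, h6, h7, h8, h9, hT⟩
    exact ⟨h9, hS.setReg (by omega) (by omega), by simp [h5], by simp [h6], by simp [h7],
      by simp [h8], by simp, hT⟩
  · exact ⟨hS.setReg (by omega) (by omega), by simp [h5], by simp [h6], by simp [h7],
      by simp [h8], by simp, hT⟩
  · rintro s' ⟨hS, h5, h6, h7, h8, -, hT⟩
    -- Relevant entries satisfy `x' ≤ z' ≤ n + 1`. So after the last value of `z` everything before
    -- `(x + 1, x + 1)` is filled, and the next round may start on the diagonal. The outer loops
    -- carry over in the same way.
    refine ⟨hS, h5, h6, h7, h8, hT.mono ?_⟩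
    intro i' u' v' x' z' h1 h2 h3 h4 h5 h6 h7 hb
    unfold Before at hb ⊢
    omega

theorem wp_tableProg₂ (hE : IsElimination H n par) (hS : Setup H par n a b p₀ s)
    (hW : (a + 2) * (n + 2) * (n + 2) * (n + 2) * (n + 2) ≤ W) (hnW : n + 2 ≤ W)
    (h5 : s.reg 5 = i) (h6 : s.reg 6 = u) (h7 : s.reg 7 = v)
    (hi : i < a) (hu1 : 1 ≤ u) (hu : u ≤ n) (hv1 : 1 ≤ v) (hv : v ≤ n)
    (hT : TableUpTo H par n (s.arr 6) i u v 0 0) :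
    WP W tableProg₂ (1200 * ((n + 2) * ((n + 2) * a))) (fun s' => Setup H par n a b p₀ s' ∧
      s'.reg 5 = i ∧ s'.reg 6 = u ∧ s'.reg 7 = v ∧
      TableUpTo H par n (s'.arr 6) i u (v + 1) 0 0) s := by
  have hX : 1 ≤ (n + 2) * a := Nat.mul_pos (by omega) (by omega)
  have hX' : 1 ≤ (n + 2) * ((n + 2) * a) := Nat.mul_pos (by omega) hX
  refine .seq (t₁ := 2) (t₂ := 1170 * ((n + 2) * ((n + 2) * a))) (.assign (.const (by omega))
    (by simp [Exp.cost]) ?_) (by omega)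
  refine WP.forLoop (m := n + 1) (k₀ := 0) (c := 1150) (X := (n + 2) * a) (L := n + 2)
    (Inv := fun k s' => Setup H par n a b p₀ s' ∧ s'.reg 5 = i ∧ s'.reg 6 = u ∧ s'.reg 7 = v ∧
      s'.reg 8 = k ∧ TableUpTo H par n (s'.arr 6) i u v k k)
    (by omega) (by omega) (fun k s' h => h.2.2.2.2.1)
    (fun k s' _ h => evals_reg_zero_add h.1 (by omega)) ?_ ?_ (by omega) (by omega) (by omega)
    (Nat.mul_le_mul_right _ (by decide)) ?_
  · rintro k s' hk1 hk ⟨hS, h5, h6, h7, h8, hT⟩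
    refine (wp_tableProg₁ hE hS hW hnW h5 h6 h7 h8 hi hu1 hu hv1 hv (by omega) hT).mono le_rfl ?_
    rintro s'' ⟨hS, h5, h6, h7, h8, hT⟩
    exact ⟨h8, hS.setReg (by omega) (by omega), by simp [h5], by simp [h6], by simp [h7],
      by simp, hT⟩
  · exact ⟨hS.setReg (by omega) (by omega), by simp [h5], by simp [h6], by simp [h7], by simp, hT⟩
  · rintro s' ⟨hS, h5, h6, h7, -, hT⟩
    refine ⟨hS, h5, h6, h7, hT.mono ?_⟩
    intro i' u' v' x' z' h1 h2 h3 h4 h5 h6 h7 hb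
    unfold Before at hb ⊢
    omega

theorem wp_tableProg₃ (hE : IsElimination H n par) (hS : Setup H par n a b p₀ s)
    (hW : (a + 2) * (n + 2) * (n + 2) * (n + 2) * (n + 2) ≤ W) (hnW : n + 2 ≤ W)
    (h5 : s.reg 5 = i) (h6 : s.reg 6 = u) (hi : i < a) (hu1 : 1 ≤ u) (hu : u ≤ n)
    (hT : TableUpTo H par n (s.arr 6) i u 1 0 0) :
    WP W tableProg₃ (1250 * ((n + 2) * ((n + 2) * ((n + 2) * a)))) (fun s' =>
      Setup H par n a b p₀ s' ∧ s'.reg 5 = i ∧ s'.reg 6 = u ∧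
      TableUpTo H par n (s'.arr 6) i (u + 1) 1 0 0) s := by
  have hX : 1 ≤ (n + 2) * ((n + 2) * a) :=
    Nat.mul_pos (by omega) (Nat.mul_pos (by omega) (by omega))
  have hX' : 1 ≤ (n + 2) * ((n + 2) * ((n + 2) * a)) := Nat.mul_pos (by omega) hX
  refine .seq (t₁ := 2) (t₂ := 1220 * ((n + 2) * ((n + 2) * ((n + 2) * a))))
    (.assign (.const (by omega)) (by simp [Exp.cost]) ?_) (by omega)
  refine WP.forLoop (m := n + 1) (k₀ := 1) (c := 1200) (X := (n + 2) * ((n + 2) * a)) (L := n + 2)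
    (Inv := fun k s' => Setup H par n a b p₀ s' ∧ s'.reg 5 = i ∧ s'.reg 6 = u ∧ s'.reg 7 = k ∧
      TableUpTo H par n (s'.arr 6) i u k 0 0)
    (by omega) (by omega) (fun k s' h => h.2.2.2.1)
    (fun k s' _ h => evals_reg_zero_add h.1 (by omega)) ?_ ?_ (by omega) (by omega) (by omega)
    (Nat.mul_le_mul_right _ (by decide)) ?_
  · rintro k s' hk1 hk ⟨hS, h5, h6, h7, hT⟩
    refine (wp_tableProg₂ hE hS hW hnW h5 h6 h7 hi hu1 hu hk1 (by omega) hT).mono le_rfl ?_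
    rintro s'' ⟨hS, h5, h6, h7, hT⟩
    exact ⟨h7, hS.setReg (by omega) (by omega), by simp [h5], by simp [h6], by simp, hT⟩
  · exact ⟨hS.setReg (by omega) (by omega), by simp [h5], by simp [h6], by simp, hT⟩
  · rintro s' ⟨hS, h5, h6, -, hT⟩
    refine ⟨hS, h5, h6, hT.mono ?_⟩
    intro i' u' v' x' z' h1 h2 h3 h4 h5 h6 h7 hb
    unfold Before at hb ⊢
    omega

theorem wp_tableProg₄ (hE : IsElimination H n par) (hS : Setup H par n a b p₀ s) (hn : 1 ≤ n)
    (hW : (a + 2) * (n + 2) * (n + 2) * (n + 2) * (n + 2) ≤ W) (hnW : n + 2 ≤ W)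
    (h5 : s.reg 5 = i) (hi : i < a) (hT : TableUpTo H par n (s.arr 6) i 1 1 0 0) :
    WP W tableProg₄ (1300 * ((n + 2) * ((n + 2) * ((n + 2) * ((n + 2) * a))))) (fun s' =>
      Setup H par n a b p₀ s' ∧ s'.reg 5 = i ∧
      TableUpTo H par n (s'.arr 6) (i + 1) 1 1 0 0) s := by
  have hX : 1 ≤ (n + 2) * ((n + 2) * ((n + 2) * a)) :=
    Nat.mul_pos (by omega) (Nat.mul_pos (by omega) (Nat.mul_pos (by omega) (by omega)))
  have hX' : 1 ≤ (n + 2) * ((n + 2) * ((n + 2) * ((n + 2) * a))) := Nat.mul_pos (by omega) hX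
  refine .seq (t₁ := 2) (t₂ := 1270 * ((n + 2) * ((n + 2) * ((n + 2) * ((n + 2) * a)))))
    (.assign (.const (by omega)) (by simp [Exp.cost]) ?_) (by omega)
  refine WP.forLoop (m := n + 1) (k₀ := 1) (c := 1250) (X := (n + 2) * ((n + 2) * ((n + 2) * a)))
    (L := n + 2)
    (Inv := fun k s' => Setup H par n a b p₀ s' ∧ s'.reg 5 = i ∧ s'.reg 6 = k ∧
      TableUpTo H par n (s'.arr 6) i k 1 0 0)
    (by omega) (by omega) (fun k s' h => h.2.2.1)
    (fun k s' _ h => evals_reg_zero_add h.1 (by omega)) ?_ ?_ (by omega) (by omega) (by omega)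
    (Nat.mul_le_mul_right _ (by decide)) ?_
  · rintro k s' hk1 hk ⟨hS, h5, h6, hT⟩
    refine (wp_tableProg₃ hE hS hW hnW h5 h6 hi hk1 (by omega) hT).mono le_rfl ?_
    rintro s'' ⟨hS, h5, h6, hT⟩
    exact ⟨h6, hS.setReg (by omega) (by omega), by simp [h5], by simp, hT⟩
  · exact ⟨hS.setReg (by omega) (by omega), by simp [h5], by simp, hT⟩
  · rintro s' ⟨hS, h5, -, hT⟩
    refine ⟨hS, h5, hT.mono ?_⟩
    intro i' u' v' x' z' h1 h2 h3 h4 h5 h6 h7 hb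
    unfold Before at hb ⊢
    omega

theorem wp_tableProg (hE : IsElimination H n par) (hS : Setup H par n a b p₀ s) (hn : 1 ≤ n)
    (ha : 1 ≤ a) (hW : (a + 2) * (n + 2) * (n + 2) * (n + 2) * (n + 2) ≤ W) (hnW : n + 2 ≤ W)
    (haW : a ≤ W) :
    WP W tableProg (1350 * (a * ((n + 2) * ((n + 2) * ((n + 2) * ((n + 2) * a)))))) (fun s' =>
      Setup H par n a b p₀ s' ∧ TableUpTo H par n (s'.arr 6) a 1 1 0 0) s := by
  have hX : 1 ≤ (n + 2) * ((n + 2) * ((n + 2) * ((n + 2) * a))) :=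
    Nat.mul_pos (by omega) (Nat.mul_pos (by omega) (Nat.mul_pos (by omega)
      (Nat.mul_pos (by omega) (by omega))))
  have hX' : 1 ≤ a * ((n + 2) * ((n + 2) * ((n + 2) * ((n + 2) * a)))) := Nat.mul_pos ha hX
  refine .seq (t₁ := 2) (t₂ := 1320 * (a * ((n + 2) * ((n + 2) * ((n + 2) * ((n + 2) * a))))))
    (.assign (.const (by omega)) (by simp [Exp.cost]) ?_) (by omega)
  refine WP.forLoop (m := a) (k₀ := 0) (c := 1300)
    (X := (n + 2) * ((n + 2) * ((n + 2) * ((n + 2) * a)))) (L := a)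
    (Inv := fun k s' => Setup H par n a b p₀ s' ∧ s'.reg 5 = k ∧
      TableUpTo H par n (s'.arr 6) k 1 1 0 0)
    (by omega) (by omega) (fun k s' h => h.2.1)
    (fun k s' _ h => .reg h.1.reg2 haW) ?_ ?_ hX ha (by omega)
    (Nat.mul_le_mul_right _ (by decide)) ?_
  · rintro k s' hk1 hk ⟨hS, h5, hT⟩
    refine (wp_tableProg₄ hE hS hn hW hnW h5 hk hT).mono le_rfl ?_
    rintro s'' ⟨hS, h5, hT⟩
    exact ⟨h5, hS.setReg (by omega) (by omega), by simp, hT⟩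
  · refine ⟨hS.setReg (by omega) (by omega), by simp, ?_⟩
    intro i' u' v' x' z' h1 h2 h3 h4 h5 h6 h7 hb
    unfold Before at hb
    omega
  · rintro s' ⟨hS, -, hT⟩
    exact ⟨hS, hT⟩

end

/-- The value of a tree in which the branch below the neighbour in the register 6 has one more
vertex than the register 10. -/
def treeE : Exp :=
  (relAdjE (.reg 11) (.reg 6) * (Exp.const 2).less (.reg 2 - .reg 10)) *
    combE (branchE (.reg 10) (.reg 11) (.reg 6))
      (.arr 6 (cellE ((.reg 2 - .const 2) - .reg 10) (.reg 6) (.reg 11) (.reg 0)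
        (.reg 0 + .const 1)))

/-- Read the answer off the table. -/
def answerProg : Prog :=
  .seq (.assign 12 (.const 0)) (.seq (.assign 6 (.const 1))
    (.seq (forLoop 6 (.reg 0 + .const 1) (maxLoop 10 12 (.reg 2) treeE))
      (.assign 0 ((Exp.reg 3).less (.reg 12)))))

section

variable {H : SimpleGraph ℕ} {par : ℕ → ℕ} {n a b p₀ W : ℕ} {s : State}

theorem wp_answerProg (hE : IsElimination H n par) (hS : Setup H par n a b p₀ s) (hn : 1 ≤ n)
    (ha : 1 ≤ a) (hW : (a + 2) * (n + 2) * (n + 2) * (n + 2) * (n + 2) ≤ W) (hbW : b ≤ W)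
    (hp : 1 ≤ p₀ ∧ p₀ ≤ n) (hT : TableUpTo H par n (s.arr 6) a 1 1 0 0) :
    WP W answerProg (500 * (n * a)) (fun s' => s'.reg 0 = ind (∃ w i₁ l₁ i₂ l₂, H.Adj p₀ w ∧
      H.HasBranch p₀ w i₁ l₁ ∧ H.HasBranch w p₀ i₂ l₂ ∧ 2 ≤ i₂ ∧ i₁ + i₂ = a ∧ b ≤ l₁ + l₂)) s := by
  have hN : ∀ y, y ≤ y * (n + 2) := fun y => Nat.le_mul_of_pos_right _ (by omega)
  have hW2 : (a + 2) * (n + 2) * (n + 2) ≤ W := (hN _).trans ((hN _).trans hW)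
  have hW1 : (a + 2) * (n + 2) ≤ W := (hN _).trans hW2
  have hW0 : 2 * (a + 2) ≤ W := by nlinarith
  have hnW : n + 2 ≤ W := by nlinarith
  have hnn : (n + 2) * (n + 2) ≤ W := by nlinarith
  have hWa : a * (n + 2) * (n + 2) * (n + 2) * (n + 2) ≤ W := le_trans (by gcongr; omega) hW
  have h1W : 1 ≤ W := by omega
  have hX : 1 ≤ n * a := Nat.mul_pos hn ha
  set T := s.arr 6 with hTdef
  have hT' : ∀ j < a, ∀ u v, 1 ≤ u → u ≤ n → 1 ≤ v → v ≤ n → ∀ l,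
      l < T (cellIndex (n + 2) j u v n (n + 1)) ↔ Feasible H par n j u v n (n + 1) l :=
    fun j hj u v hu1 hu hv1 hv =>
      hT j u v n (n + 1) hu1 hu hv1 hv le_rfl (by omega) le_rfl (.inl hj)
  -- The branch at `w` has `j + 1` vertices, the one at `p₀` has `a - 1 - j`, and `a - 2 - j` of
  -- these lie below `p₀`. The guard `2 < a - j` says that the latter number is positive, so `p₀` is
  -- internal and the second branch needs no correction by an indicator.
  let g : ℕ → ℕ → ℕ := fun w j => ind (H.Adj p₀ w ∧ 2 < a - j) *
    comb (T (cellIndex (n + 2) j p₀ w n (n + 1)) + ind (j = 0))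
      (T (cellIndex (n + 2) (a - 2 - j) w p₀ n (n + 1)))
  have hg : ∀ w, 1 ≤ w → w ≤ n → ∀ j < a, ∀ l, l < g w j → l ≤ 2 * a := by
    intro w hw1 hw j hj l hl
    obtain ⟨-, hl⟩ := lt_ind_mul.1 hl
    obtain ⟨l₁, l₂, h1, h2, h3⟩ := lt_comb.1 hl
    have := TableUpTo.le (hT' j hj p₀ w hp.1 hp.2 hw1 hw)
    have := TableUpTo.le (hT' (a - 2 - j) (by omega) w p₀ hw1 hw hp.1 hp.2)
    have := ind_le (j = 0)
    omega
  refine .seq (t₁ := 2) (t₂ := 498 * (n * a)) (.assign (.const (by omega)) (by simp [Exp.cost]) ?_)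
    (by omega)
  refine .seq (t₁ := 2) (t₂ := 496 * (n * a)) (.assign (.const (by omega)) (by simp [Exp.cost]) ?_)
    (by omega)
  refine .seq (t₁ := 480 * (n * a)) (t₂ := 4) ?_ (by omega)
  refine WP.forLoop (m := n + 1) (k₀ := 1) (c := 450) (X := a) (L := n)
    (Inv := fun k s' => Setup H par n a b p₀ s' ∧ s'.reg 6 = k ∧ s'.arr 6 = T ∧ s'.reg 12 ≤ W ∧
      ∀ l, l < s'.reg 12 ↔ ∃ w, 1 ≤ w ∧ w < k ∧ ∃ j < a, l < g w j)
    (by omega) h1W (fun k s' h => h.2.1) (fun k s' _ h => evals_reg_zero_add h.1 (by omega)) ?_ ?_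
    ha hn (by omega) (Nat.mul_le_mul_right _ (by decide)) ?_
  · rintro k s' hk1 hk ⟨hS, h6, h6T, h12, hl⟩
    have ctx : ∀ y j, Setup H par n a b p₀ ((s'.setReg 12 y).setReg 10 j) := fun y j =>
      (hS.setReg (by omega) (by omega)).setReg (by omega) (by omega)
    refine .maxLoop (m := a) (L := a) (g := g k) (by omega) h1W
      (fun j y => .reg (ctx y j).reg2 (by omega)) ?_ h12 ha le_rfl
      (Nat.mul_le_mul_right _ (by decide)) ?_
    · intro j y hj hy
      have hS' := ctx y j
      have h6' : ((s'.setReg 12 y).setReg 10 j).reg 6 = k := by simp [h6]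
      have h10' : ((s'.setReg 12 y).setReg 10 j).reg 10 = j := by simp
      have hT'' : ((s'.setReg 12 y).setReg 10 j).arr 6 = T := h6T
      set s'' := (s'.setReg 12 y).setReg 10 j
      have e0 : Evals W s'' (.reg 0) n := .reg hS'.reg0 (by omega)
      have e01 : Evals W s'' (.reg 0 + .const 1) (n + 1) := evals_reg_zero_add hS' (by omega)
      have e2 : Evals W s'' (.reg 2) a := .reg hS'.reg2 (by omega)
      have e6 : Evals W s'' (.reg 6) k := .reg h6' (by omega)
      have e10 : Evals W s'' (.reg 10) j := .reg h10' (by omega)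
      have e11 : Evals W s'' (.reg 11) p₀ := .reg hS'.reg11 (by omega)
      have h1 := hT' j hj p₀ k hp.1 hp.2 hk1 (by omega)
      have h2 := hT' (a - 2 - j) (by omega) k p₀ hk1 (by omega) hp.1 hp.2
      have l1 := TableUpTo.le h1
      have l2 := TableUpTo.le h2
      have l3 := ind_le (j = 0)
      simp only [g]
      rw [← hT''] at h1 h2 ⊢
      rw [← hT''] at l1 l2
      refine .ind_mul (.and (hS'.evals_relAdjE hnn e11 e6 (by omega) (by omega))
        (.less h1W (.const (by omega)) (e2.sub e10))) (.combE h1W (.add (hS'.evals_cell hWa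
        (by omega) h1 e10 e11 e6 e0 e01 hj hp.2 (by omega) le_rfl le_rfl)
        (e10.same h1W (.const (by omega))) (by omega)) (hS'.evals_cell hWa (by omega) h2
        ((e2.sub (.const (by omega))).sub e10) e6 e11 e0 e01 (by omega) (by omega) hp.2 le_rfl
        le_rfl) (by omega))
    · intro y hy
      have hyW : y ≤ W := by
        by_contra h
        rcases (hy W).1 (by omega) with h | ⟨j, hj, h⟩
        · omega
        · have := hg k hk1 (by omega) j hj _ h
          omega
      have hy12 : (((s'.setReg 12 y).setReg 10 a).setReg 6 (k + 1)).reg 12 = y := by simp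
      refine ⟨by simp [h6], ((hS.setReg (by omega) (by omega)).setReg (by omega)
        (by omega)).setReg (by omega) (by omega), by simp, h6T, by rwa [hy12], fun l => ?_⟩
      rw [hy12, hy l, hl l]
      constructor
      · rintro (⟨w, h1, h2, h3⟩ | h3)
        · exact ⟨w, h1, by omega, h3⟩
        · exact ⟨k, hk1, by omega, h3⟩
      · rintro ⟨w, h1, h2, h3⟩
        by_cases hwk : w = k
        · subst hwk
          exact .inr h3
        · exact .inl ⟨w, h1, by omega, h3⟩
  · refine ⟨(hS.setReg (by omega) (by omega)).setReg (by omega) (by omega), by simp, rfl, by simp,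
      fun l => ?_⟩
    simp only [State.setReg_reg]
    constructor
    · intro h
      simp at h
    · rintro ⟨w, h1, h2, -⟩
      omega
  · rintro s' ⟨hS, -, -, h12, hl⟩
    refine .assign (.less h1W (.reg hS.reg3 hbW) (.reg rfl h12)) (by decide) ?_
    rw [State.setReg_reg, if_pos rfl]
    congr 1
    apply propext
    rw [hl b]
    simp only [g, lt_ind_mul, lt_comb]
    constructor
    · rintro ⟨w, hw1, hw, j, hj, ⟨hadj, hj2⟩, l₁, l₂, hb, h1, h2⟩
      obtain ⟨l₁', hl₁, hb₁⟩ :=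
        (lt_branch_value hE hn (hT' j hj p₀ w hp.1 hp.2 hw1 (by omega))).1 h1
      have h2' := (hT' (a - 2 - j) (by omega) w p₀ hw1 (by omega) hp.1 hp.2 l₂).1 h2
      rw [feasible_root hE hn] at h2'
      obtain ⟨l₂', hl₂, hb₂⟩ := (exists_hasBranch_succ hE.bounds (by omega)).2 h2'
      exact ⟨w, _, l₁', _, l₂', hadj, hb₁, hb₂, by omega, by omega, by omega⟩
    · rintro ⟨w, i₁, l₁, i₂, l₂, hadj, hb₁, hb₂, hi₂, hi, hb⟩
      have hpos := hb₁.pos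
      have hw := hE.bounds _ _ hadj.symm
      obtain ⟨j, rfl⟩ : ∃ j, i₁ = j + 1 := ⟨i₁ - 1, by omega⟩
      refine ⟨w, hw.1, by omega, j, by omega, ⟨hadj, by omega⟩, l₁, l₂, hb,
        (lt_branch_value hE hn (hT' j (by omega) p₀ w hp.1 hp.2 hw.1 hw.2)).2 ⟨l₁, le_rfl, hb₁⟩,
        (hT' (a - 2 - j) (by omega) w p₀ hw.1 hw.2 hp.1 hp.2 l₂).2 ?_⟩
      rw [feasible_root hE hn]
      refine (exists_hasBranch_succ hE.bounds (by omega)).1 ⟨l₂, le_rfl, ?_⟩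
      rwa [show a - 2 - j + 1 = i₂ by omega]

end

/-- The program that decides Restricted Leafed Induced Subtree on chordal graphs. -/
def subtreeProg : Prog :=
  .branch (.reg 2)
    (.seq orderProg (.seq relabelProg (.seq parentProg (.seq tableProg answerProg))))
    (.assign 0 (.const 0))

theorem not_hasRestrictedLeafedInducedSubtree_zero {V : Type*} {G : SimpleGraph V} {v₀ : V} {b : ℕ} :
    ¬ G.HasRestrictedLeafedInducedSubtree v₀ 0 b := by
  rintro ⟨S, -, hS, ⟨h, -⟩, -⟩
  rw [Finset.card_eq_zero] at hS
  subst hS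
  simp at h

theorem wp_subtreeProg {n : ℕ} {G : SimpleGraph (Fin n)} (hG : G.IsChordal) (v₀ : Fin n)
    (a b : ℕ) {W : ℕ} (hW : (a + 2) * (n + 2) * (n + 2) * (n + 2) * (n + 2) ≤ W) (hbW : b ≤ W) :
    WP W subtreeProg (200000 * (a ^ 2 * n ^ 4 + 1))
      (fun s' => s'.reg 0 = ind (G.HasRestrictedLeafedInducedSubtree v₀ a b))
      (input G v₀ a b) := by
  have hn : 1 ≤ n := by have := v₀.2; omega
  have hN : ∀ y, y ≤ y * (n + 2) := fun y => Nat.le_mul_of_pos_right _ (by omega)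
  have hW2 : (a + 2) * (n + 2) * (n + 2) ≤ W := (hN _).trans ((hN _).trans hW)
  have hW1 : (a + 2) * (n + 2) ≤ W := (hN _).trans hW2
  have hnW : n + 2 ≤ W := by nlinarith
  have haW : a ≤ W := by nlinarith
  have hnn : (n + 2) * (n + 2) ≤ W := by nlinarith
  refine .branch (t₁ := 190000 * (a ^ 2 * n ^ 4 + 1)) (v := a) (.reg rfl haW) ?_ ?_
    (by simp [Exp.cost]; omega)
  swap
  · rintro rfl
    refine .assign (.const (by omega)) (by simp [Exp.cost]) ?_
    rw [State.setReg_reg, if_pos rfl, ind_false not_hasRestrictedLeafedInducedSubtree_zero]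
  intro ha
  have ha : 1 ≤ a := by omega
  have key : 400 * (n * (n * (n * n))) + (200 * (n * n) + (200 * (n * (2 * n)) +
      (1350 * (a * ((n + 2) * ((n + 2) * ((n + 2) * ((n + 2) * a))))) + 500 * (n * a)))) ≤
      190000 * (a ^ 2 * n ^ 4 + 1) := by
    -- From `1 ≤ n` follows `n + 2 ≤ 3 * n`, which costs a factor `81`. The remaining terms are
    -- dominated because `1 ≤ a`.
    have h₁ : (n + 2) ^ 4 ≤ (3 * n) ^ 4 := Nat.pow_le_pow_left (by omega) 4
    have h₂ : a ^ 2 * (n + 2) ^ 4 ≤ 81 * (a ^ 2 * n ^ 4) :=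
      (Nat.mul_le_mul_left _ h₁).trans_eq (by ring)
    have h₃ : n ^ 4 ≤ a ^ 2 * n ^ 4 := Nat.le_mul_of_pos_left _ (by positivity)
    have h₄ : n ^ 2 ≤ a ^ 2 * n ^ 4 := (Nat.pow_le_pow_right hn (by omega)).trans h₃
    have h₅ : a * n ≤ a ^ 2 * n ^ 4 :=
      Nat.mul_le_mul (Nat.le_self_pow (by omega) a) (Nat.le_self_pow (by omega) n)
    calc _ = 400 * n ^ 4 + 600 * n ^ 2 + 1350 * (a ^ 2 * (n + 2) ^ 4) + 500 * (a * n) := by ring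
      _ ≤ _ := by omega
  have hzero : ∀ A i, A ≠ 0 → (input G v₀ a b).arr A i = 0 := fun A i hA =>
    if_neg fun h => hA h.1
  refine .seq (wp_orderProg hG hn (by nlinarith) rfl (fun i j hj => input_arr_zero G v₀ a b hj)
    (fun x => hzero 1 x (by omega)) ?_) key
  intro s₁ hr₁ hA₁ ho
  refine .seq (wp_relabelProg (G := G) hn v₀.2 hnn (hr₁ 0 (by omega)) (hr₁ 1 (by omega))
    (by rw [hA₁ 0 (by omega) (by omega)]; exact fun i j hj => input_arr_zero G v₀ a b hj) ho
    (by rw [hA₁ 3 (by omega) (by omega)]; exact fun i => hzero 3 i (by omega)) ?_) le_rfl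
  intro s₂ hr₂ hA₂ h4 hp hpv hadj
  set H := relabel G (s₁.arr 2) with hH
  have hE := ho.isElimination
  refine .seq (wp_parentProg (H := H) rfl (fun x y h => hE.bounds x y h) hn hnn
    (by rw [hr₂ 0 (by omega)]; exact hr₁ 0 (by omega)) h4 hadj
    (by rw [hA₂ 4 (by omega), hA₁ 4 (by omega) (by omega)]; exact fun i => hzero 4 i (by omega))
    ?_) le_rfl
  intro s₃ hr₃ h11 hA₃ hlast hprev
  have hS : Setup H (firstLater H n) n a b (s₂.reg 11) s₃ := by
    refine ⟨?_, ?_, ?_, ?_, h11, ?_, hlast, hprev⟩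
    · rw [hr₃ 0 (by omega), hr₂ 0 (by omega)]; exact hr₁ 0 (by omega)
    · rw [hr₃ 2 (by omega), hr₂ 2 (by omega)]; exact hr₁ 2 (by omega)
    · rw [hr₃ 3 (by omega), hr₂ 3 (by omega)]; exact hr₁ 3 (by omega)
    · rw [hr₃ 4 (by omega), h4]
    · rw [hA₃ 3 (by omega) (by omega)]; exact hadj
  refine .seq ((wp_tableProg hE hS hn ha hW hnW haW).mono le_rfl ?_) le_rfl
  rintro s₄ ⟨hS, hT⟩
  refine (wp_answerProg hE hS hn ha hW hbW hp hT).mono le_rfl ?_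
  intro s₅ h5
  rw [h5]
  congr 1
  exact propext (ho.hasRestrictedLeafedInducedSubtree_iff hG hp hpv).symm

end RAM

/-- There is one program that decides Restricted Leafed Induced Subtree on all instances
`(G, v₀, a, b)` with `G` chordal on `n` vertices in time `O(a ^ 2 * n ^ 4)`, with words of
`O(log (n + a + b))` bits. The summand 1 only matters for `a = 0`. -/
theorem mainTheorem1 :
    ∃ (P : RAM.Prog) (C k : ℕ), ∀ (n : ℕ) (G : SimpleGraph (Fin n)) (v₀ : Fin n) (a b : ℕ),
      G.IsChordal →
        P.DecidesWithin ((n + a + b + 1) ^ k) (C * (a ^ 2 * n ^ 4 + 1)) (RAM.input G v₀ a b)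
          (G.HasRestrictedLeafedInducedSubtree v₀ a b) := by
  refine ⟨RAM.subtreeProg, 200000, 10, fun n G v₀ a b hG => ?_⟩
  have hn : 1 ≤ n := by have := v₀.2; omega
  have hM : 2 ≤ n + a + b + 1 := by omega
  -- The base of the power is at least `2`, so its square exceeds it. Each of the five factors of
  -- the table size is bounded by this square, hence the exponent `10`.
  have hsq : ∀ y, y ≤ n + a + b + 2 → y ≤ (n + a + b + 1) ^ 2 := fun y hy => by nlinarith
  have hW : (a + 2) * (n + 2) * (n + 2) * (n + 2) * (n + 2) ≤ (n + a + b + 1) ^ 10 := by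
    have h1 := hsq (a + 2) (by omega)
    have h2 := hsq (n + 2) (by omega)
    calc (a + 2) * (n + 2) * (n + 2) * (n + 2) * (n + 2)
        ≤ (n + a + b + 1) ^ 2 * (n + a + b + 1) ^ 2 * (n + a + b + 1) ^ 2 *
          (n + a + b + 1) ^ 2 * (n + a + b + 1) ^ 2 := by gcongr
      _ = (n + a + b + 1) ^ 10 := by ring
  have hb : b ≤ (n + a + b + 1) ^ 10 :=
    le_trans (by omega) (Nat.le_self_pow (by omega) (n + a + b + 1))
  obtain ⟨t, s', h1, h2, h3⟩ := RAM.wp_subtreeProg hG v₀ a b hW hb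
  exact ⟨t, s', h1, h2, h3⟩
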